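/- Let $L=\bigoplus_{j\ge 1}\mathcal V_j$ be a finite-dimensional real Lie algebra with a positive grading, $[\mathcal V_i,\mathcal V_j]\subset\mathcal V_{i+j}$, which is nilpotent of step at most $s$: $\mathcal G_{s+1}=0$, where $\mathcal G_1=L$, $\mathcal G_{j+1}=[\mathcal G_j,L]$. Let $H$ be the corresponding simply connected graded nilpotent Lie group, identified with $L$ by the exponential map: its product $xy$ is given by the Baker–Campbell–Hausdorff formula, and $x^{-1}=-x$. Write $x=x_1+x_2+\cdots$ with $x_j\in\mathcal V_j$, $\tilde\pi(x)=x_1$, and $\delta_\lambda(x)=\sum_j\lambda^j x_j$ for $\lambda\ge 0$. Let $\rho:H\to[0,\infty)$ be a homogeneous norm, that is, a continuous function with $\rho(x^{-1})=\rho(x)$, $\rho(\delta_\lambda x)=\lambda\rho(x)$ and $\rho(x)=0\Leftrightarrow x=0$ (no triangle inequality is assumed), and let $d(x,y)=\rho(x^{-1}y)$ be the associated homogeneous quasi-metric. Put $NH(x)=d(\tilde\pi(x),x)$. For $q>0$, $(H,d)$ is called Markov $q$-convex if there is a constant $\Pi$ such that for every Markov chain $\{X_t\}_{t\in\mathbb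 Z}$ on a state space $\Omega$ and every $f:\Omega\to H$ (such that $(a,b)\mapsto d(f(a),f(b))$ is measurable on $\Omega\times\Omega$) $$\sum_{k=0}^\infty\sum_{t\in\mathbb Z}\frac{\mathbb E\big[d\big(f(X_t),f(\tilde X_t(t-2^k))\big)^q\big]}{2^{kq}}\le \Pi^q\sum_{t\in\mathbb Z}\mathbb E\big[d(f(X_{t-1}),f(X_t))^q\big],$$ where $\tilde X_t(k)$ equals $X_t$ for $t\le k$ and evolves independently of $X$, with the same transition probabilities, for $t>k$. **(1)** Suppose that for some $p\in[1,\infty)$, some $K\ge 1$ and the Euclidean norm $|\cdot|$ of some scalar product, all $x,y,z\in H$ satisfy $$\frac{d(x,y)^p+d(y,z)^p}{2}\ \ge\ \Big(\frac{d(x,z)}2\Big)^p+\frac1K\left(\Big|\frac{x_1+z_1}{2}-y_1\Big|^p+NH(x^{-1}z)^p\right).$$ Then $(H,d)$ is Markov $(p\cdot s!)$-convex. **(2)** Without the convexity assumption in (1), there is always some $q\in(0,\infty)$ such that $(H,d)$ is Markov $q$-convex. In particular, every Carnot group (the case in which $\mathcal V_1$ generates $L$), with any homogeneous quasi-metric,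 has nontrivial Markov convexity. -/

import Mathlib

open MeasureTheory ProbabilityTheory
open scoped ENNReal NNReal

universe u v

/-! ## Simply connected graded nilpotent Lie groups

A simply connected nilpotent Lie group is identified with its Lie algebra `L` through the exponential
map: the points of the group are the elements of `L`, the product is given by the
Baker-Campbell-Hausdorff formula, the identity is `0` and the inverse of `x` is `-x`. -/

/-- A positive grading `L = V₁ ⊕ V₂ ⊕ ⋯` of a real Lie algebra, with `[Vᵢ, Vⱼ] ⊆ Vᵢ₊ⱼ`. The layers are
indexed by `ℕ` with `V₀ = 0`; if `L` is finite-dimensional then only finitely many layers are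
nonzero. -/
structure LieGrading (L : Type v) [LieRing L] [LieAlgebra ℝ L] where
  layer : ℕ → Submodule ℝ L
  layer_zero : layer 0 = ⊥
  isInternal : DirectSum.IsInternal layer
  lie_mem : ∀ (i j : ℕ) (x y : L), x ∈ layer i → y ∈ layer j → ⁅x, y⁆ ∈ layer (i + j)

/-- The right-nested bracket `[w₁, [w₂, … [wₘ₋₁, wₘ] … ]]` of a word. -/
def nestedBracket {L : Type v} [LieRing L] : List L → L
  | [] => 0
  | [w] => w
  | w :: w' :: l => ⁅w, nestedBracket (w' :: l)⁆

/-- The Baker-Campbell-Hausdorff series in Dynkin's form, up to brackets of length `N`: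
`∑ₙ (-1)ⁿ⁻¹ / n ∑ [x^{r₁} y^{s₁} ⋯ x^{rₙ} y^{sₙ}] / (∑ᵢ (rᵢ + sᵢ) · ∏ᵢ rᵢ! sᵢ!)`,
where the inner sum is over `rᵢ + sᵢ > 0` (here `rᵢ = (a i).1`, `sᵢ = (a i).2`), and
`[x^{r₁} y^{s₁} ⋯]` is the right-nested bracket of the word with `r₁` letters `x`, then `s₁` letters
`y`, and so on. If `L` is nilpotent of step at most `N`, all longer brackets vanish and this is the
whole series, i.e. the product `x · y` of the Lie group. -/
noncomputable def bch {L : Type v} [LieRing L] [LieAlgebra ℝ L] (N : ℕ) (x y : L) : L :=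
  ∑ n ∈ Finset.Icc 1 N,
    ∑ a : Fin n → Fin (N + 1) × Fin (N + 1) with
        (∀ i, 0 < ((a i).1 : ℕ) + ((a i).2 : ℕ)) ∧ ∑ i, (((a i).1 : ℕ) + ((a i).2 : ℕ)) ≤ N,
      ((-1 : ℝ) ^ (n - 1) / (n : ℝ)
          / ((∑ i, (((a i).1 : ℕ) + ((a i).2 : ℕ)) : ℕ) : ℝ)
          / (∏ i, ((((a i).1 : ℕ).factorial : ℝ) * (((a i).2 : ℕ).factorial : ℝ)))) •
        nestedBracket
          (List.ofFn fun i => List.replicate ((a i).1 : ℕ) x ++ List.replicate ((a i).2 : ℕ) y).flatten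

/-- `d(x, y) = ρ(x⁻¹ y)` in the nilpotent Lie group of step at most `s` with Lie algebra `L`. -/
noncomputable def leftInvDist {L : Type v} [LieRing L] [LieAlgebra ℝ L] (s : ℕ) (ρ : L → ℝ)
    (x y : L) : ℝ :=
  ρ (bch s (-x) y)

namespace LieGrading

variable {L : Type v} [LieRing L] [LieAlgebra ℝ L]

/-- The decomposition of the elements of `L` into their components in the layers. -/
noncomputable def decomp (G : LieGrading L) : L ≃ₗ[ℝ] DirectSum ℕ (fun i => G.layer i) :=
  (LinearEquiv.ofBijective (DirectSum.coeLinearMap G.layer) G.isInternal).symm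

/-- The horizontal projection `x = (x₁, x₂, …) ↦ x₁ = (x₁, 0, 0, …)`. -/
noncomputable def horiz (G : LieGrading L) (x : L) : L := (G.decomp x 1 : L)

/-- The dilation `δ_c (x₁ + x₂ + x₃ + ⋯) = c x₁ + c² x₂ + c³ x₃ + ⋯`. -/
noncomputable def dilation (G : LieGrading L) (c : ℝ) : L →ₗ[ℝ] L :=
  DirectSum.toModule ℝ ℕ L (fun i => c ^ i • (G.layer i).subtype) ∘ₗ G.decomp.toLinearMap

/-- `ρ` is a homogeneous norm; the triangle inequality is not required. -/
structure IsHomogeneousNorm (G : LieGrading L) [TopologicalSpace L] (ρ : L → ℝ) : Prop where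
  continuous : Continuous ρ
  nonneg : ∀ x, 0 ≤ ρ x
  inv : ∀ x, ρ (-x) = ρ x
  dilation : ∀ (c : ℝ) (x : L), 0 ≤ c → ρ (G.dilation c x) = c * ρ x
  eq_zero_iff : ∀ x, ρ x = 0 ↔ x = 0

/-- `NH(x) = d(x₁, x)`, which measures how far `x` is from being horizontal. -/
noncomputable def nonhoriz (G : LieGrading L) (s : ℕ) (ρ : L → ℝ) (x : L) : ℝ :=
  leftInvDist s ρ (G.horiz x) x

/-- The convexity inequality
`(d(x,y)^p + d(y,z)^p) / 2 ≥ (d(x,z) / 2)^p + (|(x₁ + z₁) / 2 - y₁|^p + NH(x⁻¹ z)^p) / K`,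
where `|·|` is the Euclidean norm of the scalar product `ip`. -/
def SatisfiesConvexity (G : LieGrading L) (s : ℕ) (ρ : L → ℝ) (ip : InnerProductSpace.Core ℝ L)
    (p K : ℝ) : Prop :=
  ∀ x y z : L,
    (leftInvDist s ρ x z / 2) ^ p
        + 1 / K *
          (√(ip.inner ((1 / 2 : ℝ) • (G.horiz x + G.horiz z) - G.horiz y)
              ((1 / 2 : ℝ) • (G.horiz x + G.horiz z) - G.horiz y)) ^ p
            + G.nonhoriz s ρ (bch s (-x) z) ^ p)
      ≤ (leftInvDist s ρ x y ^ p + leftInvDist s ρ y z ^ p) / 2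

end LieGrading

/-! ## Markov convexity -/

/-- A Markov chain `(X_t)_{t ∈ ℤ}` on a measurable state space (with discrete spaces as a special
case), given by its transition probabilities `step t x A = P(X_{t+1} ∈ A | X_t = x)` and by the laws
of the `X_t`. -/
structure MarkovChain (Ω : Type u) [MeasurableSpace Ω] where
  law : ℤ → Measure Ω
  step : ℤ → Kernel Ω Ω
  isProbabilityMeasure_law : ∀ t, IsProbabilityMeasure (law t)
  isMarkovKernel_step : ∀ t, IsMarkovKernel (step t)
  law_succ : ∀ t, (law t).bind (step t) = law (t + 1)

namespace MarkovChain

variable {Ω : Type u} [MeasurableSpace Ω]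

/-- The transition probabilities over `m` steps, from time `t` to time `t + m`. -/
noncomputable def trans (X : MarkovChain Ω) (t : ℤ) : ℕ → Kernel Ω Ω
  | 0 => Kernel.id
  | m + 1 => X.step (t + m) ∘ₖ X.trans t m

/-- `E[g(X_t, X_{t+1})]`. -/
noncomputable def expectStep (X : MarkovChain Ω) (t : ℤ) (g : Ω → Ω → ℝ≥0∞) : ℝ≥0∞ :=
  ∫⁻ x, ∫⁻ y, g x y ∂(X.step t x) ∂(X.law t)

/-- `E[g(X_{t+m}, X̃_{t+m}(t))]`, where `X̃(t)` agrees with `X` up to time `t` and evolves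
independently of `X`, with the same transition probabilities, after time `t`: given `X_t = x`, the
variables `X_{t+m}` and `X̃_{t+m}(t)` are independent and both have the law `X.trans t m x`. -/
noncomputable def expectBranch (X : MarkovChain Ω) (t : ℤ) (m : ℕ) (g : Ω → Ω → ℝ≥0∞) : ℝ≥0∞ :=
  ∫⁻ x, ∫⁻ y, ∫⁻ y', g y y' ∂(X.trans t m x) ∂(X.trans t m x) ∂(X.law t)

end MarkovChain

/-- Markov `q`-convexity of a set `E` with a distance function `d`. The functions `f` are those for
which the expectations are meaningful; on a countable discrete state space these are all
functions. -/
def IsMarkovConvex {E : Type v} (d : E → E → ℝ) (q : ℝ) : Prop :=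
  ∃ C : ℝ≥0, ∀ (Ω : Type u) [MeasurableSpace Ω] (X : MarkovChain Ω) (f : Ω → E),
    Measurable (fun a : Ω × Ω => d (f a.1) (f a.2)) →
      ∑' k : ℕ, ∑' t : ℤ,
          X.expectBranch (t - 2 ^ k) (2 ^ k) (fun a b => ENNReal.ofReal (d (f a) (f b) ^ q))
            / (2 : ℝ≥0∞) ^ ((k : ℝ) * q)
        ≤ (C : ℝ≥0∞) ^ q *
          ∑' t : ℤ, X.expectStep (t - 1) (fun a b => ENNReal.ofReal (d (f a) (f b) ^ q))

/-! Markov convexity is deduced from a four point inequality. Let `N ≥ 0` be continuous with `N ≤ C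
ρ^q` and `2 (N(x⁻¹z) + N(x⁻¹w) + κ d(z,w)^q) ≤ 2^q (2 N(x⁻¹y) + N(y⁻¹z) + N(y⁻¹w))`. Take for `x`,
`y` the values at times `t` and `t + 2^k`, and for `z`, `w` two conditionally independent
continuations to time `t + 2^(k+1)`. After taking expectations and summing over `t`, the branching
term at scale `2^k` is bounded by a decrement of `2^(-kq) ∑ E N(X_t⁻¹ X_{t+2^k})`, and these
decrements telescope (`tsum_expectBranch_le`, `isMarkovConvex_of_four_point`).

The four point inequality comes from a midpoint inequality `N(uv) / 2^p + κ (|u₁ - v₁|^p + NH(uv)^p)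
≤ (N(u) + N(v)) / 2` with `N` comparable to `ρ^p`. Apply it to `a = x⁻¹z = (x⁻¹y)(y⁻¹z)` and to `b =
x⁻¹w`. The two deficits control `NH(a)`, `NH(b)` and, by the triangle inequality, `|a₁ - b₁|`. Now
`d(z,w) = ρ(a⁻¹b)` is bounded by `NH(a)`, `NH(b)` and the distance of `a₁` from `b₁`, but the latter
is only Hölder in `|a₁ - b₁|`: at scale `R` its power `p s!` is at most a multiple of `|a₁ - b₁|^p
R^(p(s!-1))`. Raising the midpoint inequality to the power `s!` produces exactly terms of this shape
(`isMarkovConvex_of_midpoint`). In (1), `N = ρ^p`, and the assumed convexity with `y` the identity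
is the midpoint inequality.

For (2), a suitable `N` is built layer by layer: `F₁ = |x₁|²`, and `F_{j+1} = F_j^(j+1) + ε
|x_{j+1}|^m` with `m` the degree of `F_j`. Here `(uv)_{j+1}` is `u_{j+1} + v_{j+1}` plus a term in
the lower layers. That term vanishes when `u` and `v` are the same horizontal element, so it is
controlled by the deviation from this situation, which the inequality for `F_j` pays for. The sum
`u_{j+1} + v_{j+1}` is harmless because doubling scales layer `j + 1` by at least `4`. A power of
the last `F` serves as `N`.

That the truncated Dynkin series is a group law is proved in an associative algebra where long words
vanish, by differentiating `log(e^{tx} e^{ty})` in `t`, and is transported to `L` by a faithful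
nilpotent representation. -/

section NilpotentEvaluation

/-! ### Power series at nilpotent elements; exponential and logarithm -/

namespace PowerSeries

variable {R : Type*} [Ring R] [Algebra ℝ R]

/-- The discarded terms are multiples of `b ^ K = 0`. This is what makes truncated evaluation
multiplicative. -/
theorem aeval_trunc_of_pow_eq_zero {b : R} {K : ℕ} (hb : b ^ K = 0) (p : Polynomial ℝ) :
    Polynomial.aeval b (trunc K (p : ℝ⟦X⟧)) = Polynomial.aeval b p := by
  have h1 : Polynomial.aeval b p = ∑ i ∈ Finset.range (max K (p.natDegree + 1)), p.coeff i • b ^ i :=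
    Polynomial.aeval_eq_sum_range' (lt_of_lt_of_le (Nat.lt_succ_self _) (le_max_right _ _)) b
  have h2 : Polynomial.aeval b (trunc K (p : ℝ⟦X⟧))
      = ∑ i ∈ Finset.range K, p.coeff i • b ^ i := by
    rw [trunc_apply, map_sum, Finset.range_eq_Ico]
    simp [Polynomial.aeval_monomial, Algebra.smul_def]
  rw [h1, h2]
  refine Finset.sum_subset (fun i hi => ?_) (fun i _ hi => ?_)
  · simp only [Finset.mem_range, lt_max_iff] at *
    exact Or.inl hi
  · rw [pow_eq_zero_of_le (by simpa using hi) hb, smul_zero]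

/-- Evaluation of a formal power series at a nilpotent element. -/
noncomputable def nilEval (b : R) (hb : IsNilpotent b) : ℝ⟦X⟧ →ₐ[ℝ] R where
  toFun f := Polynomial.aeval b (trunc (nilpotencyClass b) f)
  map_one' := by
    have := aeval_trunc_of_pow_eq_zero (pow_nilpotencyClass hb) 1
    simpa using this
  map_zero' := by simp
  map_add' f g := by simp
  map_mul' f g := by
    rw [← map_mul, ← trunc_trunc_mul_trunc, ← Polynomial.coe_mul,
      aeval_trunc_of_pow_eq_zero (pow_nilpotencyClass hb)]
  commutes' r := by
    have := aeval_trunc_of_pow_eq_zero (pow_nilpotencyClass hb) (Polynomial.C r)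
    simpa using this

theorem nilEval_coe {b : R} (hb : IsNilpotent b) (p : Polynomial ℝ) :
    nilEval b hb p = Polynomial.aeval b p :=
  aeval_trunc_of_pow_eq_zero (pow_nilpotencyClass hb) p

theorem nilEval_X {b : R} (hb : IsNilpotent b) : nilEval b hb X = b := by
  simpa using nilEval_coe hb Polynomial.X

theorem nilEval_of_X_pow_dvd {b : R} (hb : IsNilpotent b) {K : ℕ} (hK : b ^ K = 0) {f : ℝ⟦X⟧}
    (hf : X ^ K ∣ f) : nilEval b hb f = 0 := by
  obtain ⟨g, rfl⟩ := hf
  simp [nilEval_X, hK]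

theorem X_pow_dvd_sub_trunc (K : ℕ) (f : ℝ⟦X⟧) : X ^ K ∣ f - (trunc K f : ℝ⟦X⟧) := by
  rw [X_pow_dvd_iff]
  intro m hm
  simp [coeff_trunc, hm]

theorem nilEval_eq_aeval_trunc {b : R} (hb : IsNilpotent b) {K : ℕ} (hK : b ^ K = 0) (f : ℝ⟦X⟧) :
    nilEval b hb f = Polynomial.aeval b (trunc K f) := by
  rw [← nilEval_coe hb, ← sub_eq_zero, ← map_sub]
  exact nilEval_of_X_pow_dvd hb hK (X_pow_dvd_sub_trunc K f)

theorem nilEval_eq_sum {b : R} (hb : IsNilpotent b) {K : ℕ} (hK : b ^ K = 0) (f : ℝ⟦X⟧) :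
    nilEval b hb f = ∑ i ∈ Finset.range K, coeff i f • b ^ i := by
  rw [nilEval_eq_aeval_trunc hb hK, trunc_apply, map_sum, Finset.range_eq_Ico]
  simp [Polynomial.aeval_monomial, Algebra.smul_def]

theorem nilEval_pow_eq_zero {b : R} (hb : IsNilpotent b) {K : ℕ} (hK : b ^ K = 0) {g : ℝ⟦X⟧}
    (hg : constantCoeff g = 0) : nilEval b hb g ^ K = 0 := by
  rw [← map_pow]
  exact nilEval_of_X_pow_dvd hb hK (pow_dvd_pow_of_dvd (X_dvd_iff.2 hg) K)

theorem isNilpotent_nilEval {b : R} (hb : IsNilpotent b) {g : ℝ⟦X⟧}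
    (hg : constantCoeff g = 0) : IsNilpotent (nilEval b hb g) :=
  ⟨_, nilEval_pow_eq_zero hb (pow_nilpotencyClass hb) hg⟩

/-- Modulo `X ^ K` the series `f` is a polynomial, for which substitution and evaluation commute;
the tail becomes divisible by `g ^ K`, which evaluates to zero. -/
theorem nilEval_subst {b : R} (hb : IsNilpotent b) {g : ℝ⟦X⟧} (hg : constantCoeff g = 0)
    (f : ℝ⟦X⟧) : nilEval b hb (f.subst g) = nilEval _ (isNilpotent_nilEval hb hg) f := by
  have hs : HasSubst g := HasSubst.of_constantCoeff_zero' hg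
  obtain ⟨K, hK⟩ := id hb
  obtain ⟨h, hh⟩ := X_pow_dvd_sub_trunc K f
  rw [nilEval_eq_aeval_trunc (isNilpotent_nilEval hb hg) (nilEval_pow_eq_zero hb hK hg) f]
  have e : f.subst g = Polynomial.aeval g (trunc K f) + g ^ K * h.subst g := by
    conv_lhs => rw [eq_add_of_sub_eq' hh]
    rw [subst_add hs, subst_mul hs, subst_pow hs, subst_X hs, subst_coe hs]
  rw [e, map_add, map_mul, map_pow, nilEval_pow_eq_zero hb hK hg, zero_mul, add_zero,
    Polynomial.aeval_algHom_apply]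

/-- Both sides have zero constant term, and the chain rule gives derivative `(1 + X)⁻¹ ∘ (e^X - 1) ·
e^X = 1`. -/
theorem log_subst_exp_sub_one : (log ℝ).subst (exp ℝ - 1) = (X : ℝ⟦X⟧) := by
  have hs : HasSubst (exp ℝ - 1) := HasSubst.exp_sub_one
  refine derivative.ext ?_ ?_
  · have h1 : d⁄dX ℝ (log ℝ) * (1 + X) = 1 := by
      rw [deriv_log]
      ext n
      rcases n with _ | n
      · simp
      · rw [mul_add, mul_one, map_add, coeff_succ_mul_X]
        simp [pow_succ, coeff_one]
    have h2 := congrArg (fun f : ℝ⟦X⟧ => f.subst (exp ℝ - 1)) h1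
    simp only [subst_mul hs, subst_add hs, subst_X hs] at h2
    have h3 : (1 : ℝ⟦X⟧).subst (exp ℝ - 1) = (1 : ℝ⟦X⟧) := by
      rw [← coe_substAlgHom hs, map_one]
    rw [h3] at h2
    rw [derivative_subst hs, map_sub, derivative_exp, derivative_one, sub_zero, derivative_X]
    simpa using h2
  · rw [constantCoeff_X]
    exact constantCoeff_subst_eq_zero (a := (exp ℝ - 1 : ℝ⟦X⟧))
      (by rw [← constantCoeff_eq]; simp) _ constantCoeff_log

/-- The series `e^X - 1` has an invertible linear coefficient, hence a right compositional inverse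
`Q`; the left inverse `log` must coincide with it. -/
theorem exp_subst_log : (exp ℝ).subst (log ℝ) = (1 + X : ℝ⟦X⟧) := by
  have hs : HasSubst (exp ℝ - 1) := HasSubst.exp_sub_one
  have hl : HasSubst (log ℝ) := HasSubst.log
  have hc : constantCoeff (exp ℝ - 1) = 0 := by simp
  have hu : IsUnit (coeff 1 (exp ℝ - 1)) := by simp [coeff_one]
  obtain ⟨Q, hq, h1⟩ : ∃ Q : ℝ⟦X⟧, HasSubst Q ∧ (exp ℝ - 1).subst Q = (X : ℝ⟦X⟧) :=
    ⟨_, HasSubst.substInvOfIsUnit _ hu, subst_substInvOfIsUnit_right _ hc hu⟩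
  have h2 : log ℝ = Q := by
    have := congrArg (fun f : ℝ⟦X⟧ => f.subst Q) log_subst_exp_sub_one
    simpa only [subst_comp_subst_apply hs hq, h1, X_subst, subst_X hq] using this
  have h4 : (1 : ℝ⟦X⟧).subst (log ℝ) = (1 : ℝ⟦X⟧) := by rw [← coe_substAlgHom hl, map_one]
  rw [← h2, subst_sub hl, h4, sub_eq_iff_eq_add'] at h1
  exact h1

variable [Module ℚ R]

theorem nilEval_exp {b : R} (hb : IsNilpotent b) : nilEval b hb (exp ℝ) = IsNilpotent.exp b := by
  obtain ⟨K, hK⟩ := id hb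
  rw [nilEval_eq_sum hb hK, IsNilpotent.exp_eq_sum hK]
  refine Finset.sum_congr rfl fun i _ => ?_
  rw [← Rat.cast_smul_eq_qsmul ℝ]
  simp [coeff_exp]

/-- The logarithm of a unipotent element. -/
noncomputable def nilLog (a : R) (ha : IsNilpotent (a - 1)) : R := nilEval (a - 1) ha (log ℝ)

omit [Module ℚ R] in
theorem isNilpotent_nilLog {a : R} (ha : IsNilpotent (a - 1)) : IsNilpotent (nilLog a ha) :=
  isNilpotent_nilEval ha constantCoeff_log

theorem exp_nilLog {a : R} (ha : IsNilpotent (a - 1)) : IsNilpotent.exp (nilLog a ha) = a := by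
  have := nilEval_subst ha constantCoeff_log (exp ℝ)
  rw [exp_subst_log, map_add, map_one, nilEval_X, nilEval_exp] at this
  rw [nilLog, ← this]
  abel

theorem nilLog_exp {b : R} (hb : IsNilpotent b) :
    nilLog (IsNilpotent.exp b) (IsNilpotent.isNilpotent_exp_sub_one hb) = b := by
  have hc : constantCoeff (exp ℝ - 1) = 0 := by simp
  have := nilEval_subst hb hc (log ℝ)
  rw [log_subst_exp_sub_one, nilEval_X] at this
  conv_rhs => rw [this]
  simp only [nilLog, map_sub, map_one, nilEval_exp]

theorem exp_injOn_isNilpotent : Set.InjOn (IsNilpotent.exp : R → R) {b | IsNilpotent b} := by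
  intro a ha b hb h
  rw [← nilLog_exp ha, ← nilLog_exp hb]
  simp only [h]

end PowerSeries

end NilpotentEvaluation

/-! ### Derivations of exponentials and logarithms -/

section LogarithmicDerivative

attribute [local instance] LieRing.ofAssociativeRing

open Finset

/-- A Cauchy product of two finite sums: the vanishing hypotheses remove every antidiagonal term
outside the square. -/
theorem sum_range_mul_range_eq_sum_antidiagonal {M : Type*} [AddCommMonoid M] {K N : ℕ}
    (hN : 2 * K ≤ N) (f : ℕ → ℕ → M) (h₁ : ∀ i j, K ≤ i → f i j = 0) (h₂ : ∀ i j, K ≤ j → f i j = 0) :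
    ∑ i ∈ range K, ∑ j ∈ range K, f i j
      = ∑ m ∈ range N, ∑ ij ∈ antidiagonal m, f ij.1 ij.2 := by
  rw [← sum_product' (range K) (range K) f]
  have hmaps : ∀ p ∈ range K ×ˢ range K, p.1 + p.2 ∈ range N := by
    intro p hp
    simp only [mem_product, mem_range] at hp ⊢
    omega
  rw [← sum_fiberwise_of_maps_to hmaps]
  refine sum_congr rfl fun m _ => ?_
  refine sum_subset (fun p hp => ?_) (fun p hp hp' => ?_)
  · simp only [mem_filter] at hp
    simp [hp.2]
  · rw [HasAntidiagonal.mem_antidiagonal] at hp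
    simp only [mem_filter, mem_product, mem_range, not_and] at hp'
    by_contra hne
    have a1 : p.1 < K := by
      by_contra h
      exact hne (h₁ _ _ (by omega))
    have a2 : p.2 < K := by
      by_contra h
      exact hne (h₂ _ _ (by omega))
    exact hp' ⟨a1, a2⟩ hp

namespace PowerSeries

/-- The power series `(exp X - 1) / X`. -/
noncomputable def expSubOneDivX : ℝ⟦X⟧ := mk fun n => ((n + 1).factorial : ℝ)⁻¹

/-- The power series `log (1 + X) / X`. -/
noncomputable def logDivX : ℝ⟦X⟧ := mk fun n => (-1 : ℝ) ^ n / (n + 1)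

theorem X_mul_expSubOneDivX : X * expSubOneDivX = exp ℝ - 1 := by
  ext n
  rcases n with _ | n
  · simp
  · simp [expSubOneDivX, coeff_succ_X_mul, coeff_exp, coeff_one]

theorem X_mul_logDivX : X * logDivX = log ℝ := by
  ext n
  rcases n with _ | n
  · simp
  · simp [logDivX, coeff_succ_X_mul, pow_succ]

/-- Cancel `X` in `log ∘ (e^X - 1) = X`. This inverts the operator `(e^{ad Z} - 1) / ad Z` that
appears in the derivative of `e^Z`. -/
theorem logDivX_subst_mul_expSubOneDivX :
    logDivX.subst (exp ℝ - 1) * expSubOneDivX = 1 := by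
  have hs : HasSubst (exp ℝ - 1) := HasSubst.exp_sub_one
  have h := log_subst_exp_sub_one
  rw [← X_mul_logDivX, subst_mul hs, subst_X hs, ← X_mul_expSubOneDivX] at h
  have h' : X * (logDivX.subst (X * expSubOneDivX) * expSubOneDivX) = X * (1 : ℝ⟦X⟧) := by
    rw [mul_one]
    conv_rhs => rw [← h]
    ring
  have := mul_left_cancel₀ X_ne_zero h'
  rwa [X_mul_expSubOneDivX] at this

end PowerSeries

open PowerSeries LinearMap

variable {R : Type*} [Ring R] [Algebra ℝ R]

variable [Module ℚ R]

theorem exp_mulLeft {Z : R} (hZ : IsNilpotent Z) :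
    IsNilpotent.exp (mulLeft ℝ Z) = mulLeft ℝ (IsNilpotent.exp Z) := by
  have := IsNilpotent.map_exp hZ (Algebra.lmul ℝ R)
  exact this.symm

theorem exp_mulRight {Z : R} (hZ : IsNilpotent Z) :
    IsNilpotent.exp (mulRight ℝ Z) = mulRight ℝ (IsNilpotent.exp Z) := by
  obtain ⟨K, hK⟩ := hZ
  have hK' : mulRight ℝ Z ^ K = 0 := by rw [LinearMap.pow_mulRight, hK]; ext; simp
  ext x
  rw [IsNilpotent.exp_eq_sum hK, IsNilpotent.exp_eq_sum hK']
  simp [LinearMap.pow_mulRight, mul_sum, LinearMap.sum_apply, mul_smul_comm]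

/-- `e^{ad Z} x = e^Z x e^{-Z}`. -/
theorem exp_ad_apply {Z : R} (hZ : IsNilpotent Z) (x : R) :
    IsNilpotent.exp (LieAlgebra.ad ℝ R Z) x = IsNilpotent.exp Z * x * IsNilpotent.exp (-Z) := by
  have h : mulLeft ℝ Z - mulRight ℝ Z = mulLeft ℝ Z + mulRight ℝ (-Z) := by
    ext x; simp [sub_eq_add_neg]
  rw [LieAlgebra.ad_eq_lmul_left_sub_lmul_right, Pi.sub_apply, h, IsNilpotent.exp_add_of_commute
    (LinearMap.commute_mulLeft_right Z (-Z)) ((LinearMap.isNilpotent_mulLeft_iff ℝ Z).2 hZ)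
    ((LinearMap.isNilpotent_mulRight_iff ℝ (-Z)).2 hZ.neg), exp_mulLeft hZ, exp_mulRight hZ.neg]
  simp [mul_assoc]

variable (D : R →ₗ[ℝ] R) (hD : ∀ a b, D (a * b) = D a * b + a * D b)

include hD

omit [Module ℚ R] in
-- Moving all factors `Z` to the right by `Z w = [Z, w] + w Z` gives `D(Z^(n+1))` with binomial
-- coefficients; the factorials turn these into the coefficients of a Cauchy product.
theorem derivation_pow_succ (Z : R) (n : ℕ) :
    ((n + 1).factorial : ℝ)⁻¹ • D (Z ^ (n + 1)) = ∑ ij ∈ antidiagonal n,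
      (ij.2.factorial : ℝ)⁻¹ • ((ij.1 + 1).factorial : ℝ)⁻¹ •
        ((LieAlgebra.ad ℝ R Z ^ ij.1) (D Z) * Z ^ ij.2) := by
  have key : ∀ n : ℕ, D (Z ^ (n + 1)) = ∑ k ∈ range (n + 1), ((n + 1).choose (k + 1) : ℝ) •
      ((LieAlgebra.ad ℝ R Z ^ k) (D Z) * Z ^ (n - k)) := by
    intro n
    induction n with
    | zero => simp
    | succ n ih =>
      have hL : ∀ k, Z * ((LieAlgebra.ad ℝ R Z ^ k) (D Z) * Z ^ (n - k))
          = (LieAlgebra.ad ℝ R Z ^ (k + 1)) (D Z) * Z ^ (n - k)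
            + (LieAlgebra.ad ℝ R Z ^ k) (D Z) * Z ^ (n - k + 1) := by
        intro k
        rw [pow_succ' (LieAlgebra.ad ℝ R Z) k, Module.End.mul_apply, LieAlgebra.ad_apply,
          LieRing.of_associative_ring_bracket, pow_succ' Z (n - k)]
        noncomm_ring
      rw [pow_succ', hD, ih, mul_sum]
      simp only [mul_smul_comm, hL, smul_add, sum_add_distrib]
      rw [sum_range_succ (fun k => ((n + 1).choose (k + 1) : ℝ) •
          ((LieAlgebra.ad ℝ R Z ^ (k + 1)) (D Z) * Z ^ (n - k))),
        sum_range_succ' (fun k => ((n + 1 + 1).choose (k + 1) : ℝ) • _),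
        sum_range_succ' (fun k => ((n + 1).choose (k + 1) : ℝ) •
          ((LieAlgebra.ad ℝ R Z ^ k) (D Z) * Z ^ (n - k + 1))), sum_range_succ (n := n) (f := fun k => ((n + 1 + 1).choose (k + 1 + 1) : ℝ) • _)]
      -- Pascal's rule separates the coefficients of the bracketed terms from those of the terms
      -- with `Z` moved to the right.
      have hs : ∀ k ∈ range n, ((n + 1 + 1).choose (k + 1 + 1) : ℝ) •
            ((LieAlgebra.ad ℝ R Z ^ (k + 1)) (D Z) * Z ^ (n + 1 - (k + 1)))
          = ((n + 1).choose (k + 1) : ℝ) •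
              ((LieAlgebra.ad ℝ R Z ^ (k + 1)) (D Z) * Z ^ (n - k))
            + ((n + 1).choose (k + 1 + 1) : ℝ) •
              ((LieAlgebra.ad ℝ R Z ^ (k + 1)) (D Z) * Z ^ (n - (k + 1) + 1)) := by
        intro k hk
        have hk' := mem_range.1 hk
        rw [Nat.choose_succ_succ (n + 1) (k + 1), Nat.cast_add, add_smul,
          show n + 1 - (k + 1) = n - k by omega, show n - (k + 1) + 1 = n - k by omega]
      rw [sum_congr rfl hs, sum_add_distrib]
      simp only [Nat.choose_self, Nat.sub_self, Nat.cast_one, one_smul, zero_add,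
        Nat.choose_one_right, pow_zero, Module.End.one_apply, Nat.sub_zero]
      push_cast
      rw [add_smul ((n : ℝ) + 1) 1, one_smul]
      abel
  rw [key, Finset.Nat.sum_antidiagonal_eq_sum_range_succ (fun i j =>
    (j.factorial : ℝ)⁻¹ • ((i + 1).factorial : ℝ)⁻¹ •
        ((LieAlgebra.ad ℝ R Z ^ i) (D Z) * Z ^ j)), smul_sum]
  refine sum_congr rfl fun k hk => ?_
  have hk' : k + 1 ≤ n + 1 := by simpa using hk
  rw [smul_smul, smul_smul]
  congr 1
  have := Nat.choose_mul_factorial_mul_factorial hk'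
  have h2 : ((n + 1).choose (k + 1) : ℝ) * ((k + 1).factorial : ℝ) * ((n - k).factorial : ℝ)
      = ((n + 1).factorial : ℝ) := by
    rw [← this]
    push_cast
    rfl
  have p1 : ((k + 1).factorial : ℝ) ≠ 0 := by positivity
  have p2 : ((n - k).factorial : ℝ) ≠ 0 := by positivity
  have p3 : ((n + 1).factorial : ℝ) ≠ 0 := by positivity
  field_simp
  rw [← h2]
  ring

/-- Summing the formulas for `D(Z^(n+1))` over `n` gives the Cauchy product of the series of `(e^{ad
Z} - 1) / ad Z`, applied to `D Z`, with that of `e^Z`. -/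
theorem derivation_exp {Z : R} (hZ : IsNilpotent Z) :
    D (IsNilpotent.exp Z) = nilEval (LieAlgebra.ad ℝ R Z) (LieAlgebra.ad_nilpotent_of_nilpotent hZ) expSubOneDivX (D Z)
      * IsNilpotent.exp Z := by
  have hD1 : D 1 = 0 := by simpa using hD 1 1
  obtain ⟨K₁, hK₁⟩ := id hZ
  have ha : IsNilpotent (LieAlgebra.ad ℝ R Z) := LieAlgebra.ad_nilpotent_of_nilpotent hZ
  obtain ⟨K₂, hK₂⟩ := id ha
  set K := max K₁ K₂
  have hK₁' : Z ^ K = 0 := pow_eq_zero_of_le (le_max_left _ _) hK₁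
  have hK₂' : LieAlgebra.ad ℝ R Z ^ K = 0 := pow_eq_zero_of_le (le_max_right _ _) hK₂
  -- The constant term is killed by `D`, so cutting at `2 * K + 1` leaves `2 * K` terms, enough to
  -- contain the product of two sums of length `K`.
  have hN : Z ^ (2 * K + 1) = 0 := pow_eq_zero_of_le (by omega) hK₁'
  rw [nilEval_eq_sum _ hK₂']
  conv_rhs => rw [← nilEval_exp hZ, nilEval_eq_sum hZ hK₁']
  conv_lhs => rw [← nilEval_exp hZ, nilEval_eq_sum hZ hN]
  rw [map_sum, sum_range_succ', LinearMap.sum_apply, sum_mul_sum]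
  simp only [map_smul, pow_zero, hD1, smul_zero, add_zero, LinearMap.smul_apply, smul_mul_assoc,
    mul_smul_comm, coeff_exp, expSubOneDivX, coeff_mk, one_div, map_inv₀, map_natCast]
  rw [sum_range_mul_range_eq_sum_antidiagonal (le_refl (2 * K)) (fun i j =>
    (j.factorial : ℝ)⁻¹ • ((i + 1).factorial : ℝ)⁻¹ •
        ((LieAlgebra.ad ℝ R Z ^ i) (D Z) * Z ^ j))
    (fun i j hi => by rw [pow_eq_zero_of_le hi hK₂']; simp)
    (fun i j hj => by rw [pow_eq_zero_of_le hj hK₁']; simp)]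
  exact sum_congr rfl fun n _ => derivation_pow_succ D hD Z n

/-- Here `D X = X` commutes with `X`, so only the constant term of `(e^{ad X} - 1) / ad X` acts. -/
theorem derivation_exp_of_fixed {X : R} (hX : IsNilpotent X) (hDX : D X = X) :
    D (IsNilpotent.exp X) = X * IsNilpotent.exp X := by
  rw [derivation_exp D hD hX, hDX]
  congr 1
  have ha : IsNilpotent (LieAlgebra.ad ℝ R X) := LieAlgebra.ad_nilpotent_of_nilpotent hX
  obtain ⟨K, hK⟩ := id ha
  have hK' : LieAlgebra.ad ℝ R X ^ (K + 1) = 0 := by rw [pow_succ, hK, zero_mul]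
  rw [nilEval_eq_sum _ hK', sum_range_succ', LinearMap.add_apply, LinearMap.sum_apply,
    sum_eq_zero]
  · simp [expSubOneDivX]
  · intro i _
    rw [LinearMap.smul_apply, pow_succ, Module.End.mul_apply, LieAlgebra.ad_apply, lie_self,
      map_zero, smul_zero]

/-- Logarithmic derivative of a product of two exponentials. -/
theorem derivation_nilLog_exp_mul_exp {X Y : R} (hX : IsNilpotent X) (hY : IsNilpotent Y)
    (hDX : D X = X) (hDY : D Y = Y)
    (hG : IsNilpotent (IsNilpotent.exp X * IsNilpotent.exp Y - 1)) :
    ∃ K₀, ∀ K, K₀ ≤ K → D (nilLog _ hG) = ∑ n ∈ range K, ((-1 : ℝ) ^ n / (n + 1)) •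
      ((IsNilpotent.exp (LieAlgebra.ad ℝ R X) * IsNilpotent.exp (LieAlgebra.ad ℝ R Y) - 1) ^ n)
        (X + IsNilpotent.exp (LieAlgebra.ad ℝ R X) Y) := by
  set Z := nilLog _ hG
  have hZ : IsNilpotent Z := isNilpotent_nilLog hG
  have hE : IsNilpotent.exp Z = IsNilpotent.exp X * IsNilpotent.exp Y := exp_nilLog hG
  have haZ : IsNilpotent (LieAlgebra.ad ℝ R Z) := LieAlgebra.ad_nilpotent_of_nilpotent hZ
  have hinv : IsNilpotent.exp (-Z) = IsNilpotent.exp (-Y) * IsNilpotent.exp (-X) := by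
    have h1 : IsNilpotent.exp Z * (IsNilpotent.exp (-Y) * IsNilpotent.exp (-X)) = 1 := by
      rw [hE, mul_assoc, ← mul_assoc _ (IsNilpotent.exp (-Y)), IsNilpotent.exp_mul_exp_neg_self hY,
        one_mul, IsNilpotent.exp_mul_exp_neg_self hX]
    calc IsNilpotent.exp (-Z) = IsNilpotent.exp (-Z) *
          (IsNilpotent.exp Z * (IsNilpotent.exp (-Y) * IsNilpotent.exp (-X))) := by rw [h1, mul_one]
      _ = _ := by rw [← mul_assoc, IsNilpotent.exp_neg_mul_exp_self hZ, one_mul]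
  -- Both sides act as conjugation by `e^X e^Y = e^Z`.
  have hg : IsNilpotent.exp (LieAlgebra.ad ℝ R X) * IsNilpotent.exp (LieAlgebra.ad ℝ R Y)
      = IsNilpotent.exp (LieAlgebra.ad ℝ R Z) := by
    ext x
    rw [Module.End.mul_apply, exp_ad_apply hX, exp_ad_apply hY, exp_ad_apply hZ, hE, hinv]
    noncomm_ring
  -- Compute `D(e^Z)` once through `Z` and once by the product rule for `e^X e^Y`, and multiply by
  -- `e^{-Z}` on the right.
  have h1 : nilEval _ haZ expSubOneDivX (D Z) = X + IsNilpotent.exp (LieAlgebra.ad ℝ R X) Y := by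
    have h2 := derivation_exp D hD hZ
    rw [hE, hD, derivation_exp_of_fixed D hD hX hDX, derivation_exp_of_fixed D hD hY hDY] at h2
    have h3 := congrArg (· * (IsNilpotent.exp (-Y) * IsNilpotent.exp (-X))) h2
    have hYY := IsNilpotent.exp_mul_exp_neg_self hY
    have hXX := IsNilpotent.exp_mul_exp_neg_self hX
    have e1 : ∀ a : R, a * (IsNilpotent.exp X * IsNilpotent.exp Y)
        * (IsNilpotent.exp (-Y) * IsNilpotent.exp (-X)) = a := by
      intro a
      calc _ = a * (IsNilpotent.exp X * (IsNilpotent.exp Y * IsNilpotent.exp (-Y))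
            * IsNilpotent.exp (-X)) := by noncomm_ring
        _ = a := by rw [hYY, mul_one, hXX, mul_one]
    simp only [add_mul, e1] at h3
    rw [← h3, exp_ad_apply hX]
    congr 1
    · rw [mul_assoc X, e1]
    · calc _ = IsNilpotent.exp X * Y * (IsNilpotent.exp Y * IsNilpotent.exp (-Y))
            * IsNilpotent.exp (-X) := by simp only [mul_assoc]
        _ = _ := by rw [hYY, mul_one]
  have hc : constantCoeff (exp ℝ - 1) = 0 := by simp
  have hev : nilEval _ haZ (exp ℝ - 1) = IsNilpotent.exp (LieAlgebra.ad ℝ R X) *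
      IsNilpotent.exp (LieAlgebra.ad ℝ R Y) - 1 := by
    rw [map_sub, map_one, nilEval_exp, hg]
  -- Solve for `D Z`: the inverse of `(e^{ad Z} - 1) / ad Z` is `log(1 + U) / U` at `U = e^{ad Z} -
  -- 1 = e^{ad X} e^{ad Y} - 1`.
  have h4 := congrArg (fun f => nilEval _ haZ f (D Z)) logDivX_subst_mul_expSubOneDivX
  simp only [map_mul, map_one, Module.End.mul_apply, Module.End.one_apply, h1,
    nilEval_subst haZ hc] at h4
  obtain ⟨K₀, hK₀⟩ := isNilpotent_nilEval haZ hc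
  refine ⟨K₀, fun K hK => ?_⟩
  rw [← h4, nilEval_eq_sum _ (pow_eq_zero_of_le hK hK₀), LinearMap.sum_apply, hev]
  simp [logDivX]

end LogarithmicDerivative

/-! ### Nested brackets and Dynkin's series -/

section NestedBrackets

variable {L : Type*} [LieRing L]

theorem nestedBracket_cons (a : L) {l : List L} (hl : l ≠ []) :
    nestedBracket (a :: l) = ⁅a, nestedBracket l⁆ := by
  cases l with
  | nil => exact absurd rfl hl
  | cons b l => rfl

variable [LieAlgebra ℝ L]

theorem nestedBracket_append (w : List L) {l : List L} (hl : l ≠ []) :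
    nestedBracket (w ++ l) = (w.map (LieAlgebra.ad ℝ L)).prod (nestedBracket l) := by
  induction w with
  | nil => simp
  | cons a w ih =>
    rw [List.cons_append, nestedBracket_cons a (by simp [hl]), ih]
    simp

theorem nestedBracket_replicate_append (r q : ℕ) (x y : L) {l : List L} (hl : l ≠ []) :
    nestedBracket (List.replicate r x ++ List.replicate q y ++ l)
      = (LieAlgebra.ad ℝ L x ^ r) ((LieAlgebra.ad ℝ L y ^ q) (nestedBracket l)) := by
  rw [nestedBracket_append _ hl]
  simp

/-- The innermost bracket is `[x, x]`. Hence very few final blocks contribute to Dynkin's series. -/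
theorem nestedBracket_replicate_add_two (w : List L) (r : ℕ) (x : L) :
    nestedBracket (w ++ List.replicate (r + 2) x) = 0 := by
  have : w ++ List.replicate (r + 2) x = (w ++ List.replicate r x) ++ [x, x] := by
    rw [List.replicate_add]
    simp
  rw [this, nestedBracket_append (L := L) _ (by simp)]
  simp [nestedBracket]

end NestedBrackets

section DynkinSums

attribute [local instance] LieRing.ofAssociativeRing

variable {R : Type*} [Ring R] [Algebra ℝ R]

/-- The span of the products of at least `m` factors from `{X, Y}`. -/
def wordSpan (X Y : R) (m : ℕ) : Submodule ℝ R :=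
  Submodule.span ℝ {w | ∃ l : List R, (∀ z ∈ l, z = X ∨ z = Y) ∧ m ≤ l.length ∧ l.prod = w}

namespace wordSpan

variable {X Y : R}

theorem prod_mem {l : List R} (hl : ∀ z ∈ l, z = X ∨ z = Y) : l.prod ∈ wordSpan X Y l.length :=
  Submodule.subset_span ⟨l, hl, le_rfl, rfl⟩

theorem one_mem : (1 : R) ∈ wordSpan X Y 0 := by
  simpa using prod_mem (X := X) (Y := Y) (l := []) (by simp)

theorem left_mem : X ∈ wordSpan X Y 1 := by
  simpa using prod_mem (X := X) (Y := Y) (l := [X]) (by simp)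

theorem right_mem : Y ∈ wordSpan X Y 1 := by
  simpa using prod_mem (X := X) (Y := Y) (l := [Y]) (by simp)

theorem mul_mem {m n : ℕ} {a b : R} (ha : a ∈ wordSpan X Y m) (hb : b ∈ wordSpan X Y n) :
    a * b ∈ wordSpan X Y (m + n) := by
  have h := Submodule.mul_mem_mul ha hb
  rw [wordSpan, wordSpan, Submodule.span_mul_span] at h
  refine Submodule.span_mono ?_ h
  rintro _ ⟨_, ⟨l, hl, hm, rfl⟩, _, ⟨l', hl', hn, rfl⟩, rfl⟩
  refine ⟨l ++ l', ?_, by simp only [List.length_append]; omega, by simp⟩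
  intro z hz
  rcases List.mem_append.1 hz with h | h
  · exact hl z h
  · exact hl' z h

theorem anti {m n : ℕ} (h : m ≤ n) : wordSpan X Y n ≤ wordSpan X Y m := by
  refine Submodule.span_mono ?_
  rintro w ⟨l, hl, hn, rfl⟩
  exact ⟨l, hl, h.trans hn, rfl⟩

theorem pow_mem {m : ℕ} {a : R} (ha : a ∈ wordSpan X Y m) (i : ℕ) :
    a ^ i ∈ wordSpan X Y (i * m) := by
  induction i with
  | zero => simpa using one_mem
  | succ i ih =>
    rw [pow_succ, Nat.succ_mul]
    exact mul_mem ih ha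

theorem lie_mem {m n : ℕ} {a b : R} (ha : a ∈ wordSpan X Y m) (hb : b ∈ wordSpan X Y n) :
    ⁅a, b⁆ ∈ wordSpan X Y (m + n) := by
  rw [LieRing.of_associative_ring_bracket]
  refine Submodule.sub_mem _ (mul_mem ha hb) ?_
  rw [add_comm]
  exact mul_mem hb ha

theorem ad_pow_mem {m n : ℕ} {a b : R} (ha : a ∈ wordSpan X Y m) (hb : b ∈ wordSpan X Y n) (i : ℕ) :
    (LieAlgebra.ad ℝ R a ^ i) b ∈ wordSpan X Y (i * m + n) := by
  induction i with
  | zero => simpa using hb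
  | succ i ih =>
    rw [pow_succ', Module.End.mul_apply, LieAlgebra.ad_apply, Nat.succ_mul]
    have := lie_mem ha ih
    rwa [show i * m + m + n = m + (i * m + n) by ring]

theorem letter_mem {z : R} (hz : z = X ∨ z = Y) : z ∈ wordSpan X Y 1 := by
  rcases hz with rfl | rfl
  · exact left_mem
  · exact right_mem

theorem nestedBracket_mem {l : List R} (hl : ∀ z ∈ l, z = X ∨ z = Y) :
    nestedBracket l ∈ wordSpan X Y l.length := by
  induction l with
  | nil => simp [nestedBracket]
  | cons a l ih =>
    by_cases h : l = []
    · subst h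
      simpa [nestedBracket] using letter_mem (hl a (by simp))
    · rw [nestedBracket_cons a h, List.length_cons, add_comm]
      exact lie_mem (letter_mem (hl a (by simp))) (ih fun z hz => hl z (by simp [hz]))

section Nilpotent

variable {s : ℕ} (hW : ∀ l : List R, (∀ z ∈ l, z = X ∨ z = Y) → s + 1 ≤ l.length → l.prod = 0)

include hW

theorem eq_zero_of_mem {a : R} {m : ℕ} (hm : s + 1 ≤ m) (ha : a ∈ wordSpan X Y m) : a = 0 := by
  have h : wordSpan X Y m ≤ ⊥ := by
    refine Submodule.span_le.2 ?_
    rintro w ⟨l, hl, hn, rfl⟩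
    simpa using hW l hl (hm.trans hn)
  simpa using h ha

theorem isNilpotent_of_mem {a : R} (ha : a ∈ wordSpan X Y 1) : IsNilpotent a :=
  ⟨s + 1, eq_zero_of_mem hW (by simp) (pow_mem ha (s + 1))⟩

theorem exp_sub_one_mem [Module ℚ R] {a : R} (ha : a ∈ wordSpan X Y 1) :
    IsNilpotent.exp a - 1 ∈ wordSpan X Y 1 := by
  have h : a ^ (s + 1) = 0 := eq_zero_of_mem hW (by simp) (pow_mem ha (s + 1))
  rw [IsNilpotent.exp_eq_sum h, Finset.sum_range_succ']
  simp only [pow_zero, Nat.factorial_zero, Nat.cast_one, inv_one, one_smul, add_sub_cancel_right]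
  refine Submodule.sum_mem _ fun i _ => ?_
  rw [← Rat.cast_smul_eq_qsmul ℝ]
  exact Submodule.smul_mem _ _ (anti (by omega) (pow_mem ha (i + 1)))

theorem isNilpotent_exp_mul_exp_sub_one [Module ℚ R] :
    IsNilpotent (IsNilpotent.exp X * IsNilpotent.exp Y - 1) := by
  refine isNilpotent_of_mem (X := X) (Y := Y) hW ?_
  have hX := exp_sub_one_mem hW (left_mem (X := X) (Y := Y))
  have hY := exp_sub_one_mem hW (right_mem (X := X) (Y := Y))
  have : IsNilpotent.exp X * IsNilpotent.exp Y - 1 = (IsNilpotent.exp X - 1)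
      * (IsNilpotent.exp Y - 1) + (IsNilpotent.exp X - 1) + (IsNilpotent.exp Y - 1) := by
    noncomm_ring
  rw [this]
  exact Submodule.add_mem _ (Submodule.add_mem _ (anti (by omega) (mul_mem hX hY)) hX) hY

/-- As an operator `ad a` may need a higher power to vanish, but on combinations of words each
application lengthens the words, so `s + 1` applications suffice. -/
theorem exp_ad_apply_eq_sum [Module ℚ R] {a v : R} (ha : a ∈ wordSpan X Y 1) (hv : v ∈ wordSpan X Y 0) :
    IsNilpotent.exp (LieAlgebra.ad ℝ R a) v
      = ∑ i ∈ Finset.range (s + 1), (i.factorial : ℝ)⁻¹ • (LieAlgebra.ad ℝ R a ^ i) v := by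
  have h0 : (LieAlgebra.ad ℝ R a ^ (s + 1)) • v = 0 :=
    eq_zero_of_mem hW (by simp) (ad_pow_mem ha hv (s + 1))
  have := IsNilpotent.exp_smul_eq_sum h0
    (LieAlgebra.ad_nilpotent_of_nilpotent (isNilpotent_of_mem hW ha))
  rw [Module.End.smul_def] at this
  rw [this]
  refine Finset.sum_congr rfl fun i _ => ?_
  rw [← Rat.cast_smul_eq_qsmul ℝ]
  simp

end Nilpotent

end wordSpan

end DynkinSums

section DynkinSeries

attribute [local instance] LieRing.ofAssociativeRing

/-- The word `x^{r₁} y^{q₁} ⋯ x^{rₙ} y^{qₙ}`. -/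
def blockWord {α : Type*} {s n : ℕ} (a : Fin n → Fin (s + 1) × Fin (s + 1)) (x y : α) : List α :=
  (List.ofFn fun i => List.replicate ((a i).1 : ℕ) x ++ List.replicate ((a i).2 : ℕ) y).flatten

section BlockWord

variable {α β : Type*} {s n : ℕ}

theorem blockWord_cons (p : Fin (s + 1) × Fin (s + 1)) (a : Fin n → Fin (s + 1) × Fin (s + 1))
    (x y : α) : blockWord (Fin.cons p a) x y
      = List.replicate (p.1 : ℕ) x ++ List.replicate (p.2 : ℕ) y ++ blockWord a x y := by
  simp [blockWord, List.ofFn_succ]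

theorem mem_blockWord (a : Fin n → Fin (s + 1) × Fin (s + 1)) (x y z : α)
    (hz : z ∈ blockWord a x y) : z = x ∨ z = y := by
  simp only [blockWord, List.mem_flatten, List.mem_ofFn] at hz
  obtain ⟨l, ⟨i, rfl⟩, hl⟩ := hz
  rcases List.mem_append.1 hl with h | h
  · exact Or.inl (List.eq_of_mem_replicate h)
  · exact Or.inr (List.eq_of_mem_replicate h)

theorem length_blockWord (a : Fin n → Fin (s + 1) × Fin (s + 1)) (x y : α) :
    (blockWord a x y).length = ∑ i, (((a i).1 : ℕ) + ((a i).2 : ℕ)) := by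
  simp [blockWord, List.length_flatten, List.map_ofFn, Function.comp_def, List.sum_ofFn]

theorem map_blockWord (f : α → β) (a : Fin n → Fin (s + 1) × Fin (s + 1)) (x y : α) :
    (blockWord a x y).map f = blockWord a (f x) (f y) := by
  simp [blockWord, List.map_flatten, List.map_ofFn, Function.comp_def]

end BlockWord

/-- The weight `1 / (r! q!)` of a nonempty block `x^r y^q`. -/
noncomputable def blockWeight {s : ℕ} (p : Fin (s + 1) × Fin (s + 1)) : ℝ :=
  if 0 < (p.1 : ℕ) + (p.2 : ℕ) then (((p.1 : ℕ).factorial : ℝ) * ((p.2 : ℕ).factorial : ℝ))⁻¹ else 0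

theorem blockWeight_of_pos {s : ℕ} {p : Fin (s + 1) × Fin (s + 1)} (hp : 0 < (p.1 : ℕ) + (p.2 : ℕ)) :
    blockWeight p = (((p.1 : ℕ).factorial : ℝ) * ((p.2 : ℕ).factorial : ℝ))⁻¹ := if_pos hp

theorem blockWeight_of_not_pos {s : ℕ} {p : Fin (s + 1) × Fin (s + 1)}
    (hp : ¬ 0 < (p.1 : ℕ) + (p.2 : ℕ)) : blockWeight p = 0 := if_neg hp

/-- The part of Dynkin's series with `n` blocks, without the degree denominators. -/
noncomputable def dynkinSum {L : Type*} [LieRing L] [LieAlgebra ℝ L] (s n : ℕ) (x y : L) : L :=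
  ∑ a : Fin n → Fin (s + 1) × Fin (s + 1),
    (∏ i, blockWeight (a i)) • nestedBracket (blockWord a x y)

variable {R : Type*} [Ring R] [Algebra ℝ R] [Module ℚ R] {X Y : R} {s : ℕ}
  (hW : ∀ l : List R, (∀ z ∈ l, z = X ∨ z = Y) → s + 1 ≤ l.length → l.prod = 0)

omit [Module ℚ R] in
theorem dynkinSum_mem (n : ℕ) : dynkinSum s n X Y ∈ wordSpan X Y n := by
  refine Submodule.sum_mem _ fun a _ => ?_
  by_cases h : ∀ i, 0 < ((a i).1 : ℕ) + ((a i).2 : ℕ)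
  · refine Submodule.smul_mem _ _ (wordSpan.anti ?_ (wordSpan.nestedBracket_mem (mem_blockWord a X Y)))
    rw [length_blockWord]
    calc n = ∑ i : Fin n, 1 := by simp
      _ ≤ _ := Finset.sum_le_sum fun i _ => h i
  · push Not at h
    obtain ⟨i, hi⟩ := h
    rw [Finset.prod_eq_zero (Finset.mem_univ i) (blockWeight_of_not_pos hi.not_gt), zero_smul]
    exact Submodule.zero_mem _

omit [Module ℚ R] in
-- The empty block has weight zero, so its term is removed from the full double sum; this accounts
-- for the `-1` in `e^{ad X} e^{ad Y} - 1`.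
theorem sum_blockWeight_smul {M : Type*} [AddCommGroup M] [Module ℝ M] (F : ℕ → ℕ → M) :
    ∑ p : Fin (s + 1) × Fin (s + 1), blockWeight p • F p.1 p.2
      = (∑ r ∈ Finset.range (s + 1), ∑ q ∈ Finset.range (s + 1),
          ((r.factorial : ℝ)⁻¹ * (q.factorial : ℝ)⁻¹) • F r q) - F 0 0 := by
  have h : ∀ p : Fin (s + 1) × Fin (s + 1), blockWeight p • F p.1 p.2
      = (((p.1 : ℕ).factorial : ℝ)⁻¹ * ((p.2 : ℕ).factorial : ℝ)⁻¹) • F p.1 p.2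
        - if p = 0 then F 0 0 else 0 := by
    intro p
    by_cases hp : p = 0
    · subst hp
      simp [blockWeight]
    · have : 0 < (p.1 : ℕ) + (p.2 : ℕ) := by
        by_contra h0
        apply hp
        ext <;> simp only [Prod.fst_zero, Prod.snd_zero, Fin.val_zero] <;> omega
      simp [blockWeight_of_pos this, hp, mul_comm]
  rw [Finset.sum_congr rfl fun p _ => h p, Finset.sum_sub_distrib, Finset.sum_ite_eq' Finset.univ,
    if_pos (Finset.mem_univ _), Fintype.sum_prod_type]
  congr 1
  rw [← Fin.sum_univ_eq_sum_range (fun r => ∑ q ∈ Finset.range (s + 1),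
    ((r.factorial : ℝ)⁻¹ * (q.factorial : ℝ)⁻¹) • F r q)]
  refine Finset.sum_congr rfl fun r _ => ?_
  rw [← Fin.sum_univ_eq_sum_range (fun q => 
    (((r : ℕ).factorial : ℝ)⁻¹ * (q.factorial : ℝ)⁻¹) • F r q)]

include hW

/-- In a single block `x^r y^q` the bracket vanishes for `q ≥ 2`; the blocks with `q = 1` sum to
`e^{ad X} Y`, and for `q = 0` only `r = 1` survives, giving `X`. -/
theorem dynkinSum_one :
    dynkinSum s 1 X Y = X + IsNilpotent.exp (LieAlgebra.ad ℝ R X) Y := by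
  have hX0 : ∀ l : List R, (∀ z ∈ l, z = X ∨ z = Y) → s + 1 ≤ l.length → nestedBracket l = 0 :=
    fun l hl hs => wordSpan.eq_zero_of_mem hW hs (wordSpan.nestedBracket_mem hl)
  have h1 : dynkinSum s 1 X Y = ∑ p : Fin (s + 1) × Fin (s + 1), blockWeight p •
      nestedBracket (List.replicate (p.1 : ℕ) X ++ List.replicate (p.2 : ℕ) Y) := by
    rw [dynkinSum]
    refine Fintype.sum_equiv (Equiv.funUnique (Fin 1) _) _ _ fun a => ?_
    simp [blockWord]
  rw [h1, sum_blockWeight_smul (s := s)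
    (fun r q => nestedBracket (List.replicate r X ++ List.replicate q Y))]
  rw [wordSpan.exp_ad_apply_eq_sum hW wordSpan.left_mem
    (wordSpan.anti (Nat.zero_le 1) wordSpan.right_mem)]
  -- The splitting by `q` needs room for `q = 0, 1`; for `s = 0` the letters themselves vanish.
  rcases s with _ | s
  · have hX : X = 0 := by simpa using hW [X] (by simp) (by simp)
    have hY : Y = 0 := by simpa using hW [Y] (by simp) (by simp)
    simp [nestedBracket, hX, hY]
  · have hF : ∀ r, ∑ q ∈ Finset.range (s + 1 + 1), ((r.factorial : ℝ)⁻¹ * (q.factorial : ℝ)⁻¹) •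
        nestedBracket (List.replicate r X ++ List.replicate q Y)
        = (r.factorial : ℝ)⁻¹ • nestedBracket (List.replicate r X)
          + (r.factorial : ℝ)⁻¹ • (LieAlgebra.ad ℝ R X ^ r) Y := by
      intro r
      rw [Finset.sum_range_succ', Finset.sum_range_succ', Finset.sum_eq_zero, zero_add]
      · have := nestedBracket_replicate_append r 0 X Y (l := [Y]) (by simp)
        simp only [List.replicate_zero, List.append_nil, pow_zero, Module.End.one_apply,
          nestedBracket] at this
        simp [this, add_comm]
      · intro q _
        rw [nestedBracket_replicate_add_two, smul_zero]
    have hG : ∑ r ∈ Finset.range (s + 1 + 1), (r.factorial : ℝ)⁻¹ •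
        nestedBracket (List.replicate r X) = X := by
      rw [Finset.sum_range_succ', Finset.sum_range_succ', Finset.sum_eq_zero, zero_add]
      · simp [nestedBracket]
      · intro r _
        have := nestedBracket_replicate_add_two [] r X
        rw [List.nil_append] at this
        rw [this, smul_zero]
    simp only [hF, Finset.sum_add_distrib, hG]
    simp [nestedBracket]

theorem exp_ad_mul_exp_ad_sub_one_apply {v : R} (hv : v ∈ wordSpan X Y 0) :
    (IsNilpotent.exp (LieAlgebra.ad ℝ R X) * IsNilpotent.exp (LieAlgebra.ad ℝ R Y) - 1) v
      = ∑ p : Fin (s + 1) × Fin (s + 1), blockWeight p •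
        (LieAlgebra.ad ℝ R X ^ (p.1 : ℕ)) ((LieAlgebra.ad ℝ R Y ^ (p.2 : ℕ)) v) := by
  rw [sum_blockWeight_smul (s := s)
    (fun r q => (LieAlgebra.ad ℝ R X ^ r) ((LieAlgebra.ad ℝ R Y ^ q) v))]
  rw [LinearMap.sub_apply, Module.End.mul_apply,
    wordSpan.exp_ad_apply_eq_sum hW wordSpan.right_mem hv, map_sum, Finset.sum_comm]
  simp only [pow_zero, Module.End.one_apply]
  congr 1
  refine Finset.sum_congr rfl fun q _ => ?_
  rw [map_smul, wordSpan.exp_ad_apply_eq_sum hW wordSpan.left_mem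
    (wordSpan.anti (Nat.zero_le _) (wordSpan.ad_pow_mem wordSpan.right_mem hv q)), Finset.smul_sum]
  refine Finset.sum_congr rfl fun r _ => ?_
  rw [smul_smul, mul_comm]

/-- Splitting off the first block `x^r y^q` applies `(ad X)^r (ad Y)^q` to the bracket of the
remaining word, which is nonempty whenever its weight is nonzero. -/
theorem dynkinSum_succ_succ (n : ℕ) :
    dynkinSum s (n + 2) X Y
      = (IsNilpotent.exp (LieAlgebra.ad ℝ R X) * IsNilpotent.exp (LieAlgebra.ad ℝ R Y) - 1)
        (dynkinSum s (n + 1) X Y) := by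
  rw [exp_ad_mul_exp_ad_sub_one_apply hW (wordSpan.anti (Nat.zero_le _) (dynkinSum_mem (n + 1)))]
  rw [dynkinSum, ← (Fin.consEquiv (fun _ => Fin (s + 1) × Fin (s + 1))).sum_comp,
    Fintype.sum_prod_type]
  refine Finset.sum_congr rfl fun p _ => ?_
  rw [dynkinSum, map_sum, map_sum, Finset.smul_sum]
  refine Finset.sum_congr rfl fun a _ => ?_
  rw [map_smul, map_smul]
  change (∏ i, blockWeight ((Fin.cons p a : Fin (n + 2) → _) i)) •
    nestedBracket (blockWord (Fin.cons p a : Fin (n + 2) → _) X Y) = _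
  rw [Fin.prod_univ_succ, blockWord_cons, mul_smul]
  simp only [Fin.cons_zero, Fin.cons_succ]
  by_cases h : 0 < ((a 0).1 : ℕ) + ((a 0).2 : ℕ)
  · rw [nestedBracket_replicate_append]
    intro h0
    have := congrArg List.length h0
    rw [length_blockWord, Fin.sum_univ_succ, List.length_nil] at this
    omega
  · have : ∏ i, blockWeight (a i) = 0 :=
      Finset.prod_eq_zero (Finset.mem_univ 0) (blockWeight_of_not_pos h)
    rw [this, zero_smul, zero_smul]

theorem dynkinSum_succ (n : ℕ) :
    dynkinSum s (n + 1) X Y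
      = ((IsNilpotent.exp (LieAlgebra.ad ℝ R X) * IsNilpotent.exp (LieAlgebra.ad ℝ R Y) - 1) ^ n)
        (X + IsNilpotent.exp (LieAlgebra.ad ℝ R X) Y) := by
  induction n with
  | zero => simpa using dynkinSum_one hW
  | succ n ih => rw [dynkinSum_succ_succ hW, ih, pow_succ', Module.End.mul_apply]

open PowerSeries in
-- The sum may stop at `s` because `n + 1` nonempty blocks form a word of length at least `n + 1`.
theorem derivation_nilLog_eq_sum_dynkinSum (D : R →ₗ[ℝ] R)
    (hD : ∀ a b, D (a * b) = D a * b + a * D b) (hDX : D X = X) (hDY : D Y = Y) :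
    D (nilLog _ (wordSpan.isNilpotent_exp_mul_exp_sub_one hW))
      = ∑ n ∈ Finset.range s, ((-1 : ℝ) ^ n / (n + 1)) • dynkinSum s (n + 1) X Y := by
  obtain ⟨K, hK⟩ := derivation_nilLog_exp_mul_exp D hD
    (wordSpan.isNilpotent_of_mem hW wordSpan.left_mem)
    (wordSpan.isNilpotent_of_mem hW wordSpan.right_mem) hDX hDY
    (wordSpan.isNilpotent_exp_mul_exp_sub_one hW)
  rw [hK (max K s) (le_max_left _ _)]
  simp only [← dynkinSum_succ hW]
  symm
  refine Finset.sum_subset (Finset.range_mono (le_max_right _ _)) fun n _ hn => ?_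
  rw [wordSpan.eq_zero_of_mem hW (by simpa using hn) (dynkinSum_mem (n + 1)), smul_zero]

end DynkinSeries

/-! ### The Baker-Campbell-Hausdorff formula in an associative algebra -/

section BakerCampbellHausdorff

attribute [local instance] LieRing.ofAssociativeRing

open Polynomial

variable {A : Type*} [Ring A] [Algebra ℝ A]

/-- `∑ aₘ tᵐ ↦ ∑ aₘ / m`. -/
noncomputable def divDegree : A[X] →ₗ[ℝ] A :=
  Polynomial.lsum fun m => (m : ℝ)⁻¹ • LinearMap.id

theorem divDegree_monomial (m : ℕ) (a : A) : divDegree (monomial m a) = (m : ℝ)⁻¹ • a := by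
  simp [divDegree, Polynomial.sum_monomial_index]

omit [Algebra ℝ A] in
theorem nestedBracket_map_monomial (l : List A) :
    nestedBracket (l.map (monomial 1)) = monomial l.length (nestedBracket l) := by
  induction l with
  | nil => simp [nestedBracket]
  | cons a l ih =>
    by_cases h : l = []
    · subst h; simp [nestedBracket]
    · rw [List.map_cons, nestedBracket_cons _ (by simpa using h), nestedBracket_cons _ h, ih,
        LieRing.of_associative_ring_bracket, LieRing.of_associative_ring_bracket,
        monomial_mul_monomial, monomial_mul_monomial, map_sub, List.length_cons, add_comm]

omit [Algebra ℝ A] in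
theorem prod_map_monomial (l : List A) :
    (l.map (monomial 1)).prod = monomial l.length l.prod := by
  induction l with
  | nil => simp
  | cons a l ih =>
    rw [List.map_cons, List.prod_cons, ih, monomial_mul_monomial, List.length_cons, List.prod_cons,
      add_comm]

/-- Replacing `x`, `y` by `x t`, `y t` records the length of a word as a power of `t`, so that
`divDegree` restores the degree denominators of Dynkin's formula. -/
theorem bch_eq_sum (s : ℕ) {x y : A}
    (hW : ∀ l : List A, (∀ z ∈ l, z = x ∨ z = y) → s + 1 ≤ l.length → l.prod = 0) :
    bch s x y = divDegree (∑ n ∈ Finset.range s,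
      ((-1 : ℝ) ^ n / (n + 1)) • dynkinSum s (n + 1) (monomial 1 x) (monomial 1 y)) := by
  have hzero : ∀ l : List A, (∀ z ∈ l, z = x ∨ z = y) → s + 1 ≤ l.length → nestedBracket l = 0 :=
    fun l hl hs => wordSpan.eq_zero_of_mem hW hs (wordSpan.nestedBracket_mem hl)
  rw [bch, map_sum]
  refine Finset.sum_nbij' (fun n => n - 1) (fun n => n + 1) ?_ ?_ ?_ ?_ ?_
  · intro n hn
    simp only [Finset.mem_Icc, Finset.mem_range] at *
    omega
  · intro n hn
    simp only [Finset.mem_Icc, Finset.mem_range] at *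
    omega
  · intro n hn
    simp only [Finset.mem_Icc] at hn
    omega
  · intro n hn
    simp
  · intro n hn
    obtain ⟨n, rfl⟩ : ∃ m, n = m + 1 := ⟨n - 1, by have := (Finset.mem_Icc.1 hn).1; omega⟩
    rw [Nat.add_sub_cancel, map_smul, dynkinSum, map_sum, Finset.smul_sum, Finset.sum_filter]
    refine Finset.sum_congr rfl fun a _ => ?_
    rw [map_smul, ← map_blockWord (monomial 1) a x y, nestedBracket_map_monomial,
      divDegree_monomial, length_blockWord, smul_smul, smul_smul]
    split_ifs with h
    · have hp : ∏ i, blockWeight (a i) = (∏ i, ((((a i).1 : ℕ).factorial : ℝ)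
          * (((a i).2 : ℕ).factorial : ℝ)))⁻¹ := by
        rw [← Finset.prod_inv_distrib]
        exact Finset.prod_congr rfl fun i _ => blockWeight_of_pos (h.1 i)
      rw [hp]
      change _ • nestedBracket (blockWord a x y) = _
      congr 1
      push_cast
      simp only [div_eq_mul_inv]
      ring
    -- Tuples excluded by the filter contribute nothing: either the word is longer than `s`, or an
    -- empty block has weight zero.
    · symm
      by_cases hpos : ∀ i, 0 < ((a i).1 : ℕ) + ((a i).2 : ℕ)
      · rw [hzero _ (mem_blockWord a x y), smul_zero]
        rw [length_blockWord]
        by_contra hlt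
        exact h ⟨hpos, by omega⟩
      · push Not at hpos
        obtain ⟨i, hi⟩ := hpos
        rw [Finset.prod_eq_zero (Finset.mem_univ i) (blockWeight_of_not_pos hi.not_gt)]
        simp

/-- The operator `t d/dt` on polynomials. -/
noncomputable def eulerDerivation : A[X] →ₗ[ℝ] A[X] where
  toFun p := X * derivative p
  map_add' p q := by simp [mul_add]
  map_smul' c p := by simp

theorem eulerDerivation_mul (p q : A[X]) :
    eulerDerivation (p * q) = eulerDerivation p * q + p * eulerDerivation q := by
  simp only [eulerDerivation, LinearMap.coe_mk, AddHom.coe_mk, derivative_mul, mul_add]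
  rw [← mul_assoc, ← mul_assoc, ← mul_assoc, X_mul (p := p)]

theorem eulerDerivation_monomial (m : ℕ) (a : A) :
    eulerDerivation (monomial m a) = (m : ℝ) • monomial m a := by
  rcases m with _ | m
  · simp [eulerDerivation]
  · simp only [eulerDerivation, LinearMap.coe_mk, AddHom.coe_mk, derivative_monomial_succ,
      X_mul_monomial, smul_monomial]
    congr 1
    rw [Algebra.smul_def, map_natCast, Nat.cast_comm, Nat.cast_succ]

/-- Evaluation at `t = 1`. -/
noncomputable def evalOneHom : A[X] →+* A := eval₂RingHom' (RingHom.id A) 1 fun a => Commute.one_right a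

omit [Algebra ℝ A] in
theorem evalOneHom_monomial (m : ℕ) (a : A) : evalOneHom (monomial m a) = a := by
  simp [evalOneHom, eval₂RingHom']

theorem divDegree_eulerDerivation (p : A[X]) :
    divDegree (eulerDerivation p) = evalOneHom p - p.coeff 0 := by
  induction p using Polynomial.induction_on' with
  | add p q hp hq => simp only [map_add, hp, hq, coeff_add]; abel
  | monomial m a =>
    rw [eulerDerivation_monomial, map_smul, divDegree_monomial, evalOneHom_monomial]
    rcases m with _ | m
    · simp
    · have : ((m + 1 : ℕ) : ℝ) ≠ 0 := by positivity
      rw [smul_smul, mul_inv_cancel₀ this, one_smul]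
      simp [coeff_monomial]

/-- Let `Z(t) = log(e^{tx} e^{ty})`. The derivation `t d/dt` fixes `t x` and `t y`, so Dynkin's
computation gives `t Z'(t)`; dividing each coefficient by its degree recovers `Z(1)` because `Z(0) =
0`. -/
theorem exp_bch_of_prod_eq_zero [Module ℚ A] {s : ℕ} {x y : A}
    (hW : ∀ l : List A, (∀ z ∈ l, z = x ∨ z = y) → s + 1 ≤ l.length → l.prod = 0) :
    IsNilpotent.exp (bch s x y) = IsNilpotent.exp x * IsNilpotent.exp y := by
  have hW' : ∀ l : List A[X], (∀ z ∈ l, z = monomial 1 x ∨ z = monomial 1 y) → s + 1 ≤ l.length →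
      l.prod = 0 := by
    intro l hl hs
    obtain ⟨l', rfl⟩ : ∃ l' : List A, l = l'.map (monomial 1) := by
      refine ⟨l.map fun z => z.coeff 1, ?_⟩
      rw [List.map_map, eq_comm]
      conv_rhs => rw [← List.map_id l]
      refine List.map_congr_left fun z hz => ?_
      rcases hl z hz with rfl | rfl <;> simp
    rw [prod_map_monomial, hW l' ?_ (by simpa using hs), map_zero]
    intro z hz
    have := hl (monomial 1 z) (List.mem_map_of_mem hz)
    simpa only [(monomial_injective 1).eq_iff] using this
  have hx := wordSpan.isNilpotent_of_mem hW' wordSpan.left_mem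
  have hy := wordSpan.isNilpotent_of_mem hW' wordSpan.right_mem
  have hG := wordSpan.isNilpotent_exp_mul_exp_sub_one hW'
  set Z := PowerSeries.nilLog _ hG with hZ
  -- At `t = 0` both exponentials are `1`, and the logarithm of `1` is `0`.
  have h0 : Z.coeff 0 = 0 := by
    obtain ⟨K, hK⟩ := id hG
    have hc : constantCoeff (IsNilpotent.exp (monomial 1 x) * IsNilpotent.exp (monomial 1 y) - 1)
        = (0 : A) := by
      rw [map_sub, map_mul, map_one, IsNilpotent.map_exp hx, IsNilpotent.map_exp hy]
      simp
    change constantCoeff Z = 0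
    rw [hZ, PowerSeries.nilLog, PowerSeries.nilEval_eq_sum _ hK, map_sum]
    refine Finset.sum_eq_zero fun i _ => ?_
    rw [constantCoeff_apply, coeff_smul, ← constantCoeff_apply, map_pow, hc]
    rcases i with _ | i <;> simp
  have h1 : evalOneHom Z = bch s x y := by
    rw [bch_eq_sum s hW, ← derivation_nilLog_eq_sum_dynkinSum hW' eulerDerivation eulerDerivation_mul
      (by simp [eulerDerivation_monomial]) (by simp [eulerDerivation_monomial]),
      divDegree_eulerDerivation, h0, sub_zero]
  rw [← h1, ← IsNilpotent.map_exp (PowerSeries.isNilpotent_nilLog hG), PowerSeries.exp_nilLog hG,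
    map_mul, IsNilpotent.map_exp hx, IsNilpotent.map_exp hy, evalOneHom_monomial,
    evalOneHom_monomial]

end BakerCampbellHausdorff

/-! ### Gradings and a faithful nilpotent representation -/

namespace LieGrading

variable {L : Type v} [LieRing L] [LieAlgebra ℝ L] (G : LieGrading L)

/-- The projection to the `j`-th layer. -/
noncomputable def comp (j : ℕ) : L →ₗ[ℝ] L :=
  (G.layer j).subtype ∘ₗ DirectSum.component ℝ ℕ (fun i => G.layer i) j ∘ₗ G.decomp.toLinearMap

theorem comp_mem (j : ℕ) (x : L) : G.comp j x ∈ G.layer j := by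
  simp [comp]

theorem horiz_eq (x : L) : G.horiz x = G.comp 1 x := rfl

theorem decomp_of_mem {i : ℕ} {x : L} (hx : x ∈ G.layer i) :
    G.decomp x = DirectSum.lof ℝ ℕ (fun i => G.layer i) i ⟨x, hx⟩ := by
  have h : G.decomp.symm (DirectSum.lof ℝ ℕ (fun i => G.layer i) i ⟨x, hx⟩) = x :=
    DirectSum.coeLinearMap_lof G.layer i ⟨x, hx⟩
  conv_lhs => rw [← h]
  exact G.decomp.apply_symm_apply _

theorem comp_of_mem {i : ℕ} {x : L} (hx : x ∈ G.layer i) : G.comp i x = x := by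
  simp [comp, G.decomp_of_mem hx]

theorem comp_of_mem_ne {i j : ℕ} (hij : i ≠ j) {x : L} (hx : x ∈ G.layer i) : G.comp j x = 0 := by
  simp [comp, G.decomp_of_mem hx, DirectSum.component.of, hij]

theorem ext_comp {x y : L} (h : ∀ j, G.comp j x = G.comp j y) : x = y := by
  apply G.decomp.injective
  ext j
  exact h j

theorem comp_zero (x : L) : G.comp 0 x = 0 := by
  have := G.comp_mem 0 x
  rw [G.layer_zero] at this
  simpa using this

@[elab_as_elim]
theorem layer_induction {P : L → Prop} (x : L) (hmem : ∀ i, ∀ x ∈ G.layer i, P x) (h0 : P 0)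
    (hadd : ∀ x y, P x → P y → P (x + y)) : P x := by
  have hx : x ∈ ⨆ i, G.layer i := by rw [G.isInternal.submodule_iSup_eq_top]; trivial
  exact Submodule.iSup_induction _ (motive := P) hx hmem h0 hadd

/-- The endomorphism that acts on the `i`-th layer as multiplication by `c i`. -/
noncomputable def weight (c : ℕ → ℝ) : L →ₗ[ℝ] L :=
  DirectSum.toModule ℝ ℕ L (fun i => c i • (G.layer i).subtype) ∘ₗ G.decomp.toLinearMap

theorem weight_of_mem (c : ℕ → ℝ) {i : ℕ} {x : L} (hx : x ∈ G.layer i) :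
    G.weight c x = c i • x := by
  simp [weight, G.decomp_of_mem hx]

theorem comp_weight (c : ℕ → ℝ) (j : ℕ) (x : L) : G.comp j (G.weight c x) = c j • G.comp j x := by
  induction x using G.layer_induction with
  | h0 => simp
  | hadd x y hx hy => simp [hx, hy]
  | hmem i x hx =>
    rw [G.weight_of_mem c hx, map_smul]
    by_cases hij : i = j
    · subst hij; rfl
    · simp [G.comp_of_mem_ne hij hx]

theorem weight_lie_of_mul {c : ℕ → ℝ} (hc : ∀ i j, c (i + j) = c i * c j) (x y : L) :
    G.weight c ⁅x, y⁆ = ⁅G.weight c x, G.weight c y⁆ := by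
  induction x using G.layer_induction with
  | h0 => simp
  | hadd x x' hx hx' => simp [hx, hx']
  | hmem i x hx =>
    induction y using G.layer_induction with
    | h0 => simp
    | hadd y y' hy hy' => simp [hy, hy']
    | hmem j y hy =>
      rw [G.weight_of_mem c (G.lie_mem i j x y hx hy), G.weight_of_mem c hx, G.weight_of_mem c hy,
        hc, smul_lie, lie_smul, smul_smul]

theorem weight_lie_of_add {c : ℕ → ℝ} (hc : ∀ i j, c (i + j) = c i + c j) (x y : L) :
    G.weight c ⁅x, y⁆ = ⁅G.weight c x, y⁆ + ⁅x, G.weight c y⁆ := by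
  induction x using G.layer_induction with
  | h0 => simp
  | hadd x x' hx hx' => simp only [add_lie, map_add, hx, hx']; abel
  | hmem i x hx =>
    induction y using G.layer_induction with
    | h0 => simp
    | hadd y y' hy hy' => simp only [lie_add, map_add, hy, hy']; abel
    | hmem j y hy =>
      rw [G.weight_of_mem c (G.lie_mem i j x y hx hy), G.weight_of_mem c hx, G.weight_of_mem c hy,
        hc, smul_lie, lie_smul, add_smul]

/-- The derivation that acts on the `i`-th layer as multiplication by `i`. -/
noncomputable def euler : L →ₗ[ℝ] L := G.weight (fun i => (i : ℝ))

theorem euler_lie (x y : L) : G.euler ⁅x, y⁆ = ⁅G.euler x, y⁆ + ⁅x, G.euler y⁆ :=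
  G.weight_lie_of_add (by simp) x y

/-- All layers have positive degree. This makes the representation below faithful, whereas the
adjoint representation kills the centre. -/
theorem euler_injective : Function.Injective G.euler := by
  rw [← LinearMap.ker_eq_bot, LinearMap.ker_eq_bot']
  intro x hx
  refine G.ext_comp fun j => ?_
  have := G.comp_weight (fun i => (i : ℝ)) j x
  rw [← euler, hx, map_zero] at this
  rcases j with _ | j
  · simp [comp_zero]
  · rw [map_zero]
    exact (smul_eq_zero.1 this.symm).resolve_left (by positivity)

attribute [local instance] LieRing.ofAssociativeRing

/-- A faithful representation of `L`: the adjoint representation of the semidirect product of `L`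
with the derivation `euler`, restricted to `L`. -/
noncomputable def repr : L →ₗ⁅ℝ⁆ Module.End ℝ (L × ℝ) where
  toFun x := LinearMap.inl ℝ L ℝ ∘ₗ
    (LieAlgebra.ad ℝ L x ∘ₗ LinearMap.fst ℝ L ℝ + (LinearMap.snd ℝ L ℝ).smulRight (G.euler x))
  map_add' x y := by ext <;> simp
  map_smul' c x := by ext <;> simp
  map_lie' {x y} := by
    ext z <;> simp [LieRing.of_associative_ring_bracket, euler_lie]
    · rw [add_comm, ← lie_skew (G.euler x) y, sub_eq_add_neg]

theorem repr_apply (x : L) (v : L × ℝ) : G.repr x v = (⁅x, v.1⁆ + v.2 • G.euler x, 0) := by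
  simp [repr]

theorem repr_injective : Function.Injective G.repr := by
  intro x y h
  have := congrArg (fun T => (T ((0 : L), (1 : ℝ))).1) h
  simp only [repr_apply, lie_zero, zero_add, one_smul] at this
  exact G.euler_injective this

/-- The factor applied first lands in `L × 0`; from there every further factor acts by a bracket and
descends one step in the lower central series. Hence the shift by one. -/
theorem prod_repr_apply_mem (l : List L) (v : L × ℝ) (hl : l ≠ []) :
    ((l.map G.repr).prod v).1 ∈ LieModule.lowerCentralSeries ℝ L L (l.length - 1) ∧
      ((l.map G.repr).prod v).2 = 0 := by
  induction l with
  | nil => exact absurd rfl hl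
  | cons x l ih =>
    rw [List.map_cons, List.prod_cons, Module.End.mul_apply, repr_apply]
    refine ⟨?_, rfl⟩
    by_cases h : l = []
    · subst h; simp
    · obtain ⟨h1, h2⟩ := ih h
      obtain ⟨m, hm⟩ : ∃ m, l.length = m + 1 :=
        ⟨l.length - 1, by have := List.length_pos_of_ne_nil h; omega⟩
      simp only [h2, zero_smul, add_zero, List.length_cons, hm, Nat.add_sub_cancel] at h1 ⊢
      rw [LieModule.lowerCentralSeries_succ]
      exact LieSubmodule.lie_mem_lie (by simp) h1

variable {s : ℕ} (hs : LieModule.lowerCentralSeries ℝ L L s = ⊥)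

include hs

theorem prod_eq_zero_of_lowerCentralSeries (l : List (Module.End ℝ (L × ℝ)))
    (hl : ∀ z ∈ l, z ∈ G.repr.range) (hlen : s + 1 ≤ l.length) : l.prod = 0 := by
  obtain ⟨l', rfl⟩ : ∃ l' : List L, l = l'.map G.repr := by
    have : l ∈ Set.range (List.map G.repr) := by
      rw [Set.range_list_map]
      exact hl
    exact ⟨_, this.choose_spec.symm⟩
  rw [List.length_map] at hlen
  refine LinearMap.ext fun v => ?_
  obtain ⟨h1, h2⟩ := G.prod_repr_apply_mem l' v (by rintro rfl; simp at hlen)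
  have h3 := LieModule.antitone_lowerCentralSeries ℝ L L (show s ≤ l'.length - 1 by omega) h1
  rw [hs, LieSubmodule.mem_bot] at h3
  exact Prod.ext h3 h2

theorem isNilpotent_repr (x : L) : IsNilpotent (G.repr x) := by
  refine ⟨s + 1, ?_⟩
  have := G.prod_eq_zero_of_lowerCentralSeries hs (List.replicate (s + 1) (G.repr x))
    (fun z hz => by rw [List.eq_of_mem_replicate hz]; exact ⟨x, rfl⟩) (by simp)
  simpa using this

end LieGrading

section LieHom

variable {L L' : Type*} [LieRing L] [LieAlgebra ℝ L] [LieRing L'] [LieAlgebra ℝ L']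

theorem map_nestedBracket (φ : L →ₗ⁅ℝ⁆ L') (l : List L) :
    φ (nestedBracket l) = nestedBracket (l.map φ) := by
  induction l with
  | nil => simp [nestedBracket]
  | cons a l ih =>
    by_cases h : l = []
    · subst h; simp [nestedBracket]
    · rw [List.map_cons, nestedBracket_cons _ h, nestedBracket_cons _ (by simpa using h), LieHom.map_lie,
        ih]

theorem map_bch (φ : L →ₗ⁅ℝ⁆ L') (s : ℕ) (x y : L) : φ (bch s x y) = bch s (φ x) (φ y) := by
  simp only [bch]
  rw [← LieHom.coe_toLinearMap, map_sum]
  refine Finset.sum_congr rfl fun n _ => ?_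
  rw [map_sum]
  refine Finset.sum_congr rfl fun a _ => ?_
  rw [map_smul, LieHom.coe_toLinearMap, map_nestedBracket]
  congr 2
  exact map_blockWord φ a x y

end LieHom

/-! ### The group laws of the truncated series -/

namespace LieGrading

variable {L : Type v} [LieRing L] [LieAlgebra ℝ L] (G : LieGrading L)

theorem dilation_bch (c : ℝ) (s : ℕ) (x y : L) :
    G.dilation c (bch s x y) = bch s (G.dilation c x) (G.dilation c y) := by
  have h : ∀ x y, G.dilation c ⁅x, y⁆ = ⁅G.dilation c x, G.dilation c y⁆ :=
    G.weight_lie_of_mul (c := fun i => c ^ i) (fun i j => pow_add c i j)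
  exact map_bch { G.dilation c with map_lie' := @h } s x y

variable {s : ℕ} (hs : LieModule.lowerCentralSeries ℝ L L s = ⊥)

include G hs

section

attribute [local instance] LieRing.ofAssociativeRing

theorem exp_repr_bch [Module ℚ (Module.End ℝ (L × ℝ))] (x y : L) :
    IsNilpotent.exp (G.repr (bch s x y)) = IsNilpotent.exp (G.repr x) * IsNilpotent.exp (G.repr y) := by
  rw [map_bch]
  refine exp_bch_of_prod_eq_zero fun l hl hlen =>
    G.prod_eq_zero_of_lowerCentralSeries hs l (fun z hz => ?_) hlen
  rcases hl z hz with rfl | rfl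
  · exact ⟨x, rfl⟩
  · exact ⟨y, rfl⟩

theorem eq_of_exp_repr_eq [Module ℚ (Module.End ℝ (L × ℝ))] {x y : L}
    (h : IsNilpotent.exp (G.repr x) = IsNilpotent.exp (G.repr y)) : x = y :=
  G.repr_injective (PowerSeries.exp_injOn_isNilpotent (G.isNilpotent_repr hs x)
    (G.isNilpotent_repr hs y) h)

/-- In the faithful representation the product becomes multiplication of unipotent operators, and
`exp` is injective on nilpotent ones. -/
theorem bch_assoc (x y z : L) : bch s (bch s x y) z = bch s x (bch s y z) := by
  -- `IsNilpotent.exp` has rational coefficients, so a rational structure is chosen by restricting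
  -- scalars.
  let : Module ℚ (Module.End ℝ (L × ℝ)) := Module.compHom _ (algebraMap ℚ ℝ)
  refine G.eq_of_exp_repr_eq hs ?_
  simp only [G.exp_repr_bch hs, mul_assoc]

theorem bch_of_lie_eq_zero {x y : L} (h : ⁅x, y⁆ = 0) : bch s x y = x + y := by
  let : Module ℚ (Module.End ℝ (L × ℝ)) := Module.compHom _ (algebraMap ℚ ℝ)
  refine G.eq_of_exp_repr_eq hs ?_
  rw [G.exp_repr_bch hs, map_add, IsNilpotent.exp_add_of_commute ?_ (G.isNilpotent_repr hs x)
    (G.isNilpotent_repr hs y)]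
  have := congrArg G.repr h
  rw [LieHom.map_lie, map_zero, LieRing.of_associative_ring_bracket, sub_eq_zero] at this
  exact this

end

theorem bch_zero (x : L) : bch s x 0 = x := by
  rw [G.bch_of_lie_eq_zero hs (lie_zero x), add_zero]

theorem zero_bch (x : L) : bch s 0 x = x := by
  rw [G.bch_of_lie_eq_zero hs (zero_lie x), zero_add]

theorem bch_self (x : L) : bch s x x = x + x := G.bch_of_lie_eq_zero hs (lie_self x)

theorem bch_neg_self (x : L) : bch s x (-x) = 0 := by
  rw [G.bch_of_lie_eq_zero hs (by simp), add_neg_cancel]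

theorem neg_bch_self (x : L) : bch s (-x) x = 0 := by
  rw [G.bch_of_lie_eq_zero hs (by simp), neg_add_cancel]

theorem neg_bch (x y : L) : -bch s x y = bch s (-y) (-x) := by
  have h : bch s (bch s x y) (bch s (-y) (-x)) = 0 := by
    rw [G.bch_assoc hs, ← G.bch_assoc hs y, G.bch_neg_self hs, G.zero_bch hs, G.bch_neg_self hs]
  calc -bch s x y = bch s (-bch s x y) (bch s (bch s x y) (bch s (-y) (-x))) := by
        rw [h, G.bch_zero hs]
    _ = bch s (-y) (-x) := by rw [← G.bch_assoc hs, G.neg_bch_self hs, G.zero_bch hs]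

/-- `x⁻¹ z = (x⁻¹ y) (y⁻¹ z)`. -/
theorem bch_neg_trans (x y z : L) : bch s (-x) z = bch s (bch s (-x) y) (bch s (-y) z) := by
  rw [G.bch_assoc hs, ← G.bch_assoc hs y, G.bch_neg_self hs, G.zero_bch hs]

/-- `y⁻¹ z = (x⁻¹ y)⁻¹ (x⁻¹ z)`. -/
theorem bch_neg_eq (x y z : L) : bch s (-y) z = bch s (-bch s (-x) y) (bch s (-x) z) := by
  rw [G.neg_bch hs, neg_neg, ← G.bch_neg_trans hs]

end LieGrading

/-! ### Components of a product in the layers -/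

section WordExpansion

variable {L : Type v} [LieRing L] [LieAlgebra ℝ L]

/-- To prove a property of `bch s`, stable under linear combinations, it is enough to check it on the
nested brackets of nonempty words of length at most `s`. -/
theorem bch_induction {s : ℕ} {P : (L → L → L) → Prop} (h0 : P fun _ _ => 0)
    (hadd : ∀ F F', P F → P F' → P fun x y => F x y + F' x y)
    (hsmul : ∀ (c : ℝ) F, P F → P fun x y => c • F x y)
    (hword : ∀ l : List Bool, l ≠ [] → l.length ≤ s →
      P fun x y => nestedBracket (l.map fun b => cond b x y)) : P (bch s) := by
  have hsum : ∀ {ι : Type} (t : Finset ι) (F : ι → L → L → L), (∀ i ∈ t, P (F i)) →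
      P fun x y => ∑ i ∈ t, F i x y := by
    intro ι t F
    induction t using Finset.cons_induction with
    | empty => simpa using h0
    | cons i t hi ih =>
      intro h
      simp only [Finset.sum_cons]
      exact hadd _ _ (h i (by simp)) (ih fun j hj => h j (by simp [hj]))
  refine hsum (Finset.Icc 1 s) _ fun n hn => hsum _ _ fun a ha => hsmul _ _ ?_
  have hw : ∀ x y : L, (List.ofFn fun i => List.replicate ((a i).1 : ℕ) x
      ++ List.replicate ((a i).2 : ℕ) y).flatten
      = (blockWord a true false).map fun b => cond b x y := fun x y =>
    (map_blockWord (fun b => cond b x y) a true false).symm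
  simp only [hw]
  simp only [Finset.mem_filter, Finset.mem_univ, true_and] at ha
  have hlen := length_blockWord a true false
  refine hword _ ?_ (hlen.trans_le ha.2)
  rw [← List.length_pos_iff_ne_nil, hlen]
  have hn1 := (Finset.mem_Icc.1 hn).1
  exact Finset.sum_pos (fun i _ => ha.1 i) ⟨⟨0, hn1⟩, Finset.mem_univ _⟩

end WordExpansion

namespace LieGrading

variable {L : Type v} [LieRing L] [LieAlgebra ℝ L] (G : LieGrading L)

theorem comp_lie (k : ℕ) (x y : L) :
    G.comp k ⁅x, y⁆ = ∑ ij ∈ Finset.HasAntidiagonal.antidiagonal k, ⁅G.comp ij.1 x, G.comp ij.2 y⁆ := by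
  induction x using G.layer_induction with
  | h0 => simp
  | hadd x x' hx hx' => simp [hx, hx', Finset.sum_add_distrib]
  | hmem i x hx =>
    induction y using G.layer_induction with
    | h0 => simp
    | hadd y y' hy hy' => simp [hy, hy', Finset.sum_add_distrib]
    | hmem j y hy =>
      by_cases hk : i + j = k
      · rw [Finset.sum_eq_single (i, j)]
        · rw [G.comp_of_mem hx, G.comp_of_mem hy]
          exact G.comp_of_mem (hk ▸ G.lie_mem i j x y hx hy)
        · rintro ⟨a, b⟩ - hne
          by_cases ha : i = a
          · have hb : j ≠ b := fun hb => hne (by rw [ha, hb])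
            simp [G.comp_of_mem_ne hb hy]
          · simp [G.comp_of_mem_ne ha hx]
        · intro h
          exact absurd (Finset.HasAntidiagonal.mem_antidiagonal.2 hk) h
      · rw [G.comp_of_mem_ne hk (G.lie_mem i j x y hx hy), Finset.sum_eq_zero]
        rintro ⟨a, b⟩ hab
        have hab' : a + b = k := Finset.HasAntidiagonal.mem_antidiagonal.1 hab
        by_cases ha : i = a
        · have hb : j ≠ b := fun hb => hk (by omega)
          simp [G.comp_of_mem_ne hb hy]
        · simp [G.comp_of_mem_ne ha hx]

theorem comp_lie_eq_zero {i j k : ℕ} {x y : L} (hx : ∀ a < i, G.comp a x = 0)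
    (hy : ∀ b < j, G.comp b y = 0) (hk : k < i + j) : G.comp k ⁅x, y⁆ = 0 := by
  rw [comp_lie, Finset.sum_eq_zero]
  rintro ⟨a, b⟩ hab
  have hab' : a + b = k := Finset.HasAntidiagonal.mem_antidiagonal.1 hab
  by_cases ha : a < i
  · simp [hx a ha]
  · simp [hy b (by omega)]

/-- The part of `x` in the layers below the `j`-th. -/
noncomputable def below (j : ℕ) : L →ₗ[ℝ] L := G.weight fun i => if i < j then 1 else 0

theorem comp_below (j i : ℕ) (x : L) :
    G.comp i (G.below j x) = if i < j then G.comp i x else 0 := by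
  rw [below, comp_weight]
  split_ifs <;> simp

/-- Since layer `0` is trivial, a bracket raises the degree by at least one. So the `j`-th component
of a bracket of two or more letters does not see the letters' layers from `j` on. -/
theorem comp_nestedBracket_below (j : ℕ) (x y : L) (l : List Bool) :
    ((∀ k < j, G.comp k (nestedBracket (l.map fun b => cond b x y)
        - nestedBracket (l.map fun b => cond b (G.below j x) (G.below j y))) = 0)) ∧
      (2 ≤ l.length → G.comp j (nestedBracket (l.map fun b => cond b x y)
        - nestedBracket (l.map fun b => cond b (G.below j x) (G.below j y))) = 0) := by
  have hlet : ∀ b : Bool, ∀ k < j,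
      G.comp k (cond b x y - cond b (G.below j x) (G.below j y)) = 0 := by
    intro b k hk
    cases b <;> simp [comp_below, hk]
  induction l with
  | nil => simp [nestedBracket]
  | cons b l ih =>
    by_cases h : l = []
    · subst h
      refine ⟨fun k hk => ?_, fun h => by simp at h⟩
      simpa [nestedBracket] using hlet b k hk
    · have key : ∀ k < j + 1, G.comp k (nestedBracket ((b :: l).map fun b => cond b x y)
          - nestedBracket ((b :: l).map fun b => cond b (G.below j x) (G.below j y))) = 0 := by
        intro k hk
        rw [List.map_cons, List.map_cons, nestedBracket_cons _ (by simpa using h),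
          nestedBracket_cons _ (by simpa using h)]
        set u := nestedBracket (l.map fun b => cond b x y)
        set u' := nestedBracket (l.map fun b => cond b (G.below j x) (G.below j y))
        have e : ∀ a a' : L, ⁅a, u⁆ - ⁅a', u'⁆ = ⁅a - a', u⁆ + ⁅a', u - u'⁆ := by
          intro a a'
          rw [sub_lie, lie_sub]
          abel
        rw [e, map_add, G.comp_lie_eq_zero (i := j) (j := 1) (hlet b) _ hk,
          G.comp_lie_eq_zero (i := 1) (j := j) _ ih.1 (by omega), add_zero]
        · intro a ha
          rw [Nat.lt_one_iff.1 ha, comp_zero]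
        · intro a ha
          rw [Nat.lt_one_iff.1 ha, comp_zero]
      exact ⟨fun k hk => key k (by omega), fun _ => key j (by omega)⟩

/-- Only the words of length one see the `j`-th layer of the letters, and they do so linearly. -/
theorem exists_comp_bch_sub (s j : ℕ) : ∃ α β : ℝ, ∀ x y : L,
    G.comp j (bch s x y - bch s (G.below j x) (G.below j y))
      = α • G.comp j x + β • G.comp j y := by
  refine bch_induction (s := s) (P := fun F => ∃ α β : ℝ, ∀ x y : L,
    G.comp j (F x y - F (G.below j x) (G.below j y)) = α • G.comp j x + β • G.comp j y)
    ⟨0, 0, by simp⟩ ?_ ?_ ?_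
  · rintro F F' ⟨α, β, h⟩ ⟨α', β', h'⟩
    refine ⟨α + α', β + β', fun x y => ?_⟩
    rw [add_sub_add_comm, map_add, h, h', add_smul, add_smul]
    abel
  · rintro c F ⟨α, β, h⟩
    refine ⟨c * α, c * β, fun x y => ?_⟩
    rw [← smul_sub, map_smul, h, smul_add, smul_smul, smul_smul]
  · intro l hl _
    by_cases h2 : 2 ≤ l.length
    · exact ⟨0, 0, fun x y => by simpa using (G.comp_nestedBracket_below j x y l).2 h2⟩
    · obtain ⟨b, rfl⟩ : ∃ b, l = [b] := List.length_eq_one_iff.1 (by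
        have := List.length_pos_iff_ne_nil.2 hl
        omega)
      cases b
      · exact ⟨0, 1, fun x y => by simp [nestedBracket, comp_below]⟩
      · exact ⟨1, 0, fun x y => by simp [nestedBracket, comp_below]⟩

/-- A nested bracket of `i` horizontal letters lies in layer `i`, and only words of length at most
`s` occur. -/
theorem comp_bch_of_mem_layer_one {s k : ℕ} (hk : s < k) {x y : L} (hx : x ∈ G.layer 1)
    (hy : y ∈ G.layer 1) : G.comp k (bch s x y) = 0 := by
  refine bch_induction (s := s) (P := fun F => ∀ x ∈ G.layer 1, ∀ y ∈ G.layer 1,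
    G.comp k (F x y) = 0) (by simp) ?_ ?_ ?_ x hx y hy
  · intro F F' h h' x hx y hy
    simp [h x hx y hy, h' x hx y hy]
  · intro c F h x hx y hy
    simp [h x hx y hy]
  · intro l hl hlen x hx y hy
    have hm : ∀ l : List Bool, l ≠ [] →
        nestedBracket (l.map fun b => cond b x y) ∈ G.layer l.length := by
      intro l
      induction l with
      | nil => simp
      | cons b l ih =>
        intro _
        have hb : cond b x y ∈ G.layer 1 := by cases b <;> simpa
        by_cases h : l = []
        · subst h
          simpa [nestedBracket] using hb
        · rw [List.map_cons, nestedBracket_cons _ (by simpa using h), List.length_cons, add_comm]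
          exact G.lie_mem 1 _ _ _ hb (ih h)
    exact G.comp_of_mem_ne (by omega) (hm l hl)

variable {s : ℕ} (hs : LieModule.lowerCentralSeries ℝ L L s = ⊥)

include hs

theorem comp_bch (j : ℕ) (x y : L) :
    G.comp j (bch s x y)
      = G.comp j x + G.comp j y + G.comp j (bch s (G.below j x) (G.below j y)) := by
  obtain ⟨α, β, h⟩ := G.exists_comp_bch_sub s j
  -- The linear coefficients are identified without expanding the series, by making one factor the
  -- identity.
  have hx := h x 0
  have hy := h 0 y
  simp only [map_zero, G.bch_zero hs, G.zero_bch hs, smul_zero, add_zero, zero_add, map_sub,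
    comp_below, lt_irrefl, if_false, sub_zero] at hx hy
  rw [← sub_eq_iff_eq_add, ← map_sub, h, ← hx, ← hy]

theorem comp_one_bch (x y : L) : G.comp 1 (bch s x y) = G.comp 1 x + G.comp 1 y := by
  have h0 : ∀ z, G.below 1 z = 0 := by
    intro z
    refine G.ext_comp fun j => ?_
    rw [comp_below, map_zero]
    split_ifs with hj
    · rw [Nat.lt_one_iff.1 hj, comp_zero]
    · rfl
  rw [G.comp_bch hs, h0, h0, G.bch_zero hs, map_zero, add_zero]

end LieGrading

/-! ### Euclidean norms and Lipschitz bounds for the product -/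

section EuclideanGauge

variable {L : Type v} [AddCommGroup L] [Module ℝ L] [FiniteDimensional ℝ L] [TopologicalSpace L]
  [IsTopologicalAddGroup L] [ContinuousSMul ℝ L] [T2Space L]

/-- The norm of a Euclidean structure on a finite-dimensional space. -/
noncomputable def euclNorm (x : L) : ℝ := ‖toEuclidean x‖

theorem euclNorm_nonneg (x : L) : 0 ≤ euclNorm x := norm_nonneg _

@[simp]
theorem euclNorm_zero : euclNorm (0 : L) = 0 := by simp [euclNorm]

theorem euclNorm_eq_zero {x : L} : euclNorm x = 0 ↔ x = 0 := by simp [euclNorm]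

theorem euclNorm_add_le (x y : L) : euclNorm (x + y) ≤ euclNorm x + euclNorm y := by
  simpa [euclNorm] using norm_add_le _ _

theorem euclNorm_smul (c : ℝ) (x : L) : euclNorm (c • x) = |c| * euclNorm x := by
  simp [euclNorm, norm_smul]

@[simp]
theorem euclNorm_neg (x : L) : euclNorm (-x) = euclNorm x := by simp [euclNorm]

theorem euclNorm_sub_rev (x y : L) : euclNorm (x - y) = euclNorm (y - x) := by
  rw [← neg_sub, euclNorm_neg]

theorem euclNorm_sub_le (x y : L) : euclNorm (x - y) ≤ euclNorm x + euclNorm y := by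
  simpa [sub_eq_add_neg] using euclNorm_add_le x (-y)

theorem euclNorm_sum_le {ι : Type*} (t : Finset ι) (f : ι → L) :
    euclNorm (∑ i ∈ t, f i) ≤ ∑ i ∈ t, euclNorm (f i) := by
  simpa [euclNorm] using norm_sum_le t fun i => toEuclidean (f i)

theorem continuous_euclNorm : Continuous (euclNorm : L → ℝ) :=
  toEuclidean.continuous.norm

theorem euclNorm_parallelogram (x y : L) :
    euclNorm (x + y) ^ 2 + euclNorm (x - y) ^ 2 = 2 * (euclNorm x ^ 2 + euclNorm y ^ 2) := by
  have := parallelogram_law_with_norm ℝ (toEuclidean x) (toEuclidean y)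
  simp only [euclNorm, map_add, map_sub]
  nlinarith [this]

theorem isCompact_setOf_euclNorm_le (R : ℝ) : IsCompact {x : L | euclNorm x ≤ R} := by
  have : {x : L | euclNorm x ≤ R} = toEuclidean ⁻¹' Metric.closedBall 0 R := by
    ext x; simp [euclNorm]
  rw [this]
  exact toEuclidean.toHomeomorph.isCompact_preimage.2 (isCompact_closedBall _ _)

theorem exists_euclNorm_map_le (T : L →ₗ[ℝ] L) : ∃ C, 0 ≤ C ∧ ∀ x, euclNorm (T x) ≤ C * euclNorm x := by
  set S := (toEuclidean.toLinearEquiv.toLinearMap ∘ₗ T ∘ₗ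
    (toEuclidean (E := L)).symm.toLinearEquiv.toLinearMap).toContinuousLinearMap
  refine ⟨‖S‖, norm_nonneg _, fun x => ?_⟩
  have := S.le_opNorm (toEuclidean x)
  simpa [S, euclNorm] using this

end EuclideanGauge

section ContinuityOfBch

variable {L : Type v} [LieRing L] [LieAlgebra ℝ L] [FiniteDimensional ℝ L] [TopologicalSpace L]
  [IsTopologicalAddGroup L] [ContinuousSMul ℝ L] [T2Space L]

theorem exists_continuousBilinear_lie :
    ∃ B : EuclideanSpace ℝ (Fin (Module.finrank ℝ L)) →L[ℝ]
        EuclideanSpace ℝ (Fin (Module.finrank ℝ L)) →L[ℝ] EuclideanSpace ℝ (Fin (Module.finrank ℝ L)),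
      ∀ x y : L, B (toEuclidean x) (toEuclidean y) = toEuclidean ⁅x, y⁆ := by
  let e := (toEuclidean (E := L)).toLinearEquiv
  let b : EuclideanSpace ℝ (Fin (Module.finrank ℝ L)) →ₗ[ℝ]
      EuclideanSpace ℝ (Fin (Module.finrank ℝ L)) →ₗ[ℝ] EuclideanSpace ℝ (Fin (Module.finrank ℝ L)) :=
    LinearMap.mk₂ ℝ (fun u v => e ⁅e.symm u, e.symm v⁆) (by simp) (by simp) (by simp) (by simp)
  refine ⟨(LinearMap.toContinuousLinearMap.toLinearMap ∘ₗ b).toContinuousLinearMap, fun x y => ?_⟩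
  change e ⁅e.symm (e x), e.symm (e y)⁆ = e ⁅x, y⁆
  simp

theorem exists_euclNorm_lie_le :
    ∃ B, 0 ≤ B ∧ ∀ x y : L, euclNorm ⁅x, y⁆ ≤ B * euclNorm x * euclNorm y := by
  obtain ⟨B, hB⟩ := exists_continuousBilinear_lie (L := L)
  refine ⟨‖B‖, ContinuousLinearMap.opNorm_nonneg B, fun x y => ?_⟩
  rw [euclNorm, ← hB]
  exact B.le_opNorm₂ _ _

theorem continuous_lie : Continuous fun p : L × L => ⁅p.1, p.2⁆ := by
  obtain ⟨B, hB⟩ := exists_continuousBilinear_lie (L := L)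
  have : (fun p : L × L => ⁅p.1, p.2⁆)
      = fun p : L × L => toEuclidean.symm (B (toEuclidean p.1) (toEuclidean p.2)) := by
    funext p
    simp [hB]
  rw [this]
  fun_prop

theorem continuous_bch (s : ℕ) : Continuous fun p : L × L => bch s p.1 p.2 := by
  refine bch_induction (s := s) (P := fun F => Continuous fun p : L × L => F p.1 p.2)
    continuous_const (fun F F' h h' => h.add h') (fun c F h => h.const_smul c) ?_
  rintro l - -
  induction l with
  | nil => simpa [nestedBracket] using continuous_const
  | cons b l ih =>
    have hb : Continuous fun p : L × L => cond b p.1 p.2 := by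
      cases b
      · exact continuous_snd
      · exact continuous_fst
    by_cases h : l = []
    · subst h
      simpa [nestedBracket] using hb
    · simp only [List.map_cons]
      simp only [nestedBracket_cons _ (show l.map _ ≠ [] by simpa using h)]
      exact continuous_lie.comp (hb.prodMk ih)

/-- `bch` is Lipschitz on bounded sets. -/
theorem exists_euclNorm_bch_sub_le (s : ℕ) (R : ℝ) : ∃ C, 0 ≤ C ∧ ∀ (x y x' y' : L) (δ : ℝ),
    euclNorm x ≤ R → euclNorm y ≤ R → euclNorm x' ≤ R → euclNorm y' ≤ R →
    euclNorm (x - x') ≤ δ → euclNorm (y - y') ≤ δ →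
      euclNorm (bch s x y - bch s x' y') ≤ C * δ := by
  refine bch_induction (s := s) (P := fun F => ∃ C, 0 ≤ C ∧ ∀ (x y x' y' : L) (δ : ℝ),
    euclNorm x ≤ R → euclNorm y ≤ R → euclNorm x' ≤ R → euclNorm y' ≤ R →
    euclNorm (x - x') ≤ δ → euclNorm (y - y') ≤ δ → euclNorm (F x y - F x' y') ≤ C * δ)
    ⟨0, le_rfl, by simp⟩ ?_ ?_ ?_
  · rintro F F' ⟨C, hC, h⟩ ⟨C', hC', h'⟩
    refine ⟨C + C', by positivity, fun x y x' y' δ h1 h2 h3 h4 h5 h6 => ?_⟩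
    rw [add_sub_add_comm, add_mul]
    exact (euclNorm_add_le _ _).trans
      (add_le_add (h x y x' y' δ h1 h2 h3 h4 h5 h6) (h' x y x' y' δ h1 h2 h3 h4 h5 h6))
  · rintro c F ⟨C, hC, h⟩
    refine ⟨|c| * C, by positivity, fun x y x' y' δ h1 h2 h3 h4 h5 h6 => ?_⟩
    rw [← smul_sub, euclNorm_smul, mul_assoc]
    exact mul_le_mul_of_nonneg_left (h x y x' y' δ h1 h2 h3 h4 h5 h6) (abs_nonneg c)
  · rintro l - -
    obtain ⟨B, hB, hlie⟩ := exists_euclNorm_lie_le (L := L)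
    -- The product rule for the bracket needs the bound `M` on the shorter bracket as well as its
    -- Lipschitz constant `C`.
    suffices H : ∃ C M, 0 ≤ C ∧ 0 ≤ M ∧ ∀ (x y x' y' : L) (δ : ℝ),
        euclNorm x ≤ R → euclNorm y ≤ R → euclNorm x' ≤ R → euclNorm y' ≤ R →
        euclNorm (x - x') ≤ δ → euclNorm (y - y') ≤ δ →
        euclNorm (nestedBracket (l.map fun b => cond b x y)) ≤ M ∧
        euclNorm (nestedBracket (l.map fun b => cond b x y)
          - nestedBracket (l.map fun b => cond b x' y')) ≤ C * δ by
      obtain ⟨C, M, hC, -, h⟩ := H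
      exact ⟨C, hC, fun x y x' y' δ h1 h2 h3 h4 h5 h6 => (h x y x' y' δ h1 h2 h3 h4 h5 h6).2⟩
    induction l with
    | nil => exact ⟨0, 0, le_rfl, le_rfl, by simp [nestedBracket]⟩
    | cons b l ih =>
      obtain ⟨C, M, hC, hM, h⟩ := ih
      by_cases hl : l = []
      · subst hl
        refine ⟨1, max R 0, zero_le_one, le_max_right _ _, fun x y x' y' δ h1 h2 h3 h4 h5 h6 => ?_⟩
        cases b
        · simpa [nestedBracket] using ⟨Or.inl h2, h6⟩
        · simpa [nestedBracket] using ⟨Or.inl h1, h5⟩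
      · refine ⟨B * M + B * max R 0 * C, B * max R 0 * M, by positivity, by positivity,
          fun x y x' y' δ h1 h2 h3 h4 h5 h6 => ?_⟩
        obtain ⟨k1, k2⟩ := h x y x' y' δ h1 h2 h3 h4 h5 h6
        have hδ : 0 ≤ δ := (euclNorm_nonneg _).trans h5
        have hb : euclNorm (cond b x y) ≤ max R 0 := by
          cases b
          · exact h2.trans (le_max_left _ _)
          · exact h1.trans (le_max_left _ _)
        have hb' : euclNorm (cond b x' y') ≤ max R 0 := by
          cases b
          · exact h4.trans (le_max_left _ _)
          · exact h3.trans (le_max_left _ _)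
        have hbd : euclNorm (cond b x y - cond b x' y') ≤ δ := by
          cases b
          · exact h6
          · exact h5
        rw [List.map_cons, List.map_cons, nestedBracket_cons _ (by simpa using hl),
          nestedBracket_cons _ (by simpa using hl)]
        set u := nestedBracket (l.map fun b => cond b x y)
        set u' := nestedBracket (l.map fun b => cond b x' y')
        set a := cond b x y
        set a' := cond b x' y'
        constructor
        · refine (hlie _ _).trans ?_
          gcongr
          exact euclNorm_nonneg _
        · have e : ⁅a, u⁆ - ⁅a', u'⁆ = ⁅a - a', u⁆ + ⁅a', u - u'⁆ := by
            rw [sub_lie, lie_sub]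
            abel
          rw [e]
          calc _ ≤ B * euclNorm (a - a') * euclNorm u + B * euclNorm a' * euclNorm (u - u') :=
                (euclNorm_add_le _ _).trans (add_le_add (hlie _ _) (hlie _ _))
            _ ≤ B * δ * M + B * max R 0 * (C * δ) := by
                have := euclNorm_nonneg u
                have := euclNorm_nonneg (u - u')
                gcongr
            _ = _ := by ring

end ContinuityOfBch

/-! ### Markov chains: from four points to branching sums -/

namespace MarkovChain

variable {Ω : Type u} [MeasurableSpace Ω] (X : MarkovChain Ω)

instance (t : ℤ) (m : ℕ) : IsMarkovKernel (X.trans t m) := by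
  have := X.isMarkovKernel_step
  induction m with
  | zero => rw [trans]; infer_instance
  | succ m ih => rw [trans]; infer_instance

theorem law_bind_trans (t : ℤ) (m : ℕ) : (X.law t).bind (X.trans t m) = X.law (t + m) := by
  induction m with
  | zero => simp [trans]
  | succ m ih =>
    rw [trans, ← Measure.comp_assoc, ih, X.law_succ, add_assoc]
    simp

theorem trans_add (t : ℤ) (m n : ℕ) :
    X.trans t (m + n) = X.trans (t + m) n ∘ₖ X.trans t m := by
  induction n with
  | zero => simp [trans]
  | succ n ih =>
    rw [← Nat.add_assoc, trans, trans, ih, Kernel.comp_assoc, Nat.cast_add, add_assoc]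

/-- `E[N(X_t, X_{t+m})]`. -/
noncomputable def expectPair (t : ℤ) (m : ℕ) (N : Ω → Ω → ℝ≥0∞) : ℝ≥0∞ :=
  ∫⁻ x, ∫⁻ y, N x y ∂(X.trans t m x) ∂(X.law t)

theorem expectPair_one (t : ℤ) (N : Ω → Ω → ℝ≥0∞) : X.expectPair t 1 N = X.expectStep t N := by
  simp [expectPair, expectStep, trans]

variable {X} {N T : Ω → Ω → ℝ≥0∞} {κ Q : ℝ≥0∞}

/-- Integrate the four point inequality with `x`, `y` at times `t`, `t + m` and with `z`, `w` two
independent continuations of `y` to time `t + 2m`. Each continuation has the law of the original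
chain. -/
theorem two_mul_expectPair_add_le (hN : Measurable (Function.uncurry N))
    (hT : Measurable (Function.uncurry T))
    (h4 : ∀ x y z w, 2 * (N x z + N x w + κ * T z w) ≤ Q * (2 * N x y + (N y z + N y w)))
    (t : ℤ) (m : ℕ) :
    2 * X.expectPair t (m + m) N + κ * X.expectBranch (t + m) m T
      ≤ Q * (X.expectPair t m N + X.expectPair (t + m) m N) := by
  have hNr : ∀ x, Measurable (N x) := fun x => hN.of_uncurry_left
  have hTr : ∀ x, Measurable (T x) := fun x => hT.of_uncurry_left
  set P := X.trans (t + m) m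
  have mN : Measurable fun p : Ω × Ω => ∫⁻ z, N p.1 z ∂(P p.2) :=
    Measurable.lintegral_kernel_prod_right' (κ := P.comap Prod.snd measurable_snd)
      (f := fun q : (Ω × Ω) × Ω => N q.1.1 q.2)
      (hN.comp ((measurable_fst.comp measurable_fst).prodMk measurable_snd))
  have mν : Measurable fun y => ∫⁻ z, N y z ∂(P y) := hN.lintegral_kernel_prod_right
  have mTi : Measurable fun q : Ω × Ω => ∫⁻ w, T q.2 w ∂(P q.1) :=
    Measurable.lintegral_kernel_prod_right' (κ := P.comap Prod.fst measurable_fst)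
      (f := fun q : (Ω × Ω) × Ω => T q.1.2 q.2)
      (hT.comp ((measurable_snd.comp measurable_fst).prodMk measurable_snd))
  have mτ : Measurable fun y => ∫⁻ z, ∫⁻ w, T z w ∂(P y) ∂(P y) :=
    Measurable.lintegral_kernel_prod_right' (κ := P) mTi
  have mT' : ∀ y, Measurable fun z => ∫⁻ w, T z w ∂(P y) := fun y =>
    mTi.comp (measurable_const.prodMk measurable_id)
  -- First integrate over `z` and `w` with `x`, `y` fixed. The two play symmetric roles, so a common
  -- factor `2` appears and cancels.
  have key : ∀ x y, 2 * ∫⁻ z, N x z ∂(P y) + κ * ∫⁻ z, ∫⁻ w, T z w ∂(P y) ∂(P y)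
      ≤ Q * (N x y + ∫⁻ z, N y z ∂(P y)) := by
    intro x y
    have h : ∫⁻ z, ∫⁻ w, 2 * (N x z + N x w + κ * T z w) ∂(P y) ∂(P y)
        ≤ ∫⁻ z, ∫⁻ w, Q * (2 * N x y + (N y z + N y w)) ∂(P y) ∂(P y) :=
      lintegral_mono fun z => lintegral_mono fun w => h4 x y z w
    have e1 : ∫⁻ z, ∫⁻ w, 2 * (N x z + N x w + κ * T z w) ∂(P y) ∂(P y)
        = 2 * (2 * ∫⁻ z, N x z ∂(P y) + κ * ∫⁻ z, ∫⁻ w, T z w ∂(P y) ∂(P y)) := by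
      have i1 : ∀ z, ∫⁻ w, 2 * (N x z + N x w + κ * T z w) ∂(P y)
          = 2 * (N x z + ∫⁻ w, N x w ∂(P y) + κ * ∫⁻ w, T z w ∂(P y)) := by
        intro z
        rw [lintegral_const_mul _ ((measurable_const.fun_add (hNr x)).fun_add ((hTr z).const_mul κ)),
          lintegral_add_left (measurable_const.fun_add (hNr x)), lintegral_add_left measurable_const,
          lintegral_const_mul _ (hTr z), lintegral_const, measure_univ, mul_one]
      simp only [i1]
      rw [lintegral_const_mul _ (((hNr x).fun_add measurable_const).fun_add ((mT' y).const_mul κ)),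
        lintegral_add_left ((hNr x).fun_add measurable_const), lintegral_add_left (hNr x),
        lintegral_const_mul _ (mT' y), lintegral_const, measure_univ, mul_one, two_mul (∫⁻ z, N x z ∂(P y))]
    have e2 : ∫⁻ z, ∫⁻ w, Q * (2 * N x y + (N y z + N y w)) ∂(P y) ∂(P y)
        = 2 * (Q * (N x y + ∫⁻ z, N y z ∂(P y))) := by
      have i1 : ∀ z, ∫⁻ w, Q * (2 * N x y + (N y z + N y w)) ∂(P y)
          = Q * (2 * N x y + (N y z + ∫⁻ w, N y w ∂(P y))) := by
        intro z
        rw [lintegral_const_mul _ (measurable_const.fun_add (measurable_const.fun_add (hNr y))),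
          lintegral_add_left measurable_const, lintegral_add_left measurable_const,
          lintegral_const, lintegral_const, measure_univ, mul_one, mul_one]
      simp only [i1]
      rw [lintegral_const_mul _ (measurable_const.fun_add ((hNr y).fun_add measurable_const)),
          lintegral_add_left measurable_const, lintegral_add_left (hNr y),
          lintegral_const, lintegral_const, measure_univ, mul_one, mul_one]
      ring
    rw [e1, e2] at h
    exact (ENNReal.mul_le_mul_iff_right two_ne_zero ENNReal.ofNat_ne_top).1 h
  have hp := X.isProbabilityMeasure_law
  have h : ∫⁻ x, ∫⁻ y, (2 * ∫⁻ z, N x z ∂(P y) + κ * ∫⁻ z, ∫⁻ w, T z w ∂(P y) ∂(P y))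
        ∂(X.trans t m x) ∂(X.law t)
      ≤ ∫⁻ x, ∫⁻ y, Q * (N x y + ∫⁻ z, N y z ∂(P y)) ∂(X.trans t m x) ∂(X.law t) :=
    lintegral_mono fun x => lintegral_mono fun y => key x y
  have hlaw : ∀ g : Ω → ℝ≥0∞, Measurable g →
      ∫⁻ x, ∫⁻ y, g y ∂(X.trans t m x) ∂(X.law t) = ∫⁻ y, g y ∂(X.law (t + m)) := by
    intro g hg
    rw [← X.law_bind_trans t m, Measure.lintegral_bind (Kernel.aemeasurable _) hg.aemeasurable]
  have mNx : ∀ x, Measurable fun y => ∫⁻ z, N x z ∂(P y) := fun x =>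
    mN.comp (measurable_const.prodMk measurable_id)
  have mA : Measurable fun x => ∫⁻ y, ∫⁻ z, N x z ∂(P y) ∂(X.trans t m x) :=
    Measurable.lintegral_kernel_prod_right' (κ := X.trans t m) mN
  have mB : Measurable fun x => ∫⁻ y, N x y ∂(X.trans t m x) := hN.lintegral_kernel_prod_right
  have e1 : ∫⁻ x, ∫⁻ y, (2 * ∫⁻ z, N x z ∂(P y) + κ * ∫⁻ z, ∫⁻ w, T z w ∂(P y) ∂(P y))
        ∂(X.trans t m x) ∂(X.law t)
      = 2 * X.expectPair t (m + m) N + κ * X.expectBranch (t + m) m T := by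
    have i1 : ∀ x, ∫⁻ y, (2 * ∫⁻ z, N x z ∂(P y) + κ * ∫⁻ z, ∫⁻ w, T z w ∂(P y) ∂(P y))
        ∂(X.trans t m x) = 2 * ∫⁻ y, ∫⁻ z, N x z ∂(P y) ∂(X.trans t m x)
          + κ * ∫⁻ y, ∫⁻ z, ∫⁻ w, T z w ∂(P y) ∂(P y) ∂(X.trans t m x) := by
      intro x
      rw [lintegral_add_left ((mNx x).const_mul 2), lintegral_const_mul _ (mNx x),
        lintegral_const_mul _ mτ]
    simp only [i1]
    rw [lintegral_add_left (mA.const_mul 2), lintegral_const_mul _ mA,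
      lintegral_const_mul _ mτ.lintegral_kernel, hlaw _ mτ, expectPair, expectBranch]
    simp only [X.trans_add t m m]
    congr 2
    refine lintegral_congr fun x => ?_
    rw [Kernel.lintegral_comp _ _ _ (hNr x)]
  have e2 : ∫⁻ x, ∫⁻ y, Q * (N x y + ∫⁻ z, N y z ∂(P y)) ∂(X.trans t m x) ∂(X.law t)
      = Q * (X.expectPair t m N + X.expectPair (t + m) m N) := by
    have i1 : ∀ x, ∫⁻ y, Q * (N x y + ∫⁻ z, N y z ∂(P y)) ∂(X.trans t m x)
        = Q * (∫⁻ y, N x y ∂(X.trans t m x) + ∫⁻ y, ∫⁻ z, N y z ∂(P y) ∂(X.trans t m x)) := by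
      intro x
      rw [lintegral_const_mul _ ((hNr x).fun_add mν), lintegral_add_left (hNr x)]
    simp only [i1]
    rw [lintegral_const_mul _ (mB.fun_add mν.lintegral_kernel), lintegral_add_left mB, hlaw _ mν]
    rfl
  rwa [e1, e2] at h

/-- The telescoping argument: a four point inequality for `N` bounds the sum of the branching terms. -/
theorem tsum_expectBranch_le (hN : Measurable (Function.uncurry N))
    (hT : Measurable (Function.uncurry T)) (hQ0 : Q ≠ 0) (hQ : Q ≠ ∞)
    (h4 : ∀ x y z w, 2 * (N x z + N x w + κ * T z w) ≤ Q * (2 * N x y + (N y z + N y w))) :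
    κ / Q * ∑' k : ℕ, ∑' t : ℤ, X.expectBranch (t - 2 ^ k) (2 ^ k) T / Q ^ k
      ≤ 2 * ∑' t : ℤ, X.expectStep (t - 1) N := by
  set S : ℕ → ℝ≥0∞ := fun k => ∑' t : ℤ, X.expectPair t (2 ^ k) N
  set B : ℕ → ℝ≥0∞ := fun k => ∑' t : ℤ, X.expectBranch t (2 ^ k) T
  have hshift : ∀ (f : ℤ → ℝ≥0∞) (a : ℤ), ∑' t, f (t + a) = ∑' t, f t := fun f a =>
    (Equiv.addRight a).tsum_eq f
  have hS : ∀ k, 2 * S (k + 1) + κ * B k ≤ 2 * Q * S k := by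
    intro k
    have h : ∑' t : ℤ, (2 * X.expectPair t (2 ^ k + 2 ^ k) N
          + κ * X.expectBranch (t + (2 ^ k : ℕ)) (2 ^ k) T)
        ≤ ∑' t : ℤ, Q * (X.expectPair t (2 ^ k) N + X.expectPair (t + (2 ^ k : ℕ)) (2 ^ k) N) :=
      ENNReal.tsum_le_tsum fun t => two_mul_expectPair_add_le hN hT h4 t (2 ^ k)
    rw [ENNReal.tsum_add, ENNReal.tsum_mul_left, ENNReal.tsum_mul_left, ENNReal.tsum_mul_left,
      ENNReal.tsum_add, hshift (fun t => X.expectBranch t (2 ^ k) T),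
      hshift (fun t => X.expectPair t (2 ^ k) N), ← two_mul, ← two_mul, ← pow_succ'] at h
    calc _ ≤ _ := h
      _ = 2 * Q * S k := by ring
  have hB : ∀ k, ∑' t : ℤ, X.expectBranch (t - 2 ^ k) (2 ^ k) T / Q ^ k = B k / Q ^ k := by
    intro k
    simp only [div_eq_mul_inv]
    rw [ENNReal.tsum_mul_right]
    congr 1
    simpa [sub_eq_add_neg] using hshift (fun t => X.expectBranch t (2 ^ k) T) (-(2 ^ k))
  have hS0 : ∑' t : ℤ, X.expectStep (t - 1) N = S 0 := by
    simp only [← expectPair_one]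
    simpa [sub_eq_add_neg, S] using hshift (fun t => X.expectPair t 1 N) (-1)
  simp only [hB, hS0]
  -- Telescoping of `2 S n / Q ^ n`. This quantity stays on the left, so nothing infinite is ever
  -- subtracted.
  have hind : ∀ n, 2 * (S n / Q ^ n) + κ / Q * ∑ k ∈ Finset.range n, B k / Q ^ k ≤ 2 * S 0 := by
    intro n
    induction n with
    | zero => simp
    | succ n ih =>
      refine le_trans ?_ ih
      rw [Finset.sum_range_succ, mul_add, add_comm (κ / Q * _), ← add_assoc]
      gcongr
      have hQn : (Q ^ (n + 1))⁻¹ * Q = (Q ^ n)⁻¹ := by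
        rw [pow_succ, ENNReal.mul_inv (Or.inr hQ) (Or.inr hQ0), mul_assoc,
          ENNReal.inv_mul_cancel hQ0 hQ, mul_one]
      calc 2 * (S (n + 1) / Q ^ (n + 1)) + κ / Q * (B n / Q ^ n)
          = (2 * S (n + 1) + κ * B n) * (Q ^ (n + 1))⁻¹ := by
            rw [pow_succ, ENNReal.mul_inv (Or.inr hQ) (Or.inr hQ0)]
            simp only [div_eq_mul_inv]
            rw [ENNReal.mul_inv (Or.inr hQ) (Or.inr hQ0)]
            ring
        _ ≤ (2 * Q * S n) * (Q ^ (n + 1))⁻¹ := by gcongr; exact hS n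
        _ = 2 * S n * ((Q ^ (n + 1))⁻¹ * Q) := by ring
        _ = 2 * (S n / Q ^ n) := by rw [hQn, div_eq_mul_inv, mul_assoc]
  rw [← ENNReal.tsum_mul_left]
  refine ENNReal.tsum_le_of_sum_range_le fun n => ?_
  rw [← Finset.mul_sum]
  exact le_trans le_add_self (hind n)

end MarkovChain

theorem continuous_comp_prodMk {A B C X : Type*} [TopologicalSpace A] [TopologicalSpace B] [TopologicalSpace C]
   [TopologicalSpace X] {F : A → B → C} (hF : Continuous fun p : A × B => F p.1 p.2) {f : X → A} {g : X → B}
   (hf : Continuous f) (hg : Continuous g) : Continuous fun x => F (f x) (g x) := hF.comp (hf.prodMk hg)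

theorem Continuous.bch_comp {L : Type v} [LieRing L] [LieAlgebra ℝ L] [FiniteDimensional ℝ L]
    [TopologicalSpace L] [IsTopologicalAddGroup L] [ContinuousSMul ℝ L] [T2Space L] {X : Type*}
    [TopologicalSpace X] {f g : X → L} (hf : Continuous f) (s : ℕ) (hg : Continuous g) :
    Continuous fun x => bch s (f x) (g x) :=
  continuous_comp_prodMk (F := fun x y => bch s x y) (continuous_bch s) hf hg

/-! ### Dilations, the gauge and comparison of homogeneous norms -/

namespace LieGrading

variable {L : Type v} [LieRing L] [LieAlgebra ℝ L] [FiniteDimensional ℝ L] (G : LieGrading L)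

theorem exists_comp_eq_zero : ∃ n, ∀ j, n < j → G.comp j = 0 := by
  have hfin := WellFoundedGT.finite_ne_bot_of_iSupIndep G.isInternal.submodule_iSupIndep
  obtain ⟨n, hn⟩ := hfin.bddAbove
  refine ⟨n, fun j hj => ?_⟩
  have hbot : G.layer j = ⊥ := by
    by_contra h
    exact absurd (hn h) (not_le.2 hj)
  ext x
  have := G.comp_mem j x
  rw [hbot] at this
  simpa using this

/-- A bound for the indices of the nonzero layers. -/
noncomputable def height : ℕ := G.exists_comp_eq_zero.choose

theorem comp_eq_zero_of_height_lt {j : ℕ} (hj : G.height < j) (x : L) : G.comp j x = 0 := by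
  rw [height] at hj
  rw [G.exists_comp_eq_zero.choose_spec j hj, LinearMap.zero_apply]

omit [FiniteDimensional ℝ L] in
theorem comp_comp (i j : ℕ) (x : L) : G.comp i (G.comp j x) = if j = i then G.comp i x else 0 := by
  split_ifs with h
  · subst h
    exact G.comp_of_mem (G.comp_mem j x)
  · exact G.comp_of_mem_ne h (G.comp_mem j x)

theorem sum_comp (x : L) : ∑ j ∈ Finset.Icc 1 G.height, G.comp j x = x := by
  refine G.ext_comp fun i => ?_
  rw [map_sum]
  simp only [comp_comp, Finset.sum_ite_eq']
  split_ifs with h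
  · rfl
  · simp only [Finset.mem_Icc, not_and, not_le] at h
    rcases Nat.eq_zero_or_pos i with rfl | hi
    · rw [comp_zero]
    · rw [G.comp_eq_zero_of_height_lt (h hi)]

omit [FiniteDimensional ℝ L] in
theorem comp_dilation (c : ℝ) (j : ℕ) (x : L) : G.comp j (G.dilation c x) = c ^ j • G.comp j x :=
  G.comp_weight _ j x

omit [FiniteDimensional ℝ L] in
theorem dilation_dilation (c c' : ℝ) (x : L) : G.dilation c (G.dilation c' x) = G.dilation (c * c') x := by
  refine G.ext_comp fun j => ?_
  rw [comp_dilation, comp_dilation, comp_dilation, smul_smul, mul_pow]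

omit [FiniteDimensional ℝ L] in
theorem dilation_one (x : L) : G.dilation 1 x = x := by
  refine G.ext_comp fun j => ?_
  rw [comp_dilation, one_pow, one_smul]

omit [FiniteDimensional ℝ L] in
theorem dilation_inv_dilation {c : ℝ} (hc : c ≠ 0) (x : L) : G.dilation c (G.dilation c⁻¹ x) = x := by
  rw [dilation_dilation, mul_inv_cancel₀ hc, dilation_one]

variable [TopologicalSpace L] [IsTopologicalAddGroup L] [ContinuousSMul ℝ L] [T2Space L]

theorem continuous_comp (j : ℕ) : Continuous (G.comp j) :=
  LinearMap.continuous_of_finiteDimensional _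

theorem exists_euclNorm_comp_le : ∃ C, 0 ≤ C ∧ ∀ j x, euclNorm (G.comp j x) ≤ C * euclNorm x := by
  choose C hC h using fun j => exists_euclNorm_map_le (G.comp j)
  refine ⟨∑ j ∈ Finset.range (G.height + 1), C j, Finset.sum_nonneg fun j _ => hC j, fun j x => ?_⟩
  by_cases hj : j ≤ G.height
  · exact (h j x).trans (mul_le_mul_of_nonneg_right
      (Finset.single_le_sum (f := C) (fun j _ => hC j) (by simpa using by omega))
      (euclNorm_nonneg x))
  · rw [G.comp_eq_zero_of_height_lt (not_le.1 hj), euclNorm_zero]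
    exact mul_nonneg (Finset.sum_nonneg fun j _ => hC j) (euclNorm_nonneg x)

/-- The homogeneous norm `∑ |x_j|^{1/j}`. -/
noncomputable def gauge (x : L) : ℝ :=
  ∑ j ∈ Finset.Icc 1 G.height, euclNorm (G.comp j x) ^ ((j : ℝ)⁻¹)

theorem gauge_nonneg (x : L) : 0 ≤ G.gauge x :=
  Finset.sum_nonneg fun _ _ => Real.rpow_nonneg (euclNorm_nonneg _) _

theorem continuous_gauge : Continuous G.gauge := by
  refine continuous_finsetSum _ fun j _ => ?_
  exact (continuous_euclNorm.comp (G.continuous_comp j)).rpow_const fun _ => Or.inr (by positivity)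

theorem gauge_dilation {c : ℝ} (hc : 0 ≤ c) (x : L) : G.gauge (G.dilation c x) = c * G.gauge x := by
  rw [gauge, gauge, Finset.mul_sum]
  refine Finset.sum_congr rfl fun j hj => ?_
  have hj1 := (Finset.mem_Icc.1 hj).1
  rw [comp_dilation, euclNorm_smul, abs_of_nonneg (pow_nonneg hc j),
    Real.mul_rpow (pow_nonneg hc j) (euclNorm_nonneg _), Real.pow_rpow_inv_natCast hc (by omega)]

theorem euclNorm_comp_le_gauge_pow (j : ℕ) (x : L) : euclNorm (G.comp j x) ≤ G.gauge x ^ j := by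
  rcases Nat.eq_zero_or_pos j with rfl | hj
  · simp [comp_zero]
  by_cases hjh : j ≤ G.height
  · have h : euclNorm (G.comp j x) ^ ((j : ℝ)⁻¹) ≤ G.gauge x :=
      Finset.single_le_sum (f := fun j : ℕ => euclNorm (G.comp j x) ^ ((j : ℝ)⁻¹))
        (fun j _ => Real.rpow_nonneg (euclNorm_nonneg _) _) (Finset.mem_Icc.2 ⟨hj, hjh⟩)
    calc euclNorm (G.comp j x) = (euclNorm (G.comp j x) ^ ((j : ℝ)⁻¹)) ^ j :=
          (Real.rpow_inv_natCast_pow (euclNorm_nonneg _) (by omega)).symm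
      _ ≤ _ := pow_le_pow_left₀ (Real.rpow_nonneg (euclNorm_nonneg _) _) h j
  · rw [G.comp_eq_zero_of_height_lt (not_le.1 hjh), euclNorm_zero]
    exact pow_nonneg (G.gauge_nonneg x) j

theorem gauge_eq_zero {x : L} (hx : G.gauge x = 0) : x = 0 := by
  refine G.ext_comp fun j => ?_
  rw [map_zero]
  rcases Nat.eq_zero_or_pos j with rfl | hj
  · rw [comp_zero]
  · have := G.euclNorm_comp_le_gauge_pow j x
    rw [hx, zero_pow (by omega)] at this
    exact euclNorm_eq_zero.1 (le_antisymm this (euclNorm_nonneg _))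

theorem euclNorm_le_of_gauge_le_one {x : L} (hx : G.gauge x ≤ 1) : euclNorm x ≤ G.height := by
  rw [← G.sum_comp x]
  refine (euclNorm_sum_le _ _).trans ?_
  calc _ ≤ ∑ j ∈ Finset.Icc 1 G.height, (1 : ℝ) := Finset.sum_le_sum fun j _ =>
        (G.euclNorm_comp_le_gauge_pow j x).trans (pow_le_one₀ (G.gauge_nonneg x) hx)
    _ = _ := by simp

theorem isCompact_setOf_gauge_le_one : IsCompact {x : L | G.gauge x ≤ 1} :=
  (isCompact_setOf_euclNorm_le (G.height : ℝ)).of_isClosed_subset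
    (isClosed_le G.continuous_gauge continuous_const) fun _ hx => G.euclNorm_le_of_gauge_le_one hx

theorem gauge_inv_dilation {x : L} (hx : G.gauge x ≠ 0) :
    G.gauge (G.dilation (G.gauge x)⁻¹ x) = 1 := by
  rw [G.gauge_dilation (inv_nonneg.2 (G.gauge_nonneg x)), inv_mul_cancel₀ hx]

variable {G} in
-- By homogeneity it suffices to bound `φ` on the compact gauge ball; at the identity, dilation by
-- `0` forces `φ` to vanish.
theorem exists_le_gauge_pow {φ : L → ℝ} (hφ : Continuous φ) {m : ℕ} (hm : m ≠ 0)
    (hδ : ∀ (c : ℝ) x, 0 ≤ c → φ (G.dilation c x) = c ^ m * φ x) :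
    ∃ C, 0 < C ∧ ∀ x, φ x ≤ C * G.gauge x ^ m := by
  obtain ⟨C, hC⟩ := (G.isCompact_setOf_gauge_le_one.image hφ).bddAbove
  refine ⟨max C 1, by positivity, fun x => ?_⟩
  by_cases hx : G.gauge x = 0
  · have h0 := hδ 0 0 le_rfl
    rw [map_zero, zero_pow hm, zero_mul] at h0
    rw [G.gauge_eq_zero hx, h0]
    have := G.gauge_nonneg (0 : L)
    positivity
  · have h1 := hC ⟨_, (G.gauge_inv_dilation hx).le, rfl⟩
    have h2 := hδ (G.gauge x) (G.dilation (G.gauge x)⁻¹ x) (G.gauge_nonneg x)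
    rw [G.dilation_inv_dilation hx] at h2
    rw [h2, mul_comm]
    exact mul_le_mul_of_nonneg_right (h1.trans (le_max_left _ _)) (pow_nonneg (G.gauge_nonneg x) m)

variable {G} in
theorem exists_gauge_pow_le {φ : L → ℝ} (hφ : Continuous φ) {m : ℕ} (hm : m ≠ 0)
    (hδ : ∀ (c : ℝ) x, 0 ≤ c → φ (G.dilation c x) = c ^ m * φ x) (hpos : ∀ x, x ≠ 0 → 0 < φ x) :
    ∃ C, 0 < C ∧ ∀ x, G.gauge x ^ m ≤ C * φ x := by
  have hK : IsCompact {x : L | G.gauge x = 1} :=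
    G.isCompact_setOf_gauge_le_one.of_isClosed_subset
      (isClosed_eq G.continuous_gauge continuous_const) fun _ hx => le_of_eq hx
  have hne : ∀ x ∈ {x : L | G.gauge x = 1}, φ x ≠ 0 := by
    rintro x hx
    refine (hpos x ?_).ne'
    rintro rfl
    have h0 := G.gauge_dilation le_rfl (0 : L)
    rw [map_zero, zero_mul] at h0
    simp [h0] at hx
  obtain ⟨C, hC⟩ := (hK.image_of_continuousOn (hφ.continuousOn.inv₀ hne)).bddAbove
  refine ⟨max C 1, by positivity, fun x => ?_⟩
  by_cases hx : G.gauge x = 0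
  · have h0 := hδ 0 0 le_rfl
    rw [map_zero, zero_pow hm, zero_mul] at h0
    rw [hx, G.gauge_eq_zero hx, h0, zero_pow hm, mul_zero]
  · have h1 := hC ⟨_, G.gauge_inv_dilation hx, rfl⟩
    have h2 := hδ (G.gauge x) (G.dilation (G.gauge x)⁻¹ x) (G.gauge_nonneg x)
    rw [G.dilation_inv_dilation hx] at h2
    set u := G.dilation (G.gauge x)⁻¹ x
    have hu : 0 < φ u := by
      refine hpos u ?_
      intro h0
      have := G.gauge_inv_dilation hx
      rw [show G.dilation (G.gauge x)⁻¹ x = 0 from h0] at this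
      have h0 := G.gauge_dilation le_rfl (0 : L)
      rw [map_zero, zero_mul] at h0
      rw [h0] at this
      exact zero_ne_one this
    have h3 : 1 ≤ max C 1 * φ u := by
      have : (φ u)⁻¹ ≤ max C 1 := h1.trans (le_max_left _ _)
      calc 1 = (φ u)⁻¹ * φ u := (inv_mul_cancel₀ hu.ne').symm
        _ ≤ _ := mul_le_mul_of_nonneg_right this hu.le
    rw [h2]
    calc G.gauge x ^ m = G.gauge x ^ m * 1 := (mul_one _).symm
      _ ≤ G.gauge x ^ m * (max C 1 * φ u) := by
        have := G.gauge_nonneg x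
        gcongr
      _ = _ := by ring

namespace IsHomogeneousNorm

variable {G} {ρ : L → ℝ} (hρ : G.IsHomogeneousNorm ρ)

include hρ

omit [FiniteDimensional ℝ L] [IsTopologicalAddGroup L] [ContinuousSMul ℝ L] [T2Space L] in
theorem zero : ρ 0 = 0 := (hρ.eq_zero_iff 0).2 rfl

theorem exists_le_gauge : ∃ C, 0 < C ∧ ∀ x, ρ x ≤ C * G.gauge x := by
  simpa using exists_le_gauge_pow hρ.continuous one_ne_zero
    (fun c x hc => by rw [hρ.dilation c x hc, pow_one])

theorem exists_gauge_le : ∃ C, 0 < C ∧ ∀ x, G.gauge x ≤ C * ρ x := by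
  simpa using exists_gauge_pow_le hρ.continuous one_ne_zero
    (fun c x hc => by rw [hρ.dilation c x hc, pow_one])
    (fun x hx => lt_of_le_of_ne (hρ.nonneg x) fun h => hx ((hρ.eq_zero_iff x).1 h.symm))

/-- The quasi-triangle inequality: rescale by the sum of the gauges and use compactness. It replaces
the triangle inequality, which is not assumed. -/
theorem exists_bch_le (s : ℕ) (hzero : bch s (0 : L) 0 = 0) :
    ∃ C, 0 < C ∧ ∀ x y, ρ (bch s x y) ≤ C * (ρ x + ρ y) := by
  obtain ⟨C₁, hC₁, h₁⟩ := hρ.exists_gauge_le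
  have hK : IsCompact ({x : L | G.gauge x ≤ 1} ×ˢ {x : L | G.gauge x ≤ 1}) :=
    G.isCompact_setOf_gauge_le_one.prod G.isCompact_setOf_gauge_le_one
  obtain ⟨C₂, h₂⟩ := (hK.image (hρ.continuous.comp (continuous_bch s))).bddAbove
  refine ⟨max C₂ 1 * C₁, by positivity, fun x y => ?_⟩
  set r := G.gauge x + G.gauge y with hr
  have hx := G.gauge_nonneg x
  have hy := G.gauge_nonneg y
  have hmain : ρ (bch s x y) ≤ max C₂ 1 * r := by
    by_cases h0 : r = 0
    · have hx0 : x = 0 := G.gauge_eq_zero (by linarith)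
      have hy0 : y = 0 := G.gauge_eq_zero (by linarith)
      rw [h0, hx0, hy0, hzero, hρ.zero, mul_zero]
    · have hr0 : 0 < r := lt_of_le_of_ne (by positivity) (Ne.symm h0)
      have hb : ∀ z, G.gauge z ≤ r → G.gauge (G.dilation r⁻¹ z) ≤ 1 := by
        intro z hz
        rw [G.gauge_dilation (by positivity), inv_mul_le_iff₀ hr0, mul_one]
        exact hz
      have h3 := h₂ ⟨(G.dilation r⁻¹ x, G.dilation r⁻¹ y),
        ⟨hb x (by linarith), hb y (by linarith)⟩, rfl⟩
      have h4 := hρ.dilation r (bch s (G.dilation r⁻¹ x) (G.dilation r⁻¹ y)) hr0.le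
      rw [G.dilation_bch, G.dilation_inv_dilation h0, G.dilation_inv_dilation h0] at h4
      rw [h4, mul_comm]
      exact mul_le_mul_of_nonneg_right (h3.trans (le_max_left _ _)) hr0.le
  calc ρ (bch s x y) ≤ max C₂ 1 * r := hmain
    _ ≤ max C₂ 1 * (C₁ * ρ x + C₁ * ρ y) := by
      have := h₁ x
      have := h₁ y
      gcongr
      linarith
    _ = _ := by ring

/-- Away from `V`, `ρ` has a positive minimum on the compact gauge ball; outside that ball `ρ` is
bounded below by comparison with the gauge. -/
theorem exists_lt_mem_nhds {V : Set L} (hV : V ∈ nhds (0 : L)) : ∃ r, 0 < r ∧ ∀ u, ρ u < r → u ∈ V := by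
  obtain ⟨C₁, hC₁, h₁⟩ := hρ.exists_gauge_le
  have hK : IsCompact ({x : L | G.gauge x ≤ 1} \ interior V) :=
    G.isCompact_setOf_gauge_le_one.diff isOpen_interior
  have h0 : (0 : L) ∈ interior V := mem_interior_iff_mem_nhds.2 hV
  obtain ⟨C, hC⟩ : ∃ c, 0 < c ∧ ∀ x ∈ {x : L | G.gauge x ≤ 1} \ interior V, c ≤ ρ x := by
    rcases ({x : L | G.gauge x ≤ 1} \ interior V).eq_empty_or_nonempty with he | hne
    · exact ⟨1, one_pos, by simp [he]⟩
    · obtain ⟨x₀, hx₀, hmin⟩ := hK.exists_isMinOn hne hρ.continuous.continuousOn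
      refine ⟨ρ x₀, lt_of_le_of_ne (hρ.nonneg _) fun h => ?_, fun x hx => hmin hx⟩
      have := (hρ.eq_zero_iff x₀).1 h.symm
      exact hx₀.2 (this ▸ h0)
  refine ⟨min C C₁⁻¹, lt_min hC.1 (by positivity), fun u hu => ?_⟩
  by_contra huV
  have hg : G.gauge u ≤ 1 := by
    calc G.gauge u ≤ C₁ * ρ u := h₁ u
      _ ≤ C₁ * C₁⁻¹ := by
        gcongr
        exact (hu.trans_le (min_le_right _ _)).le
      _ = 1 := mul_inv_cancel₀ hC₁.ne'
  exact absurd (hC.2 u ⟨hg, fun h => huV (interior_subset h)⟩)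
    (not_le.2 (hu.trans_le (min_le_left _ _)))

end IsHomogeneousNorm

/-! ### Measurability, and Markov convexity from a four point inequality -/

variable {G} {s : ℕ} (hs : LieModule.lowerCentralSeries ℝ L L s = ⊥) {ρ : L → ℝ}
  (hρ : G.IsHomogeneousNorm ρ)

theorem continuous_leftInvDist (hρ : G.IsHomogeneousNorm ρ) : Continuous fun p : L × L => leftInvDist s ρ p.1 p.2 :=
  hρ.continuous.comp (continuous_fst.neg.bch_comp s continuous_snd)

include hs hρ

/-- Preimages of quasi-balls centred in the image of `f` are sections of measurable sets. The part
of the image in an open `U` is covered by such balls inside `U`, and countably many suffice by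
second countability. -/
theorem borel_measurable_of_measurable_leftInvDist {Ω : Type u} [MeasurableSpace Ω] {f : Ω → L}
    (hf : Measurable fun a : Ω × Ω => leftInvDist s ρ (f a.1) (f a.2)) :
    Measurable[_, borel L] f := by
  have hball : ∀ b r, MeasurableSet {a | leftInvDist s ρ (f b) (f a) < r} := fun b r =>
    (hf.comp (measurable_const.prodMk measurable_id)) measurableSet_Iio
  let _ : SecondCountableTopology L := (toEuclidean (E := L)).toHomeomorph.secondCountableTopology
  refine measurable_generateFrom (fun U hU => ?_)
  have hU : IsOpen U := hU
  have hr : ∀ b : Ω, f b ∈ U → ∃ r, 0 < r ∧ ∀ y, leftInvDist s ρ (f b) y < r → y ∈ U := by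
    intro b hb
    have hc : Continuous fun u => bch s (f b) u := continuous_const.bch_comp s continuous_id
    have hV : {u | bch s (f b) u ∈ U} ∈ nhds (0 : L) :=
      (hU.preimage hc).mem_nhds (by rwa [Set.mem_preimage, G.bch_zero hs])
    obtain ⟨r, hr, h⟩ := hρ.exists_lt_mem_nhds hV
    refine ⟨r, hr, fun y hy => ?_⟩
    have := h _ hy
    rwa [Set.mem_ofPred_eq, ← G.bch_assoc hs, G.bch_neg_self hs, G.zero_bch hs] at this
  choose! r hr0 hrU using hr
  let B : {b // f b ∈ U} → Set L := fun b => {y | leftInvDist s ρ (f b) y < r b}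
  have hB : ∀ b, IsOpen (B b) := fun b =>
    isOpen_lt (continuous_comp_prodMk (continuous_leftInvDist hρ) continuous_const continuous_id)
      continuous_const
  obtain ⟨T, hT, hTU⟩ := TopologicalSpace.isOpen_iUnion_countable B hB
  have : f ⁻¹' U = ⋃ b ∈ T, {a | leftInvDist s ρ (f b) (f a) < r b} := by
    ext a
    simp only [Set.mem_preimage, Set.mem_iUnion]
    constructor
    · intro ha
      have : f a ∈ ⋃ b, B b := by
        refine Set.mem_iUnion.2 ⟨⟨a, ha⟩, ?_⟩
        change ρ (bch s (-f a) (f a)) < r a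
        rw [G.neg_bch_self hs, hρ.zero]
        exact hr0 a ha
      rw [← hTU] at this
      simpa [B] using this
    · rintro ⟨b, hb, h⟩
      exact hrU b b.2 _ h
  rw [this]
  exact MeasurableSet.biUnion hT fun b _ => hball b _

/-- A four point inequality implies Markov convexity. -/
theorem isMarkovConvex_of_four_point {q : ℝ} (hq : 0 < q) {N : L → ℝ} (hN : Continuous N)
    (hN0 : ∀ x, 0 ≤ N x) {C κ : ℝ} (hC : 0 ≤ C) (hNC : ∀ x, N x ≤ C * ρ x ^ q) (hκ : 0 < κ)
    (h4 : ∀ x y z w : L, 2 * (N (bch s (-x) z) + N (bch s (-x) w) + κ * leftInvDist s ρ z w ^ q)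
      ≤ 2 ^ q * (2 * N (bch s (-x) y) + (N (bch s (-y) z) + N (bch s (-y) w)))) :
    IsMarkovConvex.{u} (leftInvDist s ρ) q := by
  have h2q : (0 : ℝ) < 2 ^ q := by positivity
  -- `2 C` comes from comparing the telescoped bound with `ρ ^ q`, and `2 ^ q / κ` from dividing out
  -- the factor of the branching sum. The convexity constant is `A ^ (1 / q)`.
  set A : ℝ := 2 * 2 ^ q * C / κ
  have hA : 0 ≤ A := by positivity
  refine ⟨Real.toNNReal (A ^ q⁻¹), fun Ω _ X f hf => ?_⟩
  let _ : MeasurableSpace L := borel L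
  have _ : BorelSpace L := ⟨rfl⟩
  let _ : SecondCountableTopology L := (toEuclidean (E := L)).toHomeomorph.secondCountableTopology
  have hfm : Measurable f := borel_measurable_of_measurable_leftInvDist hs hρ hf
  have hd0 : ∀ x y, 0 ≤ leftInvDist s ρ x y := fun x y => hρ.nonneg _
  have mN : Measurable (Function.uncurry fun a b : Ω => ENNReal.ofReal (N (bch s (-f a) (f b)))) := by
    have h1 : Measurable fun p : L × L => N (bch s (-p.1) p.2) :=
      (hN.comp ((continuous_bch s).comp (continuous_fst.neg.prodMk continuous_snd))).measurable
    exact (h1.comp ((hfm.comp measurable_fst).prodMk (hfm.comp measurable_snd))).ennreal_ofReal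
  have mT : Measurable (Function.uncurry fun a b : Ω =>
      ENNReal.ofReal (leftInvDist s ρ (f a) (f b) ^ q)) := (hf.pow_const q).ennreal_ofReal
  have key := MarkovChain.tsum_expectBranch_le (X := X) (κ := ENNReal.ofReal κ) (Q := ENNReal.ofReal (2 ^ q))
    mN mT (by simpa using h2q) ENNReal.ofReal_ne_top (by
      intro x y z w
      have e2 : (2 : ℝ≥0∞) = ENNReal.ofReal 2 := by simp
      have hdp := Real.rpow_nonneg (hd0 (f z) (f w)) q
      rw [e2, ← ENNReal.ofReal_mul hκ.le, ← ENNReal.ofReal_add (hN0 _) (hN0 _),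
        ← ENNReal.ofReal_add (add_nonneg (hN0 _) (hN0 _)) (mul_nonneg hκ.le hdp),
        ← ENNReal.ofReal_mul (by norm_num), ← ENNReal.ofReal_mul (by norm_num),
        ← ENNReal.ofReal_add (hN0 _) (hN0 _),
        ← ENNReal.ofReal_add (mul_nonneg (by norm_num) (hN0 _)) (add_nonneg (hN0 _) (hN0 _)),
        ← ENNReal.ofReal_mul h2q.le]
      exact ENNReal.ofReal_le_ofReal (h4 _ _ _ _))
  have hQk : ∀ k : ℕ, ENNReal.ofReal (2 ^ q) ^ k = (2 : ℝ≥0∞) ^ ((k : ℝ) * q) := by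
    intro k
    rw [← ENNReal.ofReal_rpow_of_pos two_pos, ENNReal.ofReal_ofNat, ← ENNReal.rpow_natCast,
      ← ENNReal.rpow_mul, mul_comm]
  simp only [hQk] at key
  set S := ∑' k : ℕ, ∑' t : ℤ, X.expectBranch (t - 2 ^ k) (2 ^ k)
    (fun a b => ENNReal.ofReal (leftInvDist s ρ (f a) (f b) ^ q)) / (2 : ℝ≥0∞) ^ ((k : ℝ) * q)
  have hstep : ∑' t : ℤ, X.expectStep (t - 1) (fun a b => ENNReal.ofReal (N (bch s (-f a) (f b))))
      ≤ ENNReal.ofReal C * ∑' t : ℤ, X.expectStep (t - 1)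
        (fun a b => ENNReal.ofReal (leftInvDist s ρ (f a) (f b) ^ q)) := by
    rw [← ENNReal.tsum_mul_left]
    refine ENNReal.tsum_le_tsum fun t => ?_
    have := X.isMarkovKernel_step
    have hTr : ∀ x, Measurable fun b => ENNReal.ofReal (leftInvDist s ρ (f x) (f b) ^ q) :=
      fun x => mT.of_uncurry_left
    rw [MarkovChain.expectStep, MarkovChain.expectStep, ← lintegral_const_mul _
      (Measurable.lintegral_kernel_prod_right (κ := X.step (t - 1)) mT)]
    refine lintegral_mono fun x => ?_
    rw [← lintegral_const_mul _ (hTr x)]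
    refine lintegral_mono fun y => ?_
    rw [← ENNReal.ofReal_mul hC]
    exact ENNReal.ofReal_le_ofReal (hNC _)
  set S₀ := ∑' t : ℤ, X.expectStep (t - 1)
        (fun a b => ENNReal.ofReal (leftInvDist s ρ (f a) (f b) ^ q))
  have hCq : ((Real.toNNReal (A ^ q⁻¹) : ℝ≥0) : ℝ≥0∞) ^ q = ENNReal.ofReal A := by
    change ENNReal.ofReal (A ^ q⁻¹) ^ q = _
    rw [ENNReal.ofReal_rpow_of_nonneg (by positivity) hq.le, Real.rpow_inv_rpow hA hq.ne']
  rw [hCq]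
  have hκQ : ENNReal.ofReal (2 ^ q) / ENNReal.ofReal κ * (ENNReal.ofReal κ / ENNReal.ofReal (2 ^ q)) = 1 := by
    rw [← ENNReal.ofReal_div_of_pos hκ, ← ENNReal.ofReal_div_of_pos h2q,
      ← ENNReal.ofReal_mul (by positivity)]
    rw [show (2 : ℝ) ^ q / κ * (κ / 2 ^ q) = 1 by field_simp]
    simp
  calc S = ENNReal.ofReal (2 ^ q) / ENNReal.ofReal κ *
        (ENNReal.ofReal κ / ENNReal.ofReal (2 ^ q) * S) := by rw [← mul_assoc, hκQ, one_mul]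
    _ ≤ ENNReal.ofReal (2 ^ q) / ENNReal.ofReal κ * (2 * (ENNReal.ofReal C * S₀)) := by
      exact mul_le_mul' le_rfl (key.trans (mul_le_mul' le_rfl hstep))
    _ = ENNReal.ofReal A * S₀ := by
      rw [show A = (2 ^ q / κ) * (2 * C) by simp only [A]; ring, ENNReal.ofReal_mul (by positivity),
        ENNReal.ofReal_div_of_pos hκ, ENNReal.ofReal_mul (by norm_num)]
      simp only [ENNReal.ofReal_ofNat]
      ring

end LieGrading

/-! ### From the midpoint inequality to the four point inequality -/

theorem Real.add_rpow_le_two_rpow_mul {x y p : ℝ} (hx : 0 ≤ x) (hy : 0 ≤ y) (hp : 0 ≤ p) :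
    (x + y) ^ p ≤ 2 ^ p * (x ^ p + y ^ p) := by
  have hx' := Real.rpow_nonneg hx p
  have hy' := Real.rpow_nonneg hy p
  have h2 : (0 : ℝ) ≤ 2 ^ p := by positivity
  rcases le_total x y with h | h
  · calc (x + y) ^ p ≤ (2 * y) ^ p := by gcongr; linarith
      _ = 2 ^ p * y ^ p := Real.mul_rpow (by norm_num) hy
      _ ≤ _ := by gcongr; linarith
  · calc (x + y) ^ p ≤ (2 * x) ^ p := by gcongr; linarith
      _ = 2 ^ p * x ^ p := Real.mul_rpow (by norm_num) hx
      _ ≤ _ := by gcongr; linarith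

/-- Raising to a power keeps a deficit `e (A + e) ^ k`, not merely `e ^ (k + 1)`. The stronger form
is needed because `|a₁ - b₁|` enters only to the power `p`, multiplied by a power of the scale. -/
theorem pow_succ_add_le_add_pow_succ {A e κ : ℝ} (hA : 0 ≤ A) (he : 0 ≤ e) (hκ : 0 ≤ κ) (hκ1 : κ ≤ 1)
    (k : ℕ) : A ^ (k + 1) + κ ^ (k + 1) * (e * (A + e) ^ k) ≤ (A + κ * e) ^ (k + 1) := by
  have h1 : A ^ k ≤ (A + κ * e) ^ k := by
    gcongr
    nlinarith [mul_nonneg hκ he]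
  have h2 : (κ * (A + e)) ^ k ≤ (A + κ * e) ^ k := by
    gcongr
    nlinarith
  calc A ^ (k + 1) + κ ^ (k + 1) * (e * (A + e) ^ k)
      = A * A ^ k + κ * e * (κ * (A + e)) ^ k := by rw [mul_pow]; ring
    _ ≤ A * (A + κ * e) ^ k + κ * e * (A + κ * e) ^ k := by gcongr
    _ = _ := by ring

theorem half_add_pow_le {x y : ℝ} (hx : 0 ≤ x) (hy : 0 ≤ y) (k : ℕ) :
    ((x + y) / 2) ^ (k + 1) ≤ (x ^ (k + 1) + y ^ (k + 1)) / 2 := by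
  have := add_pow_le hx hy (k + 1)
  rw [Nat.add_sub_cancel] at this
  rw [div_pow, div_le_div_iff₀ (by positivity) (by norm_num)]
  calc (x + y) ^ (k + 1) * 2 ≤ 2 ^ k * (x ^ (k + 1) + y ^ (k + 1)) * 2 := by gcongr
    _ = _ := by ring

namespace LieGrading

variable {L : Type v} [LieRing L] [LieAlgebra ℝ L] [FiniteDimensional ℝ L] {G : LieGrading L}
  [TopologicalSpace L] [IsTopologicalAddGroup L] [ContinuousSMul ℝ L] [T2Space L]
  {s : ℕ} (hs : LieModule.lowerCentralSeries ℝ L L s = ⊥) {ρ : L → ℝ} (hρ : G.IsHomogeneousNorm ρ)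

omit [FiniteDimensional ℝ L] [TopologicalSpace L] [IsTopologicalAddGroup L] [ContinuousSMul ℝ L]
  [T2Space L] in
theorem nonhoriz_eq (x : L) : G.nonhoriz s ρ x = ρ (bch s (-G.comp 1 x) x) := by
  rw [nonhoriz, leftInvDist, horiz_eq]

omit [FiniteDimensional ℝ L] [IsTopologicalAddGroup L] [ContinuousSMul ℝ L] [T2Space L] in
theorem nonhoriz_nonneg (hρ : G.IsHomogeneousNorm ρ) (x : L) : 0 ≤ G.nonhoriz s ρ x := hρ.nonneg _

include hs hρ

/-- The product `a⁻¹ b` vanishes for `a = b`, so all its components are `O(|a - b|)`. The gauge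
takes `j`-th roots, with `j ≤ s` as both factors are horizontal, and `1/j ≥ 1/s!`. -/
theorem exists_horizontal_le_of_euclNorm_le_one : ∃ C, 0 ≤ C ∧ ∀ a ∈ G.layer 1, ∀ b ∈ G.layer 1,
    euclNorm a ≤ 1 → euclNorm b ≤ 1 → euclNorm (a - b) ≤ 1 →
      ρ (bch s (-a) b) ≤ C * euclNorm (a - b) ^ ((s.factorial : ℝ)⁻¹) := by
  obtain ⟨C₀, hC₀, h₀⟩ := exists_euclNorm_bch_sub_le (L := L) s 1
  obtain ⟨C₁, hC₁, h₁⟩ := G.exists_euclNorm_comp_le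
  obtain ⟨C₂, hC₂, h₂⟩ := hρ.exists_le_gauge
  refine ⟨C₂ * ∑ j ∈ Finset.Icc 1 G.height, (C₁ * C₀) ^ ((j : ℝ)⁻¹), by positivity,
    fun a ha b hb ha1 hb1 hab => (h₂ _).trans ?_⟩
  set Δ := euclNorm (a - b)
  have hΔ : 0 ≤ Δ := euclNorm_nonneg _
  rw [mul_assoc, gauge, Finset.sum_mul]
  refine mul_le_mul_of_nonneg_left (Finset.sum_le_sum fun j hj => ?_) hC₂.le
  have hj1 := (Finset.mem_Icc.1 hj).1
  by_cases hjs : s < j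
  · rw [G.comp_bch_of_mem_layer_one hjs (neg_mem ha) hb, euclNorm_zero, Real.zero_rpow (by positivity)]
    positivity
  · have h3 : euclNorm (bch s (-a) b) ≤ C₀ * Δ := by
      have := h₀ (-a) b (-a) a Δ (by rwa [euclNorm_neg]) hb1 (by rwa [euclNorm_neg]) ha1
        (by rwa [sub_self, euclNorm_zero]) (euclNorm_sub_rev _ _).le
      rwa [G.neg_bch_self hs, sub_zero] at this
    have h4 : euclNorm (G.comp j (bch s (-a) b)) ≤ C₁ * C₀ * Δ := by
      rw [mul_assoc]
      exact (h₁ _ _).trans (mul_le_mul_of_nonneg_left h3 hC₁)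
    have h5 : (s.factorial : ℝ)⁻¹ ≤ (j : ℝ)⁻¹ := by
      have : (j : ℝ) ≤ s.factorial := by
        exact_mod_cast (Nat.self_le_factorial j).trans (Nat.factorial_le (not_lt.1 hjs))
      have : (0 : ℝ) < j := by exact_mod_cast hj1
      gcongr
    calc euclNorm (G.comp j (bch s (-a) b)) ^ ((j : ℝ)⁻¹) ≤ (C₁ * C₀ * Δ) ^ ((j : ℝ)⁻¹) :=
          Real.rpow_le_rpow (euclNorm_nonneg _) h4 (by positivity)
      _ = (C₁ * C₀) ^ ((j : ℝ)⁻¹) * Δ ^ ((j : ℝ)⁻¹) := Real.mul_rpow (by positivity) hΔ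
      _ ≤ _ := mul_le_mul_of_nonneg_left
          (Real.rpow_le_rpow_of_exponent_ge_of_imp hΔ hab h5 fun _ h => by
            have : j = 0 := by simpa using h
            omega) (by positivity)

/-- Rescale by `R = |a| + |b|` to enter the unit ball; dilation is scalar multiplication on the
first layer. The power `p s! = p + p k` of the Hölder bound then reads `R^(p + p k) (|a - b| /
R)^p`. -/
theorem exists_horizontal_rpow_le {p : ℝ} (hp : 0 < p) {k : ℕ} (hk : s.factorial = k + 1) :
    ∃ C, 0 ≤ C ∧ ∀ a ∈ G.layer 1, ∀ b ∈ G.layer 1, ρ (bch s (-a) b) ^ (p * (s.factorial : ℝ))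
      ≤ C * (euclNorm (a - b) ^ p * ((euclNorm a + euclNorm b) ^ p) ^ k) := by
  obtain ⟨C, hC, h⟩ := exists_horizontal_le_of_euclNorm_le_one hs hρ
  have hsf : (0 : ℝ) < s.factorial := by exact_mod_cast s.factorial_pos
  refine ⟨C ^ (p * (s.factorial : ℝ)), by positivity, fun a ha b hb => ?_⟩
  set R := euclNorm a + euclNorm b with hR
  have ha0 := euclNorm_nonneg a
  have hb0 := euclNorm_nonneg b
  have hR0 : 0 ≤ R := by positivity
  have hd0 := euclNorm_nonneg (a - b)
  by_cases hRz : R = 0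
  · have h1 : a = 0 := euclNorm_eq_zero.1 (by linarith)
    have h2 : b = 0 := euclNorm_eq_zero.1 (by linarith)
    rw [h1, h2, neg_zero, G.bch_zero hs, hρ.zero, Real.zero_rpow (by positivity)]
    rw [h1, h2] at hd0
    positivity
  · have hRpos : 0 < R := lt_of_le_of_ne hR0 (Ne.symm hRz)
    have hlay : ∀ c : ℝ, ∀ x ∈ G.layer 1, G.dilation c x = c • x := by
      intro c x hx
      refine G.ext_comp fun j => ?_
      rw [comp_dilation, map_smul]
      by_cases hj : 1 = j
      · rw [← hj, pow_one]
      · rw [G.comp_of_mem_ne hj hx, smul_zero, smul_zero]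
    have hsc : ∀ x : L, euclNorm (R⁻¹ • x) = euclNorm x / R := by
      intro x
      rw [euclNorm_smul, abs_of_pos (inv_pos.2 hRpos)]
      field_simp
    have hdiff : euclNorm (R⁻¹ • a - R⁻¹ • b) = euclNorm (a - b) / R := by rw [← smul_sub, hsc]
    have h1 := h (R⁻¹ • a) (Submodule.smul_mem _ _ ha) (R⁻¹ • b) (Submodule.smul_mem _ _ hb)
      (by rw [hsc, div_le_one hRpos]; linarith) (by rw [hsc, div_le_one hRpos]; linarith)
      (by rw [hdiff, div_le_one hRpos]; exact euclNorm_sub_le a b)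
    have h2 : ρ (bch s (-a) b) = R * ρ (bch s (-(R⁻¹ • a)) (R⁻¹ • b)) := by
      rw [← hρ.dilation _ _ hR0, G.dilation_bch, map_neg, hlay _ _ (Submodule.smul_mem _ _ ha),
        hlay _ _ (Submodule.smul_mem _ _ hb), smul_inv_smul₀ hRz, smul_inv_smul₀ hRz]
    rw [hdiff] at h1
    have hq : (p * (s.factorial : ℝ)) = p + p * k := by rw [hk]; push_cast; ring
    calc ρ (bch s (-a) b) ^ (p * (s.factorial : ℝ))
        ≤ (R * (C * (euclNorm (a - b) / R) ^ ((s.factorial : ℝ)⁻¹))) ^ (p * (s.factorial : ℝ)) := by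
          rw [h2]
          have := hρ.nonneg (bch s (-(R⁻¹ • a)) (R⁻¹ • b))
          gcongr
      _ = R ^ (p * (s.factorial : ℝ)) * (C ^ (p * (s.factorial : ℝ))
            * (euclNorm (a - b) / R) ^ p) := by
          rw [Real.mul_rpow hR0 (by positivity), Real.mul_rpow hC (by positivity),
            ← Real.rpow_mul (by positivity), show (s.factorial : ℝ)⁻¹ * (p * s.factorial) = p by
              field_simp]
      _ = _ := by
          rw [hq, Real.rpow_add hRpos, Real.div_rpow hd0 hR0, Real.rpow_mul hR0, Real.rpow_natCast]
          have : 0 < R ^ p := by positivity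
          field_simp

/-- Travel from `a` to `b` through `a₁` and `b₁` and use the quasi-triangle inequality twice. -/
theorem exists_rho_rpow_le {p : ℝ} (hp : 0 < p) {k : ℕ} (hk : s.factorial = k + 1) :
    ∃ C, 0 ≤ C ∧ ∀ a b : L, ρ (bch s (-a) b) ^ (p * (s.factorial : ℝ))
      ≤ C * ((G.nonhoriz s ρ a ^ p) ^ (k + 1) + (G.nonhoriz s ρ b ^ p) ^ (k + 1)
        + euclNorm (G.comp 1 a - G.comp 1 b) ^ p
          * ((euclNorm (G.comp 1 a) + euclNorm (G.comp 1 b)) ^ p) ^ k) := by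
  obtain ⟨C₀, hC₀, h₀⟩ := hρ.exists_bch_le s (G.bch_zero hs 0)
  obtain ⟨C₁, hC₁, h₁⟩ := exists_horizontal_rpow_le hs hρ hp hk
  have hsf : (0 : ℝ) < s.factorial := by exact_mod_cast s.factorial_pos
  set q := p * (s.factorial : ℝ) with hq
  have hq0 : 0 < q := by positivity
  refine ⟨C₀ ^ q * (2 ^ q * (1 + C₀ ^ q * 2 ^ q * (C₁ + 1))), by positivity, fun a b => ?_⟩
  have hpow : ∀ x : ℝ, 0 ≤ x → (x ^ p) ^ (k + 1) = x ^ q := by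
    intro x hx
    rw [← Real.rpow_natCast, ← Real.rpow_mul hx, hq, hk]
  rw [hpow _ (nonhoriz_nonneg hρ a), hpow _ (nonhoriz_nonneg hρ b)]
  have hA := Real.rpow_nonneg (nonhoriz_nonneg (s := s) hρ a) q
  have hB := Real.rpow_nonneg (nonhoriz_nonneg (s := s) hρ b) q
  have hH := h₁ _ (G.comp_mem 1 a) _ (G.comp_mem 1 b)
  set H := ρ (bch s (-G.comp 1 a) (G.comp 1 b)) with hHdef
  have hH0 : 0 ≤ H := hρ.nonneg _
  set D := euclNorm (G.comp 1 a - G.comp 1 b) ^ p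
          * ((euclNorm (G.comp 1 a) + euclNorm (G.comp 1 b)) ^ p) ^ k
  have hD : 0 ≤ D := by
    have := euclNorm_nonneg (G.comp 1 a - G.comp 1 b)
    have := euclNorm_nonneg (G.comp 1 a)
    have := euclNorm_nonneg (G.comp 1 b)
    positivity
  have e1 : ρ (bch s (-a) (G.comp 1 a)) = G.nonhoriz s ρ a := by
    rw [nonhoriz_eq, ← hρ.inv, G.neg_bch hs, neg_neg]
  have e2 : ρ (bch s (-a) b) ≤ C₀ * (G.nonhoriz s ρ a + C₀ * (H + G.nonhoriz s ρ b)) := by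
    rw [G.bch_neg_trans hs a (G.comp 1 a) b]
    refine (h₀ _ _).trans ?_
    rw [e1]
    have : ρ (bch s (-G.comp 1 a) b) ≤ C₀ * (H + G.nonhoriz s ρ b) := by
      rw [G.bch_neg_trans hs _ (G.comp 1 b) b, nonhoriz_eq]
      exact h₀ _ _
    gcongr
  set na := G.nonhoriz s ρ a
  set nb := G.nonhoriz s ρ b
  have hna : 0 ≤ na := nonhoriz_nonneg hρ a
  have hnb : 0 ≤ nb := nonhoriz_nonneg hρ b
  calc ρ (bch s (-a) b) ^ q ≤ (C₀ * (na + C₀ * (H + nb))) ^ q :=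
        Real.rpow_le_rpow (hρ.nonneg _) e2 hq0.le
    _ = C₀ ^ q * (na + C₀ * (H + nb)) ^ q := Real.mul_rpow hC₀.le (by positivity)
    _ ≤ C₀ ^ q * (2 ^ q * (na ^ q + C₀ ^ q * (2 ^ q * (C₁ * D + nb ^ q)))) := by
        have h3 := Real.add_rpow_le_two_rpow_mul hna (by positivity : 0 ≤ C₀ * (H + nb)) hq0.le
        have h4 := Real.add_rpow_le_two_rpow_mul hH0 hnb hq0.le
        rw [Real.mul_rpow hC₀.le (by positivity)] at h3
        refine mul_le_mul_of_nonneg_left (h3.trans ?_) (by positivity)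
        refine mul_le_mul_of_nonneg_left ?_ (by positivity)
        gcongr
        exact h4.trans (by gcongr)
    _ ≤ _ := by
        rw [mul_assoc (C₀ ^ q)]
        refine mul_le_mul_of_nonneg_left ?_ (by positivity)
        rw [mul_assoc]
        refine mul_le_mul_of_nonneg_left ?_ (by positivity)
        have hP : 0 ≤ C₀ ^ q * 2 ^ q := by positivity
        have := mul_nonneg hP hA
        have := mul_nonneg hP hB
        have := mul_nonneg hP hD
        have := mul_nonneg this hC₁
        have := mul_nonneg (mul_nonneg hP hA) hC₁
        have := mul_nonneg (mul_nonneg hP hB) hC₁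
        nlinarith

/-- A convexity inequality along midpoints with exponent `p`, for a function comparable to the `p`-th
power of a homogeneous norm, implies Markov `p * s!`-convexity. -/
theorem isMarkovConvex_of_midpoint {p : ℝ} (hp : 0 < p) {N : L → ℝ} (hN : Continuous N)
    (hN0 : ∀ x, 0 ≤ N x) {C₁ C₂ κ : ℝ} (hC₁ : 0 ≤ C₁) (hC₂ : 0 ≤ C₂) (hN₁ : ∀ x, N x ≤ C₁ * ρ x ^ p)
    (hN₂ : ∀ x, ρ x ^ p ≤ C₂ * N x) (hκ : 0 < κ)
    (hmid : ∀ u v : L, N (bch s u v) / 2 ^ p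
      + κ * (euclNorm (G.comp 1 u - G.comp 1 v) ^ p + G.nonhoriz s ρ (bch s u v) ^ p)
        ≤ (N u + N v) / 2) :
    IsMarkovConvex.{u} (leftInvDist s ρ) (p * (s.factorial : ℝ)) := by
  obtain ⟨k, hk⟩ : ∃ k, s.factorial = k + 1 := ⟨s.factorial - 1, by have := s.factorial_pos; omega⟩
  obtain ⟨C₃, hC₃, h₃⟩ := exists_rho_rpow_le hs hρ hp hk
  obtain ⟨C₄, hC₄, h₄⟩ := hρ.exists_gauge_le
  have hsf : (0 : ℝ) < s.factorial := by exact_mod_cast s.factorial_pos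
  have h2p : (0 : ℝ) < 2 ^ p := by positivity
  have hpow : ∀ x : ℝ, 0 ≤ x → (x ^ p) ^ (k + 1) = x ^ (p * (s.factorial : ℝ)) := by
    intro x hx
    rw [← Real.rpow_natCast, ← Real.rpow_mul hx, hk]
  -- The midpoint inequality multiplied by `2 ^ p` has deficit coefficient `2 ^ p * κ`; the power
  -- inequality needs a coefficient at most `1`.
  set κ₁ := min (2 ^ p * κ) 1 with hκ₁
  have hκ₁0 : 0 < κ₁ := lt_min (by positivity) one_pos
  -- the horizontal part is controlled by `N`
  have hhor : ∀ x, euclNorm (G.comp 1 x) ^ p ≤ C₄ ^ p * C₂ * N x := by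
    intro x
    calc euclNorm (G.comp 1 x) ^ p ≤ (C₄ * ρ x) ^ p := by
          refine Real.rpow_le_rpow (euclNorm_nonneg _) ?_ hp.le
          exact (by simpa using G.euclNorm_comp_le_gauge_pow 1 x : _ ≤ G.gauge x).trans (h₄ x)
      _ = C₄ ^ p * ρ x ^ p := Real.mul_rpow hC₄.le (hρ.nonneg x)
      _ ≤ C₄ ^ p * (C₂ * N x) := mul_le_mul_of_nonneg_left (hN₂ x) (by positivity)
      _ = _ := by ring
  -- a bound for the distance in terms of the deficits `e` and `e'`
  have hdist : ∃ C, 0 < C ∧ ∀ (a b : L) (e e' : ℝ), 0 ≤ e → 0 ≤ e' →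
      G.nonhoriz s ρ a ^ p ≤ e → G.nonhoriz s ρ b ^ p ≤ e' →
      euclNorm (G.comp 1 a - G.comp 1 b) ^ p ≤ 2 ^ p * (e + e') →
      ρ (bch s (-a) b) ^ (p * (s.factorial : ℝ))
        ≤ C * (e * (N a + e) ^ k + e' * (N b + e') ^ k) := by
    -- From `|a₁| + |b₁| ≤ 2 |a₁| + |a₁ - b₁|`, with `|a₁|^p ≤ C₄^p C₂ N(a)` and `|a₁ - b₁|^p ≤ 2^p
    -- · 2 e`.
    set M := 2 ^ p * (2 ^ p * (C₄ ^ p * C₂) + 2 ^ p * 2) with hM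
    have hM0 : 0 ≤ M := by positivity
    have hR : ∀ (a b : L) (e : ℝ), 0 ≤ e → euclNorm (G.comp 1 a - G.comp 1 b) ^ p ≤ 2 ^ p * (2 * e) →
        (euclNorm (G.comp 1 a) + euclNorm (G.comp 1 b)) ^ p ≤ M * (N a + e) := by
      intro a b e he hab
      have hb : euclNorm (G.comp 1 b)
          ≤ euclNorm (G.comp 1 a) + euclNorm (G.comp 1 a - G.comp 1 b) := by
        simpa using euclNorm_sub_le (G.comp 1 a) (G.comp 1 a - G.comp 1 b)
      have ha0 := euclNorm_nonneg (G.comp 1 a)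
      have hb0 := euclNorm_nonneg (G.comp 1 b)
      have hd0 := euclNorm_nonneg (G.comp 1 a - G.comp 1 b)
      calc _ ≤ (2 * euclNorm (G.comp 1 a) + euclNorm (G.comp 1 a - G.comp 1 b)) ^ p :=
            Real.rpow_le_rpow (by positivity) (by linarith) hp.le
        _ ≤ 2 ^ p * ((2 * euclNorm (G.comp 1 a)) ^ p + euclNorm (G.comp 1 a - G.comp 1 b) ^ p) :=
            Real.add_rpow_le_two_rpow_mul (by positivity) hd0 hp.le
        _ ≤ 2 ^ p * (2 ^ p * (C₄ ^ p * C₂ * N a) + 2 ^ p * (2 * e)) := by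
            rw [Real.mul_rpow (by norm_num) ha0]
            gcongr
            exact hhor a
        _ ≤ _ := by
            rw [hM, mul_assoc (2 ^ p) (2 ^ p * (C₄ ^ p * C₂) + 2 ^ p * 2)]
            refine mul_le_mul_of_nonneg_left ?_ h2p.le
            have h1 : 0 ≤ 2 ^ p * (C₄ ^ p * C₂) * e := by positivity
            have h2 : 0 ≤ 2 ^ p * 2 * N a := mul_nonneg (by positivity) (hN0 a)
            linarith
    refine ⟨(C₃ + 1) * (2 + 2 ^ p * 2 * M ^ k), by positivity, ?_⟩
    intro a b e e' he he' hae hbe hab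
    have hNa := hN0 a
    have hNb := hN0 b
    set X := e * (N a + e) ^ k with hX
    set Y := e' * (N b + e') ^ k with hY
    have hX0 : 0 ≤ X := by positivity
    have hY0 : 0 ≤ Y := by positivity
    have hd0 := euclNorm_nonneg (G.comp 1 a - G.comp 1 b)
    have ha0 := euclNorm_nonneg (G.comp 1 a)
    have hb0 := euclNorm_nonneg (G.comp 1 b)
    have t1 : (G.nonhoriz s ρ a ^ p) ^ (k + 1) ≤ X := by
      have := Real.rpow_nonneg (nonhoriz_nonneg (s := s) hρ a) p
      rw [pow_succ']
      exact mul_le_mul hae (pow_le_pow_left₀ this (by linarith) k) (pow_nonneg this _) he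
    have t2 : (G.nonhoriz s ρ b ^ p) ^ (k + 1) ≤ Y := by
      have := Real.rpow_nonneg (nonhoriz_nonneg (s := s) hρ b) p
      rw [pow_succ']
      exact mul_le_mul hbe (pow_le_pow_left₀ this (by linarith) k) (pow_nonneg this _) he'
    -- The larger of the two deficits bounds `|a₁ - b₁|^p`, and the scale is then measured at the
    -- corresponding point.
    have t3 : euclNorm (G.comp 1 a - G.comp 1 b) ^ p
          * ((euclNorm (G.comp 1 a) + euclNorm (G.comp 1 b)) ^ p) ^ k
          ≤ 2 ^ p * 2 * M ^ k * (X + Y) := by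
      rcases le_total e' e with hee | hee
      · have hab' : euclNorm (G.comp 1 a - G.comp 1 b) ^ p ≤ 2 ^ p * (2 * e) :=
          hab.trans (by gcongr; linarith)
        calc _ ≤ 2 ^ p * (2 * e) * (M * (N a + e)) ^ k := by
              have := hR a b e he hab'
              gcongr
          _ = 2 ^ p * 2 * M ^ k * X := by rw [hX, mul_pow]; ring
          _ ≤ _ := by gcongr; linarith
      · have hab' : euclNorm (G.comp 1 a - G.comp 1 b) ^ p ≤ 2 ^ p * (2 * e') :=
          hab.trans (by gcongr; linarith)
        calc _ ≤ 2 ^ p * (2 * e') * (M * (N b + e')) ^ k := by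
              have := hR b a e' he' (by rwa [euclNorm_sub_rev])
              rw [add_comm] at this
              gcongr
          _ = 2 ^ p * 2 * M ^ k * Y := by rw [hY, mul_pow]; ring
          _ ≤ _ := by gcongr; linarith
    calc _ ≤ C₃ * (X + Y + 2 ^ p * 2 * M ^ k * (X + Y)) := (h₃ a b).trans (by gcongr)
      _ ≤ (C₃ + 1) * (2 * (X + Y) + 2 ^ p * 2 * M ^ k * (X + Y)) := by
          gcongr <;> linarith
      _ = _ := by ring
  obtain ⟨C₅, hC₅, h₅⟩ := hdist
  refine isMarkovConvex_of_four_point (N := fun x => N x ^ (k + 1)) (C := C₁ ^ (k + 1))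
    (κ := κ₁ ^ (k + 1) / C₅) hs hρ (by positivity) (hN.pow _) (fun x => pow_nonneg (hN0 x) _)
    (by positivity) (fun x => ?_) (by positivity) (fun x y z w => ?_)
  · rw [← hpow _ (hρ.nonneg x), ← mul_pow]
    exact pow_le_pow_left₀ (hN0 x) (hN₁ x) _
  -- The midpoint inequality raised to the power `k + 1 = s!`, with convexity of that power on the
  -- right.
  · have hmid' : ∀ u v : L, N (bch s u v) ^ (k + 1) + κ₁ ^ (k + 1)
          * ((euclNorm (G.comp 1 u - G.comp 1 v) ^ p + G.nonhoriz s ρ (bch s u v) ^ p)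
          * (N (bch s u v)
            + (euclNorm (G.comp 1 u - G.comp 1 v) ^ p + G.nonhoriz s ρ (bch s u v) ^ p)) ^ k)
        ≤ 2 ^ (p * (s.factorial : ℝ)) * ((N u ^ (k + 1) + N v ^ (k + 1)) / 2) := by
      intro u v
      have he : 0 ≤ euclNorm (G.comp 1 u - G.comp 1 v) ^ p + G.nonhoriz s ρ (bch s u v) ^ p :=
        add_nonneg (Real.rpow_nonneg (euclNorm_nonneg _) _)
          (Real.rpow_nonneg (nonhoriz_nonneg hρ _) _)
      have hm := hmid u v
      set e := euclNorm (G.comp 1 u - G.comp 1 v) ^ p + G.nonhoriz s ρ (bch s u v) ^ p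
      refine (pow_succ_add_le_add_pow_succ (hN0 _) he hκ₁0.le (min_le_right _ _) k).trans ?_
      rw [← hpow 2 (by norm_num)]
      refine le_trans ?_ (mul_le_mul_of_nonneg_left (half_add_pow_le (hN0 u) (hN0 v) k)
        (by positivity))
      rw [← mul_pow]
      refine pow_le_pow_left₀ (add_nonneg (hN0 _) (by positivity)) ?_ _
      calc N (bch s u v) + κ₁ * e ≤ N (bch s u v) + 2 ^ p * κ * e := by
            gcongr
            exact min_le_left _ _
        _ = 2 ^ p * (N (bch s u v) / 2 ^ p + κ * e) := by field_simp
        _ ≤ _ := by gcongr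
    rw [leftInvDist, G.bch_neg_eq hs x z w]
    have hz := hmid' (bch s (-x) y) (bch s (-y) z)
    have hw := hmid' (bch s (-x) y) (bch s (-y) w)
    rw [← G.bch_neg_trans hs] at hz hw
    set a := bch s (-x) z with ha
    set b := bch s (-x) w with hb
    have ha1 : G.comp 1 a = G.comp 1 (bch s (-x) y) + G.comp 1 (bch s (-y) z) := by
      rw [← G.comp_one_bch hs, ← G.bch_neg_trans hs]
    have hb1 : G.comp 1 b = G.comp 1 (bch s (-x) y) + G.comp 1 (bch s (-y) w) := by
      rw [← G.comp_one_bch hs, ← G.bch_neg_trans hs]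
    set u1 := G.comp 1 (bch s (-x) y)
    set v1 := G.comp 1 (bch s (-y) z)
    set w1 := G.comp 1 (bch s (-y) w)
    have hna := Real.rpow_nonneg (nonhoriz_nonneg (s := s) hρ a) p
    have hnb := Real.rpow_nonneg (nonhoriz_nonneg (s := s) hρ b) p
    have hEa := Real.rpow_nonneg (euclNorm_nonneg (u1 - v1)) p
    have hEb := Real.rpow_nonneg (euclNorm_nonneg (u1 - w1)) p
    -- The horizontal part of `x⁻¹ y` is common to `a` and `b`, so `a₁ - b₁` is the difference of
    -- the two deviations `u₁ - w₁` and `u₁ - v₁`.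
    have hΔ : euclNorm (G.comp 1 a - G.comp 1 b) ^ p
        ≤ 2 ^ p * (euclNorm (u1 - v1) ^ p + euclNorm (u1 - w1) ^ p) := by
      refine le_trans ?_ (Real.add_rpow_le_two_rpow_mul (euclNorm_nonneg _) (euclNorm_nonneg _) hp.le)
      refine Real.rpow_le_rpow (euclNorm_nonneg _) ?_ hp.le
      rw [ha1, hb1, show u1 + v1 - (u1 + w1) = (u1 - w1) - (u1 - v1) by abel, add_comm]
      exact euclNorm_sub_le _ _
    have h5 := h₅ a b _ _ (add_nonneg hEa hna) (add_nonneg hEb hnb) (by linarith) (by linarith)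
      (hΔ.trans (by gcongr <;> linarith))
    set X := (euclNorm (u1 - v1) ^ p + G.nonhoriz s ρ a ^ p)
      * (N a + (euclNorm (u1 - v1) ^ p + G.nonhoriz s ρ a ^ p)) ^ k
    set Y := (euclNorm (u1 - w1) ^ p + G.nonhoriz s ρ b ^ p)
      * (N b + (euclNorm (u1 - w1) ^ p + G.nonhoriz s ρ b ^ p)) ^ k
    have h6 : κ₁ ^ (k + 1) / C₅ * ρ (bch s (-a) b) ^ (p * (s.factorial : ℝ))
        ≤ κ₁ ^ (k + 1) * (X + Y) := by
      rw [div_mul_eq_mul_div, div_le_iff₀ hC₅]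
      calc _ ≤ κ₁ ^ (k + 1) * (C₅ * (X + Y)) := by gcongr
        _ = _ := by ring
    linarith

end LieGrading

/-! ### The convexity hypothesis of (1) -/

theorem InnerProductSpace.Core.exists_norm_le_sqrt_inner {E : Type*} [AddCommGroup E] [Module ℝ E]
    [FiniteDimensional ℝ E] (ip : InnerProductSpace.Core ℝ E) {F : Type*} [NormedAddCommGroup F]
    [NormedSpace ℝ F] (T : E →ₗ[ℝ] F) : ∃ C, 0 ≤ C ∧ ∀ x, ‖T x‖ ≤ C * √(ip.inner x x) := by
  let _ : NormedAddCommGroup E := ip.toNormedAddCommGroup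
  let _ : InnerProductSpace ℝ E := InnerProductSpace.ofCore ip.toCore
  exact ⟨‖T.toContinuousLinearMap‖, ContinuousLinearMap.opNorm_nonneg _, fun x => T.toContinuousLinearMap.le_opNorm x⟩

namespace LieGrading

variable {L : Type v} [LieRing L] [LieAlgebra ℝ L] [FiniteDimensional ℝ L] {G : LieGrading L}
  [TopologicalSpace L] [IsTopologicalAddGroup L] [ContinuousSMul ℝ L] [T2Space L]
  {s : ℕ}

theorem isMarkovConvex_of_satisfiesConvexity (hs : LieModule.lowerCentralSeries ℝ L L s = ⊥)
    {ρ : L → ℝ} (hρ : G.IsHomogeneousNorm ρ) (ip : InnerProductSpace.Core ℝ L)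
    {p K : ℝ} (hp : 1 ≤ p) (hK : 1 ≤ K) (h : G.SatisfiesConvexity s ρ ip p K) :
    IsMarkovConvex.{u} (leftInvDist s ρ) (p * (s.factorial : ℝ)) := by
  obtain ⟨C, hC, hip⟩ := ip.exists_norm_le_sqrt_inner (toEuclidean (E := L)).toLinearEquiv.toLinearMap
  have hp0 : 0 < p := by linarith
  -- `C` compares the two Euclidean norms, and `2` undoes the halving in the midpoint `(x₁ + z₁) /
  -- 2`.
  set M := max ((2 * C) ^ p) 1 with hM
  have hM0 : 0 < M := by positivity
  refine isMarkovConvex_of_midpoint (N := fun x => ρ x ^ p) (C₁ := 1) (C₂ := 1)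
    (κ := 1 / K * M⁻¹) hs hρ hp0 (hρ.continuous.rpow_const fun _ => Or.inr hp0.le)
    (fun x => Real.rpow_nonneg (hρ.nonneg x) _) zero_le_one zero_le_one (fun x => by rw [one_mul])
    (fun x => by rw [one_mul]) (by positivity) fun u v => ?_
  -- With `x = u⁻¹`, `y` the identity and `z = v`, the three distances are `ρ(u)`, `ρ(v)` and
  -- `ρ(uv)`.
  have h1 := h (-u) 0 v
  simp only [leftInvDist, neg_neg, neg_zero, G.bch_zero hs, G.zero_bch hs, horiz_eq, map_zero, sub_zero,
    map_neg] at h1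
  refine le_trans ?_ h1
  rw [Real.div_rpow (hρ.nonneg _) (by norm_num), mul_assoc]
  set y := (1 / 2 : ℝ) • (-G.comp 1 u + G.comp 1 v)
  have h2 : euclNorm (G.comp 1 u - G.comp 1 v) ≤ 2 * C * √(ip.inner y y) := by
    have h3 : G.comp 1 u - G.comp 1 v = (-2 : ℝ) • y := by
      simp only [y, smul_smul]
      rw [show (-2 : ℝ) * (1 / 2) = -1 by norm_num, neg_one_smul]
      abel
    have h4 := hip y
    rw [h3, euclNorm_smul, mul_assoc]
    norm_num
    exact h4
  have h5 : euclNorm (G.comp 1 u - G.comp 1 v) ^ p ≤ M * √(ip.inner y y) ^ p := by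
    calc _ ≤ (2 * C * √(ip.inner y y)) ^ p := Real.rpow_le_rpow (euclNorm_nonneg _) h2 hp0.le
      _ = (2 * C) ^ p * √(ip.inner y y) ^ p := Real.mul_rpow (by positivity) (Real.sqrt_nonneg _)
      _ ≤ _ := by
        gcongr
        exact le_max_left _ _
  have h6 : G.nonhoriz s ρ (bch s u v) ^ p ≤ M * G.nonhoriz s ρ (bch s u v) ^ p :=
    le_mul_of_one_le_left (Real.rpow_nonneg (nonhoriz_nonneg hρ _) _) (le_max_right _ _)
  gcongr
  rw [inv_mul_le_iff₀ hM0, mul_add]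
  exact add_le_add h5 h6

/-! ### Layer by layer construction of a convex homogeneous function -/

variable (G) in
/-- The deviation of the pair `(u, v)` from being a pair of equal horizontal elements, in the first
`j` layers. -/
noncomputable def deviation (j : ℕ) (u v : L) : ℝ :=
  euclNorm (G.comp 1 u - G.comp 1 v)
    + ∑ i ∈ Finset.Icc 2 j, (euclNorm (G.comp i u) + euclNorm (G.comp i v))

theorem sum_deviation_nonneg (j : ℕ) (u v : L) :
    0 ≤ ∑ i ∈ Finset.Icc 2 j, (euclNorm (G.comp i u) + euclNorm (G.comp i v)) :=
  Finset.sum_nonneg fun _ _ => add_nonneg (euclNorm_nonneg _) (euclNorm_nonneg _)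

theorem deviation_nonneg (j : ℕ) (u v : L) : 0 ≤ G.deviation j u v :=
  add_nonneg (euclNorm_nonneg _) (sum_deviation_nonneg j u v)

theorem euclNorm_sub_le_deviation (j : ℕ) (u v : L) :
    euclNorm (G.comp 1 u - G.comp 1 v) ≤ G.deviation j u v :=
  le_add_of_nonneg_right (sum_deviation_nonneg j u v)

theorem deviation_succ {j : ℕ} (hj : 1 ≤ j) (u v : L) :
    G.deviation (j + 1) u v
      = G.deviation j u v + (euclNorm (G.comp (j + 1) u) + euclNorm (G.comp (j + 1) v)) := by
  rw [deviation, deviation, Finset.sum_Icc_succ_top (by omega), add_assoc]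

/-- The deviation is not homogeneous, but for `t ≤ 2` every power `t^i` with `1 ≤ i ≤ j` is at most
`2^j t`. -/
theorem deviation_dilation_le (j : ℕ) {t : ℝ} (ht : 0 ≤ t) (ht2 : t ≤ 2) (u v : L) :
    G.deviation j (G.dilation t u) (G.dilation t v) ≤ 2 ^ j * t * G.deviation j u v := by
  have hi : ∀ i, 1 ≤ i → i ≤ j → t ^ i ≤ 2 ^ j * t := by
    intro i hi hij
    obtain ⟨k, rfl⟩ := Nat.exists_eq_add_of_le hi
    rw [add_comm, pow_succ]
    gcongr
    calc t ^ k ≤ 2 ^ k := pow_le_pow_left₀ ht ht2 k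
      _ ≤ 2 ^ j := pow_le_pow_right₀ (by norm_num) (by omega)
  simp only [deviation, comp_dilation, ← smul_sub, euclNorm_smul, abs_of_nonneg (pow_nonneg ht _),
    mul_add, Finset.mul_sum, pow_one]
  have h2j : (1 : ℝ) ≤ 2 ^ j := one_le_pow₀ (by norm_num)
  refine add_le_add ?_ (Finset.sum_le_sum fun i hi' => ?_)
  · refine mul_le_mul_of_nonneg_right ?_ (euclNorm_nonneg _)
    rw [abs_of_nonneg ht]
    exact le_mul_of_one_le_left ht h2j
  · obtain ⟨h1, h2⟩ := Finset.mem_Icc.1 hi'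
    have := hi i (by omega) h2
    exact add_le_add (mul_le_mul_of_nonneg_right this (euclNorm_nonneg _))
      (mul_le_mul_of_nonneg_right this (euclNorm_nonneg _))

theorem deviation_le {j : ℕ} (hj : 1 ≤ j) {B : ℝ} {u v : L} (hu : ∀ i ≤ j, euclNorm (G.comp i u) ≤ B)
    (hv : ∀ i ≤ j, euclNorm (G.comp i v) ≤ B) : G.deviation j u v ≤ (j + 1) * (B + B) := by
  have hB : 0 ≤ B := (euclNorm_nonneg _).trans (hu 1 hj)
  have h1 : ∑ i ∈ Finset.Icc 2 j, (euclNorm (G.comp i u) + euclNorm (G.comp i v))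
      ≤ j * (B + B) := by
    calc _ ≤ ∑ i ∈ Finset.Icc 2 j, (B + B) := Finset.sum_le_sum fun i hi =>
          add_le_add (hu i (Finset.mem_Icc.1 hi).2) (hv i (Finset.mem_Icc.1 hi).2)
      _ = ((j + 1 - 2 : ℕ) : ℝ) * (B + B) := by
        rw [Finset.sum_const, Nat.card_Icc, nsmul_eq_mul]
      _ ≤ _ := by
        gcongr
        omega
  have h2 := (euclNorm_sub_le (G.comp 1 u) (G.comp 1 v)).trans (add_le_add (hu 1 hj) (hv 1 hj))
  rw [deviation]
  linarith

omit [FiniteDimensional ℝ L] [TopologicalSpace L] [IsTopologicalAddGroup L] [ContinuousSMul ℝ L]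
  [T2Space L] in
theorem below_succ_sub (j : ℕ) (hj : 1 ≤ j) (x : L) :
    G.below (j + 1) x - G.comp 1 x = ∑ i ∈ Finset.Icc 2 j, G.comp i x := by
  refine G.ext_comp fun k => ?_
  rw [map_sub, comp_below, map_sum]
  simp only [comp_comp, Finset.sum_ite_eq', Finset.mem_Icc]
  rcases Nat.eq_zero_or_pos k with rfl | hk
  · simp [comp_zero]
  · by_cases h1 : 1 = k
    · subst h1
      rw [if_pos (by omega), if_pos rfl, if_neg (by omega), sub_self]
    · rw [if_neg h1, sub_zero]
      by_cases h2 : k < j + 1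
      · rw [if_pos h2, if_pos (by omega)]
      · rw [if_neg h2, if_neg (by omega)]

/-- In bounded regions, the product is close to that of two equal horizontal elements. -/
theorem exists_euclNorm_bch_below_sub_le (hs : LieModule.lowerCentralSeries ℝ L L s = ⊥) {j : ℕ}
    (hj : 1 ≤ j) (B : ℝ) : ∃ C, 0 ≤ C ∧ ∀ u v : L, (∀ i ≤ j, euclNorm (G.comp i u) ≤ B) →
      (∀ i ≤ j, euclNorm (G.comp i v) ≤ B) →
      euclNorm (bch s (G.below (j + 1) u) (G.below (j + 1) v) - (G.comp 1 u + G.comp 1 u))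
        ≤ C * G.deviation j u v := by
  obtain ⟨C, hC, h⟩ := exists_euclNorm_bch_sub_le (L := L) s ((j + 1) * B)
  refine ⟨C, hC, fun u v hu hv => ?_⟩
  have hB : 0 ≤ B := (euclNorm_nonneg _).trans (hu 1 hj)
  have hsum : ∀ x, (∀ i ≤ j, euclNorm (G.comp i x) ≤ B) →
      euclNorm (G.below (j + 1) x) ≤ (j + 1) * B := by
    intro x hx
    rw [← sub_add_cancel (G.below (j + 1) x) (G.comp 1 x), below_succ_sub j hj]
    have h1 : euclNorm (∑ i ∈ Finset.Icc 2 j, G.comp i x) ≤ j * B := by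
      calc _ ≤ ∑ i ∈ Finset.Icc 2 j, B := (euclNorm_sum_le _ _).trans
            (Finset.sum_le_sum fun i hi => hx i (Finset.mem_Icc.1 hi).2)
        _ = ((j + 1 - 2 : ℕ) : ℝ) * B := by simp
        _ ≤ _ := by
          gcongr
          omega
    have := euclNorm_add_le (∑ i ∈ Finset.Icc 2 j, G.comp i x) (G.comp 1 x)
    have := hx 1 hj
    linarith
  have hu1 : euclNorm (G.comp 1 u) ≤ (j + 1) * B :=
    (hu 1 hj).trans (le_mul_of_one_le_left hB (by linarith [(Nat.cast_nonneg j : (0 : ℝ) ≤ j)]))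
  have key := h (G.below (j + 1) u) (G.below (j + 1) v) (G.comp 1 u) (G.comp 1 u)
    (G.deviation j u v) (hsum u hu) (hsum v hv) hu1 hu1
  -- The comparison point is the pair `(u₁, u₁)`, whose product `u₁ + u₁` has no component above the
  -- first layer.
  rw [G.bch_self hs] at key
  refine key ?_ ?_
  · rw [below_succ_sub j hj]
    refine (euclNorm_sum_le _ _).trans ?_
    rw [deviation]
    refine le_add_of_nonneg_of_le (euclNorm_nonneg _) (Finset.sum_le_sum fun i _ => ?_)
    exact le_add_of_nonneg_right (euclNorm_nonneg _)
  · rw [show G.below (j + 1) v - G.comp 1 u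
      = (G.comp 1 v - G.comp 1 u) + (G.below (j + 1) v - G.comp 1 v) by abel, below_succ_sub j hj]
    refine (euclNorm_add_le _ _).trans ?_
    rw [deviation, euclNorm_sub_rev]
    refine add_le_add le_rfl ((euclNorm_sum_le _ _).trans (Finset.sum_le_sum fun i _ => ?_))
    exact le_add_of_nonneg_left (euclNorm_nonneg _)

variable (G) (s) in
/-- `F` is a homogeneous function of the first `j` layers, of degree `m`, with a quantitative
convexity property along midpoints. -/
structure IsLayerConvex (j : ℕ) (F : L → ℝ) (m : ℕ) (c B : ℝ) : Prop where
  continuous : Continuous F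
  nonneg : ∀ x, 0 ≤ F x
  degree_pos : 0 < m
  const_pos : 0 < c
  dilation : ∀ (t : ℝ) x, 0 ≤ t → F (G.dilation t x) = t ^ m * F x
  bounded : ∀ x, F x ≤ 1 → ∀ i ≤ j, euclNorm (G.comp i x) ≤ B
  midpoint : ∀ u v, F u + F v ≤ 1 → F (bch s u v) / 2 ^ m + c * G.deviation j u v ^ m ≤ (F u + F v) / 2

namespace IsLayerConvex

variable {j : ℕ} {F : L → ℝ} {m : ℕ} {c B : ℝ} (h : G.IsLayerConvex s j F m c B)

include h

/-- Powers raise the degree of `F` while the deviation keeps its exponent `m`. With `F u + F v = 1`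
the left side of the midpoint inequality is at most `1/2`, so one factor carries the deficit and the
other `k` are replaced by `1/2`. -/
theorem pow_midpoint (k : ℕ) {u v : L} (huv : F u + F v = 1) :
    F (bch s u v) ^ (k + 1) / 2 ^ (m * (k + 1)) + c / 2 ^ k * G.deviation j u v ^ m
      ≤ (F u ^ (k + 1) + F v ^ (k + 1)) / 2 := by
  refine le_trans ?_ (half_add_pow_le (h.nonneg u) (h.nonneg v) k)
  have h1 := h.midpoint u v huv.le
  rw [huv] at h1 ⊢
  have h2 : 0 ≤ c * G.deviation j u v ^ m :=
    mul_nonneg h.const_pos.le (pow_nonneg (deviation_nonneg j u v) m)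
  have h3 : 0 ≤ F (bch s u v) / 2 ^ m := div_nonneg (h.nonneg _) (by positivity)
  rw [pow_mul, ← div_pow]
  set b := F (bch s u v) / 2 ^ m
  have h4 : b ^ k ≤ (1 / 2) ^ k := pow_le_pow_left₀ h3 (by linarith) k
  calc b ^ (k + 1) + c / 2 ^ k * G.deviation j u v ^ m
      = b * b ^ k + c * G.deviation j u v ^ m * (1 / 2) ^ k := by
        rw [one_div_pow]; ring
    _ ≤ b * (1 / 2) ^ k + c * G.deviation j u v ^ m * (1 / 2) ^ k := by gcongr
    _ = (b + c * G.deviation j u v ^ m) * (1 / 2) ^ k := by ring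
    _ ≤ 1 / 2 * (1 / 2) ^ k := by gcongr
    _ = _ := (pow_succ' _ _).symm

/-- The zero set of `F` is invariant under dilations, which would make a nonzero component unbounded
on `F ≤ 1`. -/
theorem comp_eq_zero {x : L} (hx : F x = 0) {i : ℕ} (hi : i ≤ j) : G.comp i x = 0 := by
  rcases Nat.eq_zero_or_pos i with rfl | hi0
  · exact G.comp_zero x
  rw [← euclNorm_eq_zero]
  by_contra hne
  have hpos : 0 < euclNorm (G.comp i x) := lt_of_le_of_ne (euclNorm_nonneg _) (Ne.symm hne)
  have hB : 0 ≤ B := (euclNorm_nonneg _).trans (h.bounded x (hx.trans_le zero_le_one) i hi)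
  set t := B / euclNorm (G.comp i x) + 1 with ht
  have ht1 : 1 ≤ t := le_add_of_nonneg_left (by positivity)
  have h1 := h.bounded (G.dilation t x)
    (by rw [h.dilation _ _ (by linarith), hx, mul_zero]; exact zero_le_one) i hi
  rw [comp_dilation, euclNorm_smul, abs_of_nonneg (by positivity)] at h1
  have h2 : t ≤ t ^ i := le_self_pow₀ ht1 (by omega)
  have h3 : t * euclNorm (G.comp i x) = B + euclNorm (G.comp i x) := by
    rw [ht]
    field_simp
  nlinarith

theorem exists_dilation_eq {u v : L} (huv : F u + F v ≠ 0) : ∃ t u' v', 0 < t ∧ t ^ m = F u + F v ∧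
    G.dilation t u' = u ∧ G.dilation t v' = v ∧ F u' + F v' = 1 := by
  have h0 : 0 < F u + F v := lt_of_le_of_ne (add_nonneg (h.nonneg u) (h.nonneg v)) (Ne.symm huv)
  set t := (F u + F v) ^ ((m : ℝ)⁻¹) with ht
  have ht0 : 0 < t := by positivity
  have htm : t ^ m = F u + F v := Real.rpow_inv_natCast_pow h0.le h.degree_pos.ne'
  refine ⟨t, G.dilation t⁻¹ u, G.dilation t⁻¹ v, ht0, htm, G.dilation_inv_dilation ht0.ne' u,
    G.dilation_inv_dilation ht0.ne' v, ?_⟩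
  rw [h.dilation _ _ (by positivity), h.dilation _ _ (by positivity), ← mul_add, ← htm, ← mul_pow,
    inv_mul_cancel₀ ht0.ne', one_pow]

end IsLayerConvex

/-- The parallelogram identity, with equality. -/
theorem isLayerConvex_one (hs : LieModule.lowerCentralSeries ℝ L L s = ⊥) :
    G.IsLayerConvex s 1 (fun x => euclNorm (G.comp 1 x) ^ 2) 2 (1 / 4) 1 where
  continuous := (continuous_euclNorm.comp (G.continuous_comp 1)).pow 2
  nonneg x := sq_nonneg _
  degree_pos := by norm_num
  const_pos := by norm_num
  dilation t x ht := by
    rw [comp_dilation, euclNorm_smul, abs_of_nonneg (by positivity)]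
    ring
  bounded x hx i hi := by
    rcases Nat.le_one_iff_eq_zero_or_eq_one.1 hi with rfl | rfl
    · simp [comp_zero]
    · exact (sq_le_one_iff₀ (euclNorm_nonneg _)).1 hx
  midpoint u v _ := by
    have := euclNorm_parallelogram (G.comp 1 u) (G.comp 1 v)
    simp only [G.comp_one_bch hs, deviation, Finset.Icc_eq_empty (show ¬2 ≤ 1 by norm_num),
      Finset.sum_empty, add_zero]
    linarith

end LieGrading

theorem add_add_pow_le {a b d : ℝ} (ha : 0 ≤ a) (hb : 0 ≤ b) (hd : 0 ≤ d) {m : ℕ} (hm : 0 < m) :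
    (a + b + d) ^ m ≤ 4 ^ m * ((a ^ m + b ^ m) / 4 + d ^ m) := by
  obtain ⟨k, rfl⟩ := Nat.exists_eq_add_of_le' hm
  have h1 := add_pow_le (add_nonneg ha hb) hd (k + 1)
  have h2 := add_pow_le ha hb (k + 1)
  rw [Nat.add_sub_cancel] at h1 h2
  have h3 : (2 : ℝ) ^ k ≤ 4 ^ (k + 1) := by
    calc (2 : ℝ) ^ k ≤ 4 ^ k := by gcongr; norm_num
      _ ≤ 4 ^ (k + 1) := pow_le_pow_right₀ (by norm_num) (by omega)
  calc (a + b + d) ^ (k + 1) ≤ 2 ^ k * ((a + b) ^ (k + 1) + d ^ (k + 1)) := h1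
    _ ≤ 2 ^ k * (2 ^ k * (a ^ (k + 1) + b ^ (k + 1)) + d ^ (k + 1)) := by gcongr
    _ = 4 ^ (k + 1) * ((a ^ (k + 1) + b ^ (k + 1)) / 4) + 2 ^ k * d ^ (k + 1) := by
      rw [show (4 : ℝ) = 2 * 2 by norm_num, mul_pow, pow_succ]; ring
    _ ≤ _ := by
      rw [mul_add]
      gcongr

theorem pow_le_pow_mul_pow_of_le {D M : ℝ} (hD : 0 ≤ D) (hDM : D ≤ M) (hM : 1 ≤ M) {m m' : ℕ}
    (hmm : m ≤ m') : D ^ m' ≤ M ^ m' * D ^ m := by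
  obtain ⟨k, rfl⟩ := Nat.exists_eq_add_of_le' hmm
  calc D ^ (k + m) = D ^ k * D ^ m := pow_add _ _ _
    _ ≤ M ^ k * D ^ m := by gcongr
    _ ≤ _ := by
      exact mul_le_mul_of_nonneg_right (pow_le_pow_right₀ hM (Nat.le_add_right k m)) (by positivity)

namespace LieGrading

variable {L : Type v} [LieRing L] [LieAlgebra ℝ L] [FiniteDimensional ℝ L] {G : LieGrading L}
  [TopologicalSpace L] [IsTopologicalAddGroup L] [ContinuousSMul ℝ L] [T2Space L]
  {s : ℕ} (hs : LieModule.lowerCentralSeries ℝ L L s = ⊥)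

include hs

/-- Adding a small multiple of a power of the `(j + 1)`-st component preserves the midpoint convexity. -/
theorem IsLayerConvex.exists_add_midpoint {j : ℕ} (hj : 1 ≤ j) {F : L → ℝ} {m : ℕ} {c B : ℝ}
    (h : G.IsLayerConvex s j F m c B) : ∃ ε c', 0 < ε ∧ 0 < c' ∧ ∀ u v, F u ≤ 1 → F v ≤ 1 →
      F (bch s u v) ^ (j + 1) / 2 ^ (m * (j + 1)) + c / 2 ^ j * G.deviation j u v ^ m
        ≤ (F u ^ (j + 1) + F v ^ (j + 1)) / 2 →
      (F (bch s u v) ^ (j + 1) + ε * euclNorm (G.comp (j + 1) (bch s u v)) ^ m) / 2 ^ (m * (j + 1))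
        + c' * (G.deviation j u v ^ m
          + (euclNorm (G.comp (j + 1) u) ^ m + euclNorm (G.comp (j + 1) v) ^ m))
        ≤ ((F u ^ (j + 1) + ε * euclNorm (G.comp (j + 1) u) ^ m)
          + (F v ^ (j + 1) + ε * euclNorm (G.comp (j + 1) v) ^ m)) / 2 := by
  obtain ⟨C, hC, hlip⟩ := exists_euclNorm_bch_below_sub_le (G := G) hs hj B
  obtain ⟨C₁, hC₁, hcomp⟩ := G.exists_euclNorm_comp_le
  have hc := h.const_pos
  set Q := (C₁ * C) ^ m
  have hQ : 0 ≤ Q := by positivity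
  set c₀ := c / 2 ^ j
  have hc₀ : 0 < c₀ := by positivity
  -- Chosen so that the error `ε Q d^m` created by the lower layers uses at most half of the
  -- available deficit `c₀ d^m`.
  set ε := c₀ / (2 * (Q + 1)) with hε
  have hε0 : 0 < ε := by positivity
  have hεQ : ε * Q ≤ c₀ / 2 := by
    rw [hε, div_mul_eq_mul_div, div_le_div_iff₀ (by positivity) (by norm_num)]
    nlinarith
  refine ⟨ε, min (c₀ / 2) (ε / 4), hε0, by positivity, fun u v hu hv huv => ?_⟩
  have hd := deviation_nonneg (G := G) j u v
  have ha := euclNorm_nonneg (G.comp (j + 1) u)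
  have hb := euclNorm_nonneg (G.comp (j + 1) v)
  set d := G.deviation j u v
  have hw : euclNorm (G.comp (j + 1) (bch s u v))
      ≤ euclNorm (G.comp (j + 1) u) + euclNorm (G.comp (j + 1) v) + C₁ * C * d := by
    rw [G.comp_bch hs]
    refine (euclNorm_add_le _ _).trans (add_le_add (euclNorm_add_le _ _) ?_)
    have h1 := hlip u v (h.bounded u hu) (h.bounded v hv)
    have h2 := hcomp (j + 1)
      (bch s (G.below (j + 1) u) (G.below (j + 1) v) - (G.comp 1 u + G.comp 1 u))
    rw [map_sub, map_add, comp_comp, if_neg (by omega), add_zero, sub_zero] at h2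
    rw [mul_assoc]
    exact h2.trans (mul_le_mul_of_nonneg_left h1 hC₁)
  set a := euclNorm (G.comp (j + 1) u)
  set b := euclNorm (G.comp (j + 1) v)
  have hw' : euclNorm (G.comp (j + 1) (bch s u v)) ^ m / 2 ^ (m * (j + 1))
      ≤ (a ^ m + b ^ m) / 4 + Q * d ^ m := by
    -- Layer `j + 1 ≥ 2` is scaled by at least `4` under doubling. This leaves `1/4` where convexity
    -- allows `1/2`, so `ε / 4` remains as deficit for the new components.
    have h4 : (4 : ℝ) ^ m ≤ 2 ^ (m * (j + 1)) := by
      rw [show (4 : ℝ) = 2 ^ 2 by norm_num, ← pow_mul]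
      refine pow_le_pow_right₀ (by norm_num) ?_
      rw [mul_comm]
      exact Nat.mul_le_mul_left m (by omega)
    rw [div_le_iff₀ (by positivity), ← mul_pow]
    calc _ ≤ (a + b + C₁ * C * d) ^ m := pow_le_pow_left₀ (euclNorm_nonneg _) hw m
      _ ≤ 4 ^ m * ((a ^ m + b ^ m) / 4 + (C₁ * C * d) ^ m) :=
        add_add_pow_le ha hb (by positivity) h.degree_pos
      _ ≤ 2 ^ (m * (j + 1)) * ((a ^ m + b ^ m) / 4 + (C₁ * C * d) ^ m) := by gcongr
      _ = _ := mul_comm _ _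
  have hdm : 0 ≤ d ^ m := by positivity
  have ham : 0 ≤ a ^ m := by positivity
  have hbm : 0 ≤ b ^ m := by positivity
  rw [add_div, mul_div_assoc]
  have h5 := mul_le_mul_of_nonneg_left hw' hε0.le
  have h6 := mul_le_mul_of_nonneg_right hεQ hdm
  have h7 := mul_le_mul_of_nonneg_right (min_le_left (c₀ / 2) (ε / 4)) hdm
  have h8 := mul_le_mul_of_nonneg_right (min_le_right (c₀ / 2) (ε / 4)) (add_nonneg ham hbm)
  linarith

/-- Both summands of `F'` have degree `m (j + 1)`. The powered inequality is available only when `F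
u + F v = 1`, so a general pair is normalized by a dilation; pairs with `F u + F v = 0` are treated
directly. -/
theorem IsLayerConvex.exists_succ {j : ℕ} (hj : 1 ≤ j) {F : L → ℝ} {m : ℕ} {c B : ℝ}
    (h : G.IsLayerConvex s j F m c B) : ∃ F' m' c' B', G.IsLayerConvex s (j + 1) F' m' c' B' := by
  obtain ⟨ε, c₁, hε, hc₁, hmid⟩ := h.exists_add_midpoint hs hj
  have hF := h.nonneg
  have hm := h.degree_pos
  set M := max ((j + 1) * (B + B)) 1
  have hM1 : 1 ≤ M := le_max_right _ _
  set B₁ := max 1 ε⁻¹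
  have hB₁ : 1 ≤ B₁ := le_max_left _ _
  set m' := m * (j + 1) with hm'
  have hmm' : m ≤ m' := Nat.le_mul_of_pos_right m (by omega)
  -- For `u = δ_t u'`, `v = δ_t v'` with deviation `D ≤ M` of `(u', v')`, the deviation of `(u, v)`
  -- is at most `2^j t D`, and `D^m' ≤ M^m' D^m`.
  set K := (2 ^ j) ^ m' * M ^ m' with hK
  have hK0 : 0 < K := by positivity
  set F' : L → ℝ := fun x => F x ^ (j + 1) + ε * euclNorm (G.comp (j + 1) x) ^ m with hF'
  have hF'1 : ∀ x, F' x ≤ 1 → F x ≤ 1 := by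
    intro x hx
    have : 0 ≤ ε * euclNorm (G.comp (j + 1) x) ^ m :=
      mul_nonneg hε.le (pow_nonneg (euclNorm_nonneg _) _)
    exact (pow_le_one_iff_of_nonneg (n := j + 1) (hF x) j.succ_ne_zero).1 (by simp only [hF'] at hx; linarith)
  have hF'2 : ∀ x, F' x ≤ 1 → euclNorm (G.comp (j + 1) x) ≤ B₁ := by
    intro x hx
    rcases le_total (euclNorm (G.comp (j + 1) x)) 1 with h1 | h1
    · exact h1.trans (le_max_left _ _)
    · refine le_trans ?_ (le_max_right _ _)
      have h2 : 0 ≤ F x ^ (j + 1) := pow_nonneg (hF x) _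
      have h3 := le_self_pow₀ h1 hm.ne'
      rw [le_inv_comm₀ (by linarith) hε, ← one_div, le_div_iff₀ (by linarith)]
      have h4 := mul_le_mul_of_nonneg_left h3 hε.le
      simp only [hF'] at hx
      linarith
  have hF'0 : ∀ x, 0 ≤ F' x := fun x => add_nonneg (pow_nonneg (hF x) _)
    (mul_nonneg hε.le (pow_nonneg (euclNorm_nonneg _) _))
  have hF'δ : ∀ (t : ℝ) x, 0 ≤ t → F' (G.dilation t x) = t ^ m' * F' x := by
    intro t x ht
    simp only [hF', h.dilation t x ht, comp_dilation, euclNorm_smul, abs_of_nonneg (pow_nonneg ht _),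
      mul_pow, ← pow_mul, hm', mul_comm (j + 1) m]
    ring
  refine ⟨F', m', c₁ / (4 ^ m' * (K + B₁ ^ m')), max B B₁, ⟨?_, hF'0, by positivity, by positivity,
    hF'δ, ?_, ?_⟩⟩
  · exact (h.continuous.pow _).add
      (continuous_const.mul ((continuous_euclNorm.comp (G.continuous_comp _)).pow _))
  · intro x hx i hi
    rcases Nat.lt_or_ge j i with hij | hij
    · rw [show i = j + 1 by omega]
      exact (hF'2 x hx).trans (le_max_right _ _)
    · exact (h.bounded x (hF'1 x hx) i hij).trans (le_max_left _ _)
  · intro u v huv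
    have hu' : F' u ≤ 1 := by linarith [hF'0 v]
    have hv' : F' v ≤ 1 := by linarith [hF'0 u]
    have hu := hF'1 u hu'
    have hv := hF'1 v hv'
    have hd := deviation_nonneg (G := G) j u v
    have ha := euclNorm_nonneg (G.comp (j + 1) u)
    have hb := euclNorm_nonneg (G.comp (j + 1) v)
    suffices H : ∃ Y, 0 ≤ Y ∧ G.deviation j u v ^ m' ≤ K * Y ∧ F' (bch s u v) / 2 ^ m'
        + c₁ * (Y + (euclNorm (G.comp (j + 1) u) ^ m + euclNorm (G.comp (j + 1) v) ^ m))
        ≤ (F' u + F' v) / 2 by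
      obtain ⟨Y, hY, hdY, hle⟩ := H
      refine le_trans (add_le_add le_rfl ?_) hle
      rw [div_mul_eq_mul_div, div_le_iff₀ (by positivity), mul_assoc]
      refine mul_le_mul_of_nonneg_left ?_ hc₁.le
      rw [deviation_succ hj, add_comm (G.deviation j u v)]
      have h1 := pow_le_pow_mul_pow_of_le ha (hF'2 u hu') hB₁ hmm'
      have h2 := pow_le_pow_mul_pow_of_le hb (hF'2 v hv') hB₁ hmm'
      set a := euclNorm (G.comp (j + 1) u)
      set b := euclNorm (G.comp (j + 1) v)
      have ham : 0 ≤ a ^ m := by positivity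
      have hbm : 0 ≤ b ^ m := by positivity
      have hBm : 0 ≤ B₁ ^ m' := by positivity
      calc _ ≤ 4 ^ m' * ((a ^ m' + b ^ m') / 4 + G.deviation j u v ^ m') :=
            add_add_pow_le ha hb hd (by positivity)
        _ ≤ 4 ^ m' * (B₁ ^ m' * (a ^ m + b ^ m) + K * Y) := by
            gcongr
            have := mul_nonneg hBm (add_nonneg ham hbm)
            linarith
        _ ≤ 4 ^ m' * ((Y + (a ^ m + b ^ m)) * (K + B₁ ^ m')) := by
            gcongr
            have := mul_nonneg hBm hY
            have := mul_nonneg hK0.le (add_nonneg ham hbm)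
            linarith
        _ = _ := by ring
    -- No dilation can normalize this pair, but all its lower-layer terms vanish and only the new
    -- layer remains.
    by_cases h0 : F u + F v = 0
    · have hd0 : G.deviation j u v = 0 := by
        have h1 := h.midpoint u v (by linarith)
        have h2 : 0 ≤ F (bch s u v) / 2 ^ m := div_nonneg (hF _) (by positivity)
        have h3 : c * G.deviation j u v ^ m = 0 :=
          le_antisymm (by linarith) (mul_nonneg h.const_pos.le (pow_nonneg hd _))
        exact pow_eq_zero_iff hm.ne' |>.1 ((mul_eq_zero.1 h3).resolve_left h.const_pos.ne')
      have hz : F (bch s u v) = 0 := by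
        have h1 := h.midpoint u v (by linarith)
        rw [h0, zero_div, hd0, zero_pow hm.ne', mul_zero, add_zero,
          div_le_iff₀ (by positivity), zero_mul] at h1
        exact le_antisymm h1 (hF _)
      refine ⟨0, le_rfl, by rw [hd0, zero_pow (by positivity), mul_zero], ?_⟩
      have := hmid u v hu hv (by
        rw [hz, hd0, zero_pow hm.ne', zero_pow (by omega), mul_zero, zero_div, add_zero]
        exact div_nonneg (add_nonneg (pow_nonneg (hF u) _) (pow_nonneg (hF v) _)) (by norm_num))
      rwa [hd0, zero_pow hm.ne'] at this
    · obtain ⟨t, u', v', ht, htm, rfl, rfl, h1⟩ := h.exists_dilation_eq h0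
      have hu1 : F u' ≤ 1 := by linarith [hF v']
      have hv1 : F v' ≤ 1 := by linarith [hF u']
      have ht2 : t ≤ 2 := by
        by_contra! ht2
        have := le_self_pow₀ (by linarith : 1 ≤ t) hm.ne'
        linarith
      have hD := deviation_nonneg (G := G) j u' v'
      have hDM : G.deviation j u' v' ≤ M :=
        (deviation_le hj (h.bounded u' hu1) (h.bounded v' hv1)).trans (le_max_left _ _)
      refine ⟨t ^ m' * G.deviation j u' v' ^ m, by positivity, ?_, ?_⟩
      · calc _ ≤ (2 ^ j * t * G.deviation j u' v') ^ m' :=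
              pow_le_pow_left₀ hd (deviation_dilation_le j ht.le ht2 u' v') _
          _ = (2 ^ j) ^ m' * t ^ m' * G.deviation j u' v' ^ m' := by rw [mul_pow, mul_pow]
          _ ≤ (2 ^ j) ^ m' * t ^ m' * (M ^ m' * G.deviation j u' v' ^ m) := by
              have := pow_le_pow_mul_pow_of_le hD hDM hM1 hmm'
              gcongr
          _ = _ := by rw [hK]; ring
      · have h2 := mul_le_mul_of_nonneg_left (hmid u' v' hu1 hv1 (h.pow_midpoint j h1))
          (pow_nonneg ht.le m')
        rw [← G.dilation_bch, hF'δ _ _ ht.le, hF'δ _ _ ht.le, hF'δ _ _ ht.le]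
        have h3 : ∀ x, euclNorm (G.comp (j + 1) (G.dilation t x)) ^ m
            = t ^ m' * euclNorm (G.comp (j + 1) x) ^ m := by
          intro x
          rw [comp_dilation, euclNorm_smul, abs_of_nonneg (pow_nonneg ht.le _), mul_pow, ← pow_mul,
            mul_comm (j + 1) m]
        rw [h3, h3]
        calc _ = t ^ m' * (F' (bch s u' v') / 2 ^ m' + c₁ * (G.deviation j u' v' ^ m
              + (euclNorm (G.comp (j + 1) u') ^ m + euclNorm (G.comp (j + 1) v') ^ m))) := by ring
          _ ≤ t ^ m' * ((F' u' + F' v') / 2) := h2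
          _ = _ := by ring

theorem exists_isLayerConvex {j : ℕ} (hj : 1 ≤ j) : ∃ F m c B, G.IsLayerConvex s j F m c B := by
  induction j, hj using Nat.le_induction with
  | base => exact ⟨_, _, _, _, isLayerConvex_one hs⟩
  | succ j hj ih =>
    obtain ⟨F, m, c, B, h⟩ := ih
    exact h.exists_succ hs hj

end LieGrading

/-! ### Nontrivial Markov convexity -/

namespace LieGrading

variable {L : Type v} [LieRing L] [LieAlgebra ℝ L] [FiniteDimensional ℝ L] {G : LieGrading L}
  [TopologicalSpace L] [IsTopologicalAddGroup L] [ContinuousSMul ℝ L] [T2Space L]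
  {s : ℕ} (hs : LieModule.lowerCentralSeries ℝ L L s = ⊥) {ρ : L → ℝ} (hρ : G.IsHomogeneousNorm ρ)

omit [FiniteDimensional ℝ L] [IsTopologicalAddGroup L] [ContinuousSMul ℝ L] [T2Space L] in
theorem nonhoriz_dilation (hρ : G.IsHomogeneousNorm ρ) {t : ℝ} (ht : 0 ≤ t) (x : L) :
    G.nonhoriz s ρ (G.dilation t x) = t * G.nonhoriz s ρ x := by
  have h : -G.comp 1 (G.dilation t x) = G.dilation t (-G.comp 1 x) := by
    refine G.ext_comp fun j => ?_
    rw [comp_dilation, comp_dilation, map_neg, map_neg, map_smul, comp_comp, smul_neg]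
    split_ifs with hj
    · rw [← hj]
    · rw [smul_zero, smul_zero]
  rw [nonhoriz_eq, nonhoriz_eq, h, ← G.dilation_bch, hρ.dilation _ _ ht]

omit [TopologicalSpace L] [IsTopologicalAddGroup L] [ContinuousSMul ℝ L] [T2Space L] in
theorem below_eq_self (x : L) : G.below (G.height + 2) x = x := by
  refine G.ext_comp fun j => ?_
  rw [comp_below]
  split_ifs with hj
  · rfl
  · rw [G.comp_eq_zero_of_height_lt (by omega)]

/-- For `t ≤ 1` the worst of the roots `t^(1/j)` is bounded by `t^(1/(h+1))` with `h` the height; `h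
+ 1` keeps the exponent meaningful for `h = 0`. -/
theorem gauge_pow_le {x : L} {t T : ℝ} (ht : 0 ≤ t) (ht1 : t ≤ 1) (hT : 1 ≤ T)
    (h : ∀ j, euclNorm (G.comp j x) ≤ T * t) :
    G.gauge x ^ (G.height + 1) ≤ (G.height * T) ^ (G.height + 1) * t := by
  have h1 : G.gauge x ≤ G.height * T * t ^ (((G.height + 1 : ℕ) : ℝ)⁻¹) := by
    calc G.gauge x ≤ ∑ j ∈ Finset.Icc 1 G.height, T * t ^ (((G.height + 1 : ℕ) : ℝ)⁻¹) := by
          refine Finset.sum_le_sum fun j hj => ?_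
          obtain ⟨hj1, hjh⟩ := Finset.mem_Icc.1 hj
          have hj0 : (0 : ℝ) < j := by exact_mod_cast hj1
          have h2 : (((G.height + 1 : ℕ) : ℝ)⁻¹) ≤ (j : ℝ)⁻¹ := by
            gcongr
            omega
          calc _ ≤ (T * t) ^ ((j : ℝ)⁻¹) :=
                Real.rpow_le_rpow (euclNorm_nonneg _) (h j) (by positivity)
            _ = T ^ ((j : ℝ)⁻¹) * t ^ ((j : ℝ)⁻¹) := Real.mul_rpow (by linarith) ht
            _ ≤ T * t ^ (((G.height + 1 : ℕ) : ℝ)⁻¹) := by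
              refine mul_le_mul ?_ ?_ (by positivity) (by linarith)
              · calc T ^ ((j : ℝ)⁻¹) ≤ T ^ (1 : ℝ) :=
                      Real.rpow_le_rpow_of_exponent_le hT
                        (inv_le_one_of_one_le₀ (by exact_mod_cast hj1))
                  _ = T := Real.rpow_one T
              · exact Real.rpow_le_rpow_of_exponent_ge_of_imp ht ht1 h2 fun _ h => by
                  have : j = 0 := by simpa using h
                  omega
      _ = _ := by
          rw [Finset.sum_const, Nat.card_Icc, nsmul_eq_mul, Nat.add_sub_cancel]
          ring
  calc _ ≤ (G.height * T * t ^ (((G.height + 1 : ℕ) : ℝ)⁻¹)) ^ (G.height + 1) :=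
        pow_le_pow_left₀ (G.gauge_nonneg x) h1 _
    _ = _ := by rw [mul_pow, Real.rpow_inv_natCast_pow ht (by omega)]

include hs hρ

/-- In bounded regions, the vertical part of a product is controlled by the deviation of the factors. -/
theorem exists_nonhoriz_pow_le (B : ℝ) : ∃ K, 0 ≤ K ∧ ∀ u v : L,
    (∀ i ≤ G.height + 1, euclNorm (G.comp i u) ≤ B) →
    (∀ i ≤ G.height + 1, euclNorm (G.comp i v) ≤ B) →
    G.nonhoriz s ρ (bch s u v) ^ (G.height + 1) ≤ K * G.deviation (G.height + 1) u v := by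
  obtain ⟨C₀, hC₀, h₀⟩ := exists_euclNorm_bch_below_sub_le (G := G) (j := G.height + 1) hs (by omega) B
  obtain ⟨C₁, hC₁, h₁⟩ := G.exists_euclNorm_comp_le
  obtain ⟨C₂, hC₂, h₂⟩ := hρ.exists_le_gauge
  set M := max (((G.height + 1 : ℕ) + 1) * (B + B)) 1
  have hM : 1 ≤ M := le_max_right _ _
  obtain ⟨C₃, hC₃, h₃⟩ := exists_euclNorm_bch_sub_le (L := L) s
    ((1 + C₁) * (B + B + C₀ * M))
  -- The second factor is the Lipschitz constant for the components of `w₁⁻¹ w` in terms of `d`; the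
  -- factor `M` compensates for the normalization `t = d / M ≤ 1`.
  set T := M * (1 + C₁ * (C₃ * ((1 + C₁) * C₀)))
  have hT : 1 ≤ T := by
    have : 0 ≤ C₁ * (C₃ * ((1 + C₁) * C₀)) := by positivity
    exact one_le_mul_of_one_le_of_one_le hM (by linarith)
  refine ⟨C₂ ^ (G.height + 1) * (G.height * T) ^ (G.height + 1), by positivity, fun u v hu hv => ?_⟩
  have hB : 0 ≤ B := (euclNorm_nonneg _).trans (hu 1 (by omega))
  have hd := deviation_nonneg (G := G) (G.height + 1) u v
  have hdM : G.deviation (G.height + 1) u v ≤ M :=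
    (deviation_le (by omega) hu hv).trans (le_max_left _ _)
  have hw := h₀ u v hu hv
  rw [below_eq_self, below_eq_self] at hw
  set d := G.deviation (G.height + 1) u v
  set w := bch s u v
  set e := G.comp 1 u + G.comp 1 u with he_def
  have he1 : G.comp 1 e = e := by rw [he_def, map_add, comp_comp, if_pos rfl]
  have he : euclNorm e ≤ B + B :=
    (euclNorm_add_le _ _).trans (add_le_add (hu 1 (by omega)) (hu 1 (by omega)))
  have hw1 : euclNorm (G.comp 1 w - e) ≤ C₁ * (C₀ * d) := by
    have := h₁ 1 (w - e)
    rw [map_sub, he1] at this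
    exact this.trans (mul_le_mul_of_nonneg_left hw hC₁)
  have hCd : C₀ * d ≤ C₀ * M := mul_le_mul_of_nonneg_left hdM hC₀
  have hCd0 : 0 ≤ C₀ * d := mul_nonneg hC₀ hd
  have hwR : euclNorm w ≤ B + B + C₀ * M := by
    have := euclNorm_add_le e (w - e)
    rw [add_sub_cancel] at this
    linarith
  have hR0 : 0 ≤ B + B + C₀ * M := by positivity
  have hR : ∀ r, r ≤ B + B + C₀ * M → r ≤ (1 + C₁) * (B + B + C₀ * M) := fun r hr =>
    hr.trans (le_mul_of_one_le_left hR0 (by linarith))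
  have hwR1 : euclNorm (G.comp 1 w) ≤ (1 + C₁) * (B + B + C₀ * M) := by
    have := (h₁ 1 w).trans (mul_le_mul_of_nonneg_left hwR hC₁)
    linarith
  have h4 : euclNorm (bch s (-G.comp 1 w) w) ≤ C₃ * ((1 + C₁) * C₀ * d) := by
    have h5 : euclNorm e ≤ (1 + C₁) * (B + B + C₀ * M) :=
      hR _ (he.trans (le_add_of_nonneg_right (by positivity)))
    have := h₃ (-G.comp 1 w) w (-e) e ((1 + C₁) * C₀ * d) (by rwa [euclNorm_neg]) (hR _ hwR)
      (by rwa [euclNorm_neg]) h5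
      (by
        rw [neg_sub_neg, euclNorm_sub_rev]
        nlinarith)
      (by nlinarith [mul_nonneg hC₁ hCd0])
    rwa [G.neg_bch_self hs, sub_zero] at this
  have h6 : G.gauge (bch s (-G.comp 1 w) w) ^ (G.height + 1)
      ≤ (G.height * T) ^ (G.height + 1) * (d / M) := by
    refine gauge_pow_le (div_nonneg hd (by linarith)) ((div_le_one (by linarith)).2 hdM) hT
      fun j => (h₁ j _).trans ((mul_le_mul_of_nonneg_left h4 hC₁).trans ?_)
    have h7 : T * (d / M) = (1 + C₁ * (C₃ * ((1 + C₁) * C₀))) * d := by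
      simp only [T]
      field_simp
    rw [h7]
    linarith
  calc G.nonhoriz s ρ w ^ (G.height + 1) ≤ (C₂ * G.gauge (bch s (-G.comp 1 w) w)) ^ (G.height + 1) := by
        rw [nonhoriz_eq]
        exact pow_le_pow_left₀ (hρ.nonneg _) (h₂ _) _
    _ = C₂ ^ (G.height + 1) * G.gauge (bch s (-G.comp 1 w) w) ^ (G.height + 1) := mul_pow _ _ _
    _ ≤ C₂ ^ (G.height + 1) * ((G.height * T) ^ (G.height + 1) * d) := by
        refine mul_le_mul_of_nonneg_left (h6.trans ?_) (by positivity)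
        exact mul_le_mul_of_nonneg_left (div_le_self hd hM) (by positivity)
    _ = _ := by ring

/-- Every graded nilpotent Lie group has nontrivial Markov convexity. -/
theorem exists_isMarkovConvex : ∃ q : ℝ, 0 < q ∧ IsMarkovConvex.{u} (leftInvDist s ρ) q := by
  obtain ⟨F, m, c, B, h⟩ := exists_isLayerConvex (G := G) (j := G.height + 1) hs (by omega)
  have hF := h.nonneg
  have hm := h.degree_pos
  have hc := h.const_pos
  -- Only `NH(uv)^(h+1)`, with `h` the height, is linear in the deviation. Hence `F` is raised to
  -- the power `h + 1`, making the degree `n = m (h + 1)`, while the deficit stays at deviation to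
  -- the power `m`.
  set n := m * (G.height + 1) with hn
  have hn0 : n ≠ 0 := by positivity
  set N : L → ℝ := fun x => F x ^ (G.height + 1) with hN
  have hNc : Continuous N := h.continuous.pow _
  have hN0 : ∀ x, 0 ≤ N x := fun x => pow_nonneg (hF x) _
  have hNδ : ∀ (t : ℝ) x, 0 ≤ t → N (G.dilation t x) = t ^ n * N x := by
    intro t x ht
    simp only [hN, h.dilation t x ht, mul_pow, ← pow_mul, hn]
  have hF0 : ∀ x, F x = 0 → x = 0 := by
    intro x hx
    refine G.ext_comp fun j => ?_
    rw [map_zero]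
    rcases Nat.lt_or_ge G.height j with hj | hj
    · exact G.comp_eq_zero_of_height_lt hj x
    · exact h.comp_eq_zero hx (by omega)
  obtain ⟨C₁, hC₁, h₁⟩ := exists_le_gauge_pow hNc hn0 hNδ
  obtain ⟨C₂, hC₂, h₂⟩ := exists_gauge_pow_le hNc hn0 hNδ fun x hx =>
    pow_pos (lt_of_le_of_ne (hF x) fun h0 => hx (hF0 x h0.symm)) _
  obtain ⟨C₃, hC₃, h₃⟩ := hρ.exists_gauge_le
  obtain ⟨C₄, hC₄, h₄⟩ := hρ.exists_le_gauge
  obtain ⟨K, hK, h₅⟩ := exists_nonhoriz_pow_le hs hρ B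
  set M := max (((G.height + 1 : ℕ) + 1) * (B + B)) 1
  have hM : 1 ≤ M := le_max_right _ _
  -- The deficit left by `pow_midpoint`, divided by the sum of the constants bounding `|u₁ - v₁|^n`
  -- and `NH(uv)^n` by the `m`-th power of the deviation.
  set κ := c / 2 ^ G.height / (M ^ n + K ^ m) with hκ
  have hκ0 : 0 < κ := by positivity
  have hsf : (0 : ℝ) < s.factorial := by exact_mod_cast s.factorial_pos
  refine ⟨(n : ℝ) * s.factorial, by positivity, isMarkovConvex_of_midpoint (N := N)
    (C₁ := C₁ * C₃ ^ n) (C₂ := C₄ ^ n * C₂) (κ := κ) hs hρ (by positivity) hNc hN0 (by positivity)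
    (by positivity) (fun x => ?_) (fun x => ?_) hκ0 fun u v => ?_⟩
  · rw [Real.rpow_natCast, mul_assoc, ← mul_pow]
    exact (h₁ x).trans (mul_le_mul_of_nonneg_left
      (pow_le_pow_left₀ (G.gauge_nonneg x) (h₃ x) n) hC₁.le)
  · rw [Real.rpow_natCast]
    calc ρ x ^ n ≤ (C₄ * G.gauge x) ^ n := pow_le_pow_left₀ (hρ.nonneg x) (h₄ x) n
      _ = C₄ ^ n * G.gauge x ^ n := mul_pow _ _ _
      _ ≤ C₄ ^ n * (C₂ * N x) := mul_le_mul_of_nonneg_left (h₂ x) (by positivity)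
      _ = _ := by ring
  · simp only [Real.rpow_natCast]
    by_cases h0 : F u + F v = 0
    · have hu : u = 0 := hF0 u (le_antisymm (by linarith [hF v]) (hF u))
      have hv : v = 0 := hF0 v (le_antisymm (by linarith [hF u]) (hF v))
      subst hu
      rw [hv, G.bch_zero hs, nonhoriz_eq]
      have hFz : F 0 = 0 := by rw [hv] at h0; linarith
      simp [G.bch_zero hs, hρ.zero, hN, hFz, hn0]
    · obtain ⟨t, u', v', ht, -, rfl, rfl, h1⟩ := h.exists_dilation_eq h0
      have hu := h.bounded u' (by linarith [hF v'])
      have hv := h.bounded v' (by linarith [hF u'])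
      have hmid := h.pow_midpoint G.height h1
      have hd := deviation_nonneg (G := G) (G.height + 1) u' v'
      have hdM : G.deviation (G.height + 1) u' v' ≤ M :=
        (deviation_le (by omega) hu hv).trans (le_max_left _ _)
      have h6 : euclNorm (G.comp 1 u' - G.comp 1 v') ^ n
          ≤ M ^ n * G.deviation (G.height + 1) u' v' ^ m :=
        (pow_le_pow_left₀ (euclNorm_nonneg _) (euclNorm_sub_le_deviation _ u' v') n).trans
          (pow_le_pow_mul_pow_of_le hd hdM hM (Nat.le_mul_of_pos_right m (by omega)))
      have h7 : G.nonhoriz s ρ (bch s u' v') ^ n ≤ K ^ m * G.deviation (G.height + 1) u' v' ^ m := by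
        rw [hn, mul_comm m, pow_mul, ← mul_pow]
        exact pow_le_pow_left₀ (pow_nonneg (nonhoriz_nonneg hρ _) _) (h₅ u' v' hu hv) m
      have h8 : N (bch s u' v') / 2 ^ n + κ * (euclNorm (G.comp 1 u' - G.comp 1 v') ^ n
          + G.nonhoriz s ρ (bch s u' v') ^ n) ≤ (N u' + N v') / 2 := by
        refine le_trans (add_le_add le_rfl ?_) hmid
        rw [hκ, div_mul_eq_mul_div, div_le_iff₀ (by positivity), mul_assoc]
        refine mul_le_mul_of_nonneg_left ?_ (by positivity)
        linarith
      have h9 := mul_le_mul_of_nonneg_left h8 (pow_nonneg ht.le n)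
      rw [← G.dilation_bch, hNδ _ _ ht.le, hNδ _ _ ht.le, hNδ _ _ ht.le, nonhoriz_dilation hρ ht.le,
        comp_dilation, comp_dilation, pow_one, ← smul_sub, euclNorm_smul, abs_of_pos ht, mul_pow,
        mul_pow]
      calc _ = _ := by ring
        _ ≤ _ := h9
        _ = _ := by ring

end LieGrading

theorem theorem7p3 {L : Type v} [LieRing L] [LieAlgebra ℝ L] [FiniteDimensional ℝ L]
    [TopologicalSpace L] [IsTopologicalAddGroup L] [ContinuousSMul ℝ L] [T2Space L]
    (G : LieGrading L) (s : ℕ) (hs : LieModule.lowerCentralSeries ℝ L L s = ⊥)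
    (ρ : L → ℝ) (hρ : G.IsHomogeneousNorm ρ) :
    (∀ (ip : InnerProductSpace.Core ℝ L) (p K : ℝ), 1 ≤ p → 1 ≤ K →
        G.SatisfiesConvexity s ρ ip p K →
        IsMarkovConvex.{u} (leftInvDist s ρ) (p * (Nat.factorial s : ℝ))) ∧
      ∃ q : ℝ, 0 < q ∧ IsMarkovConvex.{u} (leftInvDist s ρ) q :=
  ⟨fun ip _ _ hp hK h => G.isMarkovConvex_of_satisfiesConvexity hs hρ ip hp hK h,
    LieGrading.exists_isMarkovConvex hs hρ⟩
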